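/- Let $M(1)=\mathbb C[h(-1),h(-2),\dots]$ be the Fock space of the Heisenberg algebra $[h(m),h(n)]=m\,\delta_{m+n,0}$ (with $h(0)=0$), let $F=\bigwedge(\varphi(-\tfrac12),\varphi(-\tfrac32),\dots)$ be the Fock space of the free fermion $[\varphi(m),\varphi(n)]_+=\delta_{m+n,0}$, $m,n\in\mathbb Z+\tfrac12$, and let $W=M(1)\otimes F$. With normal ordering $:\ :$, put for $r\ge 0$ $$\bar L^{(r)}(0)=\tfrac12\sum_{k\in\mathbb Z}(-k)^r k^r :h(k)h(-k): +(-1)^r\tfrac{\zeta(-2r-1)}2,$$ $$\bar{\mathcal L}^{(r)}(0)=\tfrac12\sum_{k\in\mathbb Z+\frac12}(-k)^{r+1}k^r :\varphi(k)\varphi(-k): +(-1)^{r+1}\tfrac{\zeta(-2r-1,\frac12)}2,$$ and $L_{2r+1}=(-1)^r\bigl(\bar L^{(r)}(0)\otimes 1+1\otimes\bar{\mathcal L}^{(r)}(0)\bigr)$ on $W$. Let $q_j=e^{2\pi i\tau_j}$, $q=q_1$, $\tau=\tau_1\in\mathbb H$, $D=\frac1{2\pi i}\frac{d}{d\tau}$.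 The generalized character $W(\tau_1,\tau_3,\dots)=\operatorname{tr}_W q_1^{L_1}q_3^{L_3}q_5^{L_5}\cdots$ is expanded as a formal power series in $\tau_3,\tau_5,\dots$ whose coefficients are functions of $\tau_1$: $$W(\tau_1,\tau_3,\dots)=\sum_I m_I(\tau_1)\frac{\tau^I}{|I|!},\qquad \tau^I=\prod_{j=3,5,\dots}\tau_j^{a_j},\quad |I|=\sum_j a_j,\quad \mathrm{wt}(I)=4a_3+6a_5+8a_7+\cdots$$ (each $\tau_j$ has weight $j+1$). $M(\tau_1,\tau_3,\dots)$ and $F(\tau_1,\tau_3,\dots)$ denote the characters of the two factors, defined in the same way with $(-1)^r\bar L^{(r)}(0)$ on $M(1)$ and $(-1)^r\bar{\mathcal L}^{(r)}(0)$ on $F$. A quasimodular form is the constant term (with respect to $1/\operatorname{Im}\tau$) of an almost holomorphic modular form $\sum_{j\le p}g_j(\tau)(\operatorname{Im}\tau)^{-j}$ with holomorphic $g_j$. In integral weight, with trivial multiplier, the $g_j$ are required to be of moderate growth (holomorphy at the cusps). A series as above is called quasimodular of weight $k\in\frac12\mathbb Z$ on $\Gamma$ if there is one unitary multiplier system $v$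 of weight $k$ on $\Gamma$ such that every $m_I$ is quasimodular of weight $k+\mathrm{wt}(I)$ on $\Gamma$ with multiplier $v$, poles at the cusps being allowed. Theorem. On each of $M(1)$, $F$, $W$ the Cartan operators are simultaneously diagonalizable with finite-dimensional simultaneous eigenspaces, the traces defining the coefficients of the characters converge absolutely, and $W(\tau_1,\tau_3,\dots)=M(\tau_1,\tau_3,\dots)F(\tau_1,\tau_3,\dots)$. Moreover: (1) $W(\tau_1,\tau_3,\dots)$ is quasimodular of weight $-\tfrac12$ on $\Gamma(4)$. More precisely, $m_0(\tau)=\dfrac{\eta(\tau)}{\eta(2\tau)\eta(\tau/2)}$, and every $m_I/m_0$ is a quasimodular form of weight $\mathrm{wt}(I)$ on $\Gamma(4)$ with trivial multiplier, holomorphic at the cusps. (2) $F(\tau_1,0,0,\dots)=\dfrac{\eta(\tau)^2}{\eta(2\tau)\eta(\tau/2)}$. Put $G_k(q)=\tfrac{\zeta(1-k)}2+\sum_{n\ge1}\bigl(\sum_{d\mid n}d^{k-1}\bigr)q^n$ and $F^{(2)}_k(q)=G_k(q^{1/2})-2^{k-1}G_k(q)$. For all $s\ge0$ and all $I$ with $(s,I)\ne(0,0)$,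 $$\frac{1}{(2\pi i)^{s+|I|}}\,\partial_{\tau_1}^{s}\prod_{j\ge3}\partial_{\tau_j}^{a_j}\log F\Big|_{\tau_3=\tau_5=\cdots=0}=D^{\,s+|I|-1}\left(\frac{F^{(2)}_{2K}(q)}{2^{2K-1}}-\frac{F^{(2)}_{2K}(q^2)}{2^{2K-2}}\right),\qquad 2K=2+\sum_{j\ge3}(j-1)a_j,$$ and this is a quasimodular form of weight $2s+\mathrm{wt}(I)$ on $\Gamma(4)$ (trivial multiplier, holomorphic at the cusps). -/

import Mathlib

open scoped TensorProduct MatrixGroups Manifold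

noncomputable section

namespace FreeFieldCharacter

/-! ## Locally finite sums of operators -/

/-- The sum of a family of operators of which only finitely many act non-trivially on each given
vector. -/
def locallyFiniteSum {V : Type} [AddCommGroup V] [Module ℂ V] {ι : Type}
    (f : ι → Module.End ℂ V) (hf : ∀ v, {i | f i v ≠ 0}.Finite) : Module.End ℂ V where
  toFun v := ∑ᶠ i, f i v
  map_add' v w := by
    simp only [map_add]
    exact finsum_add_distrib (hf v) (hf w)
  map_smul' c v := by
    simp only [map_smul, RingHom.id_apply]
    exact (smul_finsum' c (hf v)).symm

/-! ## The bosonic Fock space `M(1)` -/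

/-- `M(1) = ℂ[h(-1), h(-2), …]`; the variable with index `n` is `h(-(n+1))`. -/
abbrev BosonFock : Type := MvPolynomial ℕ ℂ

/-- The Heisenberg modes: `h(-n)` is multiplication by the variable `h(-n)`, `h(n)` is
`n ∂/∂h(-n)` for `n ≥ 1`, and `h(0) = 0`. -/
def hMode : ℤ → Module.End ℂ BosonFock
  | Int.ofNat 0 => 0
  | Int.ofNat (n + 1) => ((n : ℂ) + 1) • (MvPolynomial.pderiv n).toLinearMap
  | Int.negSucc n => LinearMap.mulLeft ℂ (MvPolynomial.X n)

/-- The normally ordered product `:h(m)h(n):`. -/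
def hNormal (m n : ℤ) : Module.End ℂ BosonFock :=
  if m ≤ n then hMode m * hMode n else hMode n * hMode m

theorem hNormal_finite (c : ℤ → ℂ) (v : BosonFock) :
    {k : ℤ | (c k • hNormal k (-k)) v ≠ 0}.Finite := by
  have key : ∀ n : ℕ, n ∉ v.vars →
      (hNormal (Int.ofNat (n + 1)) (-(Int.ofNat (n + 1)))) v = 0 ∧
      (hNormal (Int.negSucc n) (-(Int.negSucc n))) v = 0 := by
    intro n hn
    have hp := MvPolynomial.pderiv_eq_zero_of_notMem_vars hn
    have h1 : ¬ (Int.ofNat (n + 1) ≤ -(Int.ofNat (n + 1))) := by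
      simp only [Int.ofNat_eq_natCast]; omega
    have h2 : Int.negSucc n ≤ -(Int.negSucc n) := by omega
    have h3 : -(Int.negSucc n) = Int.ofNat (n + 1) := by simp [Int.neg_negSucc]
    refine ⟨?_, ?_⟩
    · rw [hNormal, if_neg h1, Module.End.mul_apply]
      simp [hMode, hp]
    · rw [hNormal, if_pos h2, Module.End.mul_apply, h3]
      simp [hMode, hp]
  refine Set.Finite.subset
    (((v.vars.image (fun n : ℕ => Int.ofNat (n + 1))) ∪
      (v.vars.image Int.negSucc) ∪ {0} : Finset ℤ).finite_toSet) ?_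
  intro k hk
  simp only [Set.mem_ofPred_eq, LinearMap.smul_apply] at hk
  simp only [Finset.coe_union, Finset.coe_image, Finset.coe_singleton, Set.mem_union,
    Set.mem_image, Finset.mem_coe, Set.mem_singleton_iff]
  match k, hk with
  | Int.ofNat 0, _ => exact Or.inr rfl
  | Int.ofNat (n + 1), hk =>
    refine Or.inl (Or.inl ⟨n, ?_, rfl⟩)
    by_contra hn
    exact hk (by rw [(key n hn).1, smul_zero])
  | Int.negSucc n, hk =>
    refine Or.inl (Or.inr ⟨n, ?_, rfl⟩)
    by_contra hn
    exact hk (by rw [(key n hn).2, smul_zero])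

/-- `L^{(r)}(0) = (1/2) ∑_{k ∈ ℤ} (-k)^r k^r :h(k)h(-k):`, that is, `(r!)²/2` times the coefficient
of `y₁^r y₂^r x^0` in `:X(e^{y₁}x) X(e^{y₂}x):`, where `X(x) = ∑_k h(k) x^{-k}`. -/
def bosonL (r : ℕ) : Module.End ℂ BosonFock :=
  (1 / 2 : ℂ) • locallyFiniteSum (fun k : ℤ => ((-(k : ℂ)) ^ r * (k : ℂ) ^ r) • hNormal k (-k))
    (hNormal_finite _)

/-- The `ζ`-regularized operator `L̄^{(r)}(0) = L^{(r)}(0) + (-1)^r ζ(-2r-1)/2`. -/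
def bosonLbar (r : ℕ) : Module.End ℂ BosonFock :=
  bosonL r + ((-1 : ℂ) ^ r * riemannZeta (-(2 * (r : ℂ) + 1)) / 2) • 1

/-- The bosonic part `(-1)^r L̄^{(r)}(0)` of the Cartan operator `L_{2r+1}`. -/
def bosonCartan (r : ℕ) : Module.End ℂ BosonFock := (-1 : ℂ) ^ r • bosonLbar r

/-! ## The fermionic Fock space `F` -/

/-- `F = ⋀(φ(-1/2), φ(-3/2), …)`; the basis vector with index `n` is `φ(-(n+1/2))`. -/
abbrev FermionFock : Type := ExteriorAlgebra ℂ (ℕ →₀ ℂ)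

/-- The fermionic modes; `phiMode n` is `φ(n + 1/2)`. The modes `φ(-(n+1/2))` act by left exterior
multiplication and the modes `φ(n+1/2)`, `n ≥ 0`, by contraction with the dual basis vector, so
that `φ(a)φ(b) + φ(b)φ(a) = δ_{a+b,0}`. -/
def phiMode : ℤ → Module.End ℂ FermionFock
  | Int.ofNat n => CliffordAlgebra.contractLeft (Q := (0 : QuadraticForm ℂ (ℕ →₀ ℂ)))
      (Finsupp.lapply n : (ℕ →₀ ℂ) →ₗ[ℂ] ℂ)
  | Int.negSucc n => LinearMap.mulLeft ℂ (ExteriorAlgebra.ι ℂ (Finsupp.single n (1 : ℂ)))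

/-- The normally ordered product `:φ(m+1/2)φ(n+1/2):`. -/
def phiNormal (m n : ℤ) : Module.End ℂ FermionFock :=
  if m ≤ n then phiMode m * phiMode n else -(phiMode n * phiMode m)

theorem contract_finite (v : FermionFock) :
    {n : ℕ | phiMode (Int.ofNat n) v ≠ 0}.Finite := by
  induction v using CliffordAlgebra.left_induction with
  | algebraMap r =>
    simp only [phiMode, CliffordAlgebra.contractLeft_algebraMap]
    simp
  | add x y hx hy =>
    refine (hx.union hy).subset ?_
    intro n hn
    simp only [Set.mem_ofPred_eq, map_add, Set.mem_union] at hn ⊢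
    by_contra h
    push Not at h
    exact hn (by rw [h.1, h.2, add_zero])
  | ι_mul x m hx =>
    refine (hx.union m.support.finite_toSet).subset ?_
    intro n hn
    simp only [Set.mem_ofPred_eq, Set.mem_union, Finset.mem_coe, Finsupp.mem_support_iff] at hn ⊢
    by_contra h
    push Not at h
    refine hn ?_
    have h1 := h.1
    simp only [phiMode] at h1 ⊢
    rw [CliffordAlgebra.contractLeft_ι_mul, h1]
    simp [h.2]

theorem phiNormal_finite (c : ℤ → ℂ) (v : FermionFock) :
    {n : ℤ | (c n • phiNormal n (-n - 1)) v ≠ 0}.Finite := by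
  have key : ∀ n : ℕ, phiMode (Int.ofNat n) v = 0 →
      (phiNormal (Int.ofNat n) (-(Int.ofNat n) - 1)) v = 0 ∧
      (phiNormal (Int.negSucc n) (-(Int.negSucc n) - 1)) v = 0 := by
    intro n hp
    have h1 : ¬ (Int.ofNat n ≤ -(Int.ofNat n) - 1) := by
      simp only [Int.ofNat_eq_natCast]; omega
    have h2 : Int.negSucc n ≤ -(Int.negSucc n) - 1 := by omega
    have h3 : -(Int.negSucc n) - 1 = Int.ofNat n := by simp [Int.neg_negSucc]
    refine ⟨?_, ?_⟩
    · rw [phiNormal, if_neg h1, LinearMap.neg_apply, Module.End.mul_apply, hp, map_zero, neg_zero]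
    · rw [phiNormal, if_pos h2, Module.End.mul_apply, h3, hp, map_zero]
  refine Set.Finite.subset (((contract_finite v).image Int.ofNat).union
    ((contract_finite v).image Int.negSucc)) ?_
  intro k hk
  simp only [Set.mem_ofPred_eq, LinearMap.smul_apply] at hk
  simp only [Set.mem_union, Set.mem_image, Set.mem_ofPred_eq]
  match k, hk with
  | Int.ofNat n, hk =>
    exact Or.inl ⟨n, fun hn => hk (by rw [(key n hn).1, smul_zero]), rfl⟩
  | Int.negSucc n, hk =>
    exact Or.inr ⟨n, fun hn => hk (by rw [(key n hn).2, smul_zero]), rfl⟩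

/-- `𝓛^{(r)}(0) = (1/2) ∑_{k ∈ ℤ+1/2} (-k)^{r+1} k^r :φ(k)φ(-k):`, that is, `(r+1)! r!/2` times the
coefficient of `y₁^{r+1} y₂^r x^0` in `:X̃(e^{y₁}x) X̃(e^{y₂}x):`, where
`X̃(x) = ∑_{k ∈ ℤ+1/2} φ(k) x^{-k}`. -/
def fermionL (r : ℕ) : Module.End ℂ FermionFock :=
  (1 / 2 : ℂ) • locallyFiniteSum
    (fun n : ℤ => ((-((n : ℂ) + 1 / 2)) ^ (r + 1) * ((n : ℂ) + 1 / 2) ^ r) • phiNormal n (-n - 1))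
    (phiNormal_finite _)

/-- The Hurwitz zeta function `ζ(s, 1/2)`. -/
def zetaHalf (s : ℂ) : ℂ := HurwitzZeta.hurwitzZeta ((1 / 2 : ℝ) : UnitAddCircle) s

/-- The `ζ`-regularized operator `𝓛̄^{(r)}(0) = 𝓛^{(r)}(0) + (-1)^{r+1} ζ(-2r-1, 1/2)/2`. -/
def fermionLbar (r : ℕ) : Module.End ℂ FermionFock :=
  fermionL r + ((-1 : ℂ) ^ (r + 1) * zetaHalf (-(2 * (r : ℂ) + 1)) / 2) • 1

/-- The fermionic part `(-1)^r 𝓛̄^{(r)}(0)` of the Cartan operator `L_{2r+1}`. -/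
def fermionCartan (r : ℕ) : Module.End ℂ FermionFock := (-1 : ℂ) ^ r • fermionLbar r

/-! ## The space `W = M(1) ⊗ F` -/

/-- `W = M(1) ⊗ F`. -/
abbrev FockSpace : Type := BosonFock ⊗[ℂ] FermionFock

/-- The Cartan operators `L_{2r+1} = (-1)^r (L̄^{(r)}(0) ⊗ 1 + 1 ⊗ 𝓛̄^{(r)}(0))` on `W`. -/
def cartan (r : ℕ) : Module.End ℂ FockSpace :=
  (bosonCartan r).rTensor FermionFock + (fermionCartan r).lTensor BosonFock

/-! ## Generalized characters -/

section Character

variable {V : Type} [AddCommGroup V] [Module ℂ V]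

/-- The simultaneous eigenspace of the operators `L 0, L 1, …` with eigenvalues
`ev 0, ev 1, …`. -/
def jointEigenspace (L : ℕ → Module.End ℂ V) (ev : ℕ → ℂ) : Submodule ℂ V :=
  ⨅ r, (L r).eigenspace (ev r)

/-- The contribution of one simultaneous eigenspace to the coefficient of
`∏_k τ_{2k+3}^{I k}` in `tr q₁^{L₁} q₃^{L₃} q₅^{L₅} ⋯`, where `q_j = e^{2πiτ_j}`, `L r` is
`L_{2r+1}` and `τ = τ₁`. -/
def characterTerm (L : ℕ → Module.End ℂ V) (τ : UpperHalfPlane) (I : ℕ →₀ ℕ) (ev : ℕ → ℂ) : ℂ :=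
  (Module.finrank ℂ (jointEigenspace L ev) : ℂ) *
    (Complex.exp (2 * Real.pi * Complex.I * τ * ev 0) *
      I.prod fun k a => (2 * Real.pi * Complex.I * ev (k + 1)) ^ a / (a.factorial : ℂ))

/-- The generalized character `tr_V q₁^{L₁} q₃^{L₃} q₅^{L₅} ⋯`, expanded as a formal power series in
`τ₃, τ₅, …` (the variable with index `k` is `τ_{2k+3}`) whose coefficients are functions of
`τ = τ₁` in the upper half-plane. -/
def genCharacter (L : ℕ → Module.End ℂ V) (τ : UpperHalfPlane) : MvPowerSeries ℕ ℂ :=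
  fun I => ∑' ev : ℕ → ℂ, characterTerm L τ I ev

/-- The generalized character makes sense: `V` is the sum of the simultaneous eigenspaces, these are
finite-dimensional, and the traces which define the coefficients converge absolutely. -/
structure HasGenCharacter (L : ℕ → Module.End ℂ V) : Prop where
  diagonalizable : ⨆ ev : ℕ → ℂ, jointEigenspace L ev = ⊤
  finiteDimensional : ∀ ev : ℕ → ℂ, FiniteDimensional ℂ (jointEigenspace L ev)
  summable : ∀ (τ : UpperHalfPlane) (I : ℕ →₀ ℕ), Summable (characterTerm L τ I)

end Character

/-- The function `m_I(τ₁)` in the expansion `∑_I m_I(τ₁) τ^I / |I|!`. -/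
def expansionCoeff (f : UpperHalfPlane → MvPowerSeries ℕ ℂ) (I : ℕ →₀ ℕ) (τ : UpperHalfPlane) : ℂ :=
  (I.degree.factorial : ℂ) * MvPowerSeries.coeff I (f τ)

/-- The weight `4 a₃ + 6 a₅ + 8 a₇ + ⋯` of a multi-index, `a_j` being the multiplicity of `τ_j`:
each variable `τ_j` contributes `j + 1`. -/
def wt (I : ℕ →₀ ℕ) : ℕ := I.sum fun k a => (2 * k + 4) * a

/-! ## Quasimodular forms -/

/-- `(cτ + d)^k` for the principal branch of the power. -/
def autFactor (k : ℝ) (γ : SL(2, ℤ)) (τ : UpperHalfPlane) : ℂ :=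
  (UpperHalfPlane.denom γ τ) ^ (k : ℂ)

/-- `v` is a (unitary) multiplier system of real weight `k` on `Γ`. -/
structure IsMultiplierSystem (Γ : Subgroup SL(2, ℤ)) (k : ℝ) (v : SL(2, ℤ) → ℂ) : Prop where
  norm_eq_one : ∀ γ ∈ Γ, ‖v γ‖ = 1
  cocycle : ∀ γ ∈ Γ, ∀ δ ∈ Γ, ∀ τ : UpperHalfPlane,
    v (γ * δ) * autFactor k (γ * δ) τ =
      (v γ * autFactor k γ (δ • τ)) * (v δ * autFactor k δ τ)
  neg_one : -1 ∈ Γ → ∀ τ : UpperHalfPlane, v (-1) * autFactor k (-1) τ = 1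

/-- Moderate growth, which for modular and quasimodular functions amounts to holomorphy at all
cusps. -/
def ModerateGrowth (f : UpperHalfPlane → ℂ) : Prop :=
  ∃ (C : ℝ) (N : ℕ), ∀ τ : UpperHalfPlane, ‖f τ‖ ≤ C * (τ.im + τ.im⁻¹) ^ N

/-- Exponential growth, which for modular and quasimodular functions amounts to being at most
meromorphic at all cusps. -/
def ExponentialGrowth (f : UpperHalfPlane → ℂ) : Prop :=
  ∃ C : ℝ, ∀ τ : UpperHalfPlane, ‖f τ‖ ≤ C * Real.exp (C * (τ.im + τ.im⁻¹))

/-- `f` is the constant term `g 0` of an almost holomorphic modular form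
`∑_{j ≤ p} g_j(τ) (Im τ)^{-j}` of weight `k` and multiplier `v` on `Γ`, with holomorphic
coefficients `g_j` that satisfy the growth condition `P`. -/
def IsQuasimodularWith (P : (UpperHalfPlane → ℂ) → Prop) (Γ : Subgroup SL(2, ℤ)) (k : ℝ)
    (v : SL(2, ℤ) → ℂ) (f : UpperHalfPlane → ℂ) : Prop :=
  ∃ (p : ℕ) (g : ℕ → UpperHalfPlane → ℂ), g 0 = f ∧
    (∀ j ≤ p, MDiff (g j) ∧ P (g j)) ∧
    ∀ γ ∈ Γ, ∀ τ : UpperHalfPlane,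
      ∑ j ∈ Finset.range (p + 1), g j (γ • τ) * (((γ • τ).im : ℂ)⁻¹) ^ j =
        v γ * autFactor k γ τ * ∑ j ∈ Finset.range (p + 1), g j τ * ((τ.im : ℂ)⁻¹) ^ j

/-- Quasimodular forms of integral weight `k` on `Γ` (trivial multiplier, holomorphic at the
cusps). -/
def IsQuasimodularForm (Γ : Subgroup SL(2, ℤ)) (k : ℕ) (f : UpperHalfPlane → ℂ) : Prop :=
  IsQuasimodularWith ModerateGrowth Γ k (fun _ => 1) f

/-- The series `∑_I m_I(τ₁) τ^I / |I|!` is quasimodular of weight `k` on `Γ`: every `m_I` is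
quasimodular of weight `k + wt(I)`, with one and the same multiplier system of weight `k` (poles at
the cusps are allowed; they are unavoidable in negative weight). -/
def IsQuasimodularSeries (Γ : Subgroup SL(2, ℤ)) (k : ℝ)
    (f : UpperHalfPlane → MvPowerSeries ℕ ℂ) : Prop :=
  ∃ v : SL(2, ℤ) → ℂ, IsMultiplierSystem Γ k v ∧
    ∀ I : ℕ →₀ ℕ, IsQuasimodularWith ExponentialGrowth Γ (k + wt I) v (expansionCoeff f I)

/-! ## Eisenstein series of level two -/

/-- `G_k = ζ(1-k)/2 + ∑_{n ≥ 1} σ_{k-1}(n) q^n`, `q = e^{2πiz}`. -/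
def eisG (k : ℕ) (z : ℂ) : ℂ :=
  riemannZeta (1 - (k : ℂ)) / 2 +
    ∑' n : ℕ, (ArithmeticFunction.sigma (k - 1) (n + 1) : ℂ) *
      Complex.exp (2 * Real.pi * Complex.I * ((n : ℂ) + 1) * z)

/-- The level-two Eisenstein series `F_k^{(2)}(q) = G_k(q^{1/2}) - 2^{k-1} G_k(q)`. -/
def eisF (k : ℕ) (z : ℂ) : ℂ := eisG k (z / 2) - 2 ^ (k - 1) * eisG k z

/-- `F_{2K}^{(2)}(q) / 2^{2K-1} - F_{2K}^{(2)}(q²) / 2^{2K-2}`. -/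
def eisCombination (K : ℕ) (τ : UpperHalfPlane) : ℂ :=
  eisF (2 * K) τ / 2 ^ (2 * K - 1) - eisF (2 * K) (2 * τ) / 2 ^ (2 * K - 2)

/-! ## Logarithms of formal power series -/

/-- The coefficient of `τ^I`, `I ≠ 0`, in `log f = log f(0) + ∑_{n ≥ 1} (-1)^{n-1} (f/f(0) - 1)^n / n`
(only the terms with `n ≤ |I|` contribute). -/
def logCoeff (f : MvPowerSeries ℕ ℂ) (I : ℕ →₀ ℕ) : ℂ :=
  ∑ n ∈ Finset.Icc 1 I.degree, (-1 : ℂ) ^ (n - 1) / n *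
    MvPowerSeries.coeff I
      ((MvPowerSeries.C (MvPowerSeries.constantCoeff f)⁻¹ * f - 1) ^ n)

/-- The value at `τ₃ = τ₅ = ⋯ = 0` of
`(2πi)^{-(s+|I|)} (∂/∂τ₁)^s ∏_k (∂/∂τ_{2k+3})^{I k} log f`, for `(s, I) ≠ (0, 0)`. -/
def logTaylor (f : UpperHalfPlane → MvPowerSeries ℕ ℂ) (s : ℕ) (I : ℕ →₀ ℕ) : UpperHalfPlane → ℂ :=
  if I = 0 then
    Derivative.normalizedDerivOfComplex^[s - 1] fun τ =>
      Derivative.normalizedDerivOfComplex (fun z => MvPowerSeries.constantCoeff (f z)) τ /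
        MvPowerSeries.constantCoeff (f τ)
  else
    Derivative.normalizedDerivOfComplex^[s] fun τ =>
      (I.prod fun _ a => (a.factorial : ℂ)) * logCoeff (f τ) I /
        (2 * Real.pi * Complex.I) ^ I.degree

end FreeFieldCharacter

end

/-! All Cartan operators are diagonal in the occupation-number bases: monomials for `M(1)`, exterior
products for `F`. A state with occupation numbers `a` on modes of energy `λ_n` (`n+1`, respectively
`n+1/2`) has eigenvalues `c_r + ∑ a_n λ_n^{2r+1}`, where `c_r` is the zeta-regularized constant.
Each character is therefore a sum over states of the formal exponentials `charExp`, absolutely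
convergent because `energy_le_pow` bounds every eigenvalue by a polynomial in the energy, while
`q^{energy}` decays.

The characters are then studied through logarithmic derivatives rather than through product
formulas. Let `Z` be the sum over states, `X_n` the exponential of one particle in mode `n`, and
`A_n` the sum weighted by the occupation of `n`. Adding a particle gives `A_n = X_n (Z + ε A_n)`,
with `ε = 1` for bosons and `ε = -1` for fermions, so `A_n = Z ∑_m ε^m X_n^{m+1}`. Summing over the
modes with weights `λ_n^{2r+1}` shows that every logarithmic derivative of `Z` is `2πi` times the
explicit Lambert series `logSeries`. The coefficient of this series at `b` is, up to a scalar, the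
`|b|`-th `D`-derivative of `c_R + ∑ ε^m λ_n^{2R+1} q^{(m+1)λ_n}`. The regularized constants are
exactly the constant terms which make these sums Eisenstein series: `G_{2R+2}` for bosons
(`eisG_eq`), and the level-two combination for fermions (`eisCombination_eq`).

Quasimodularity is handled in the graded algebra `IsQuasimodular` generated by `E₂` over the modular
forms. It is closed under `D`, by the Serre derivative and Ramanujan's identity for `D E₂`, and its
elements are constant terms of polynomials in `1/Im τ`, since `E₂ - 3/(π Im τ)` is modular. It
contains all the Eisenstein series above, on `Γ(4)`. The Taylor coefficients of `log F` are thus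
read off directly, and `m_I/m_0` follows by recursion on the degree from `∂_k W = 2πi W H_k`.

The leading coefficients are identified with eta quotients by comparing logarithmic `τ₁`-derivatives
and leading terms at `i∞`. The multiplier of `m_0` needs no explicit eta multiplier: modularity of
`Δ = η^24` gives the absolute value of the transformation factor, and a holomorphic function of
constant modulus is constant. -/

noncomputable section

namespace FreeFieldCharacter

section

/-! ## The exponential series attached to a system of eigenvalues -/

/-- The expansion of `exp (2πi ∑_r τ_{2r+1} e_r)` as a power series in `τ₃, τ₅, …`. -/
def charExp (τ : ℂ) (e : ℕ → ℂ) : MvPowerSeries ℕ ℂ := fun I =>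
  Complex.exp (2 * Real.pi * Complex.I * τ * e 0) *
    I.prod fun k a => (2 * Real.pi * Complex.I * e (k + 1)) ^ a / (a.factorial : ℂ)

theorem coeff_charExp (τ : ℂ) (e : ℕ → ℂ) (I : ℕ →₀ ℕ) :
    MvPowerSeries.coeff I (charExp τ e) = Complex.exp (2 * Real.pi * Complex.I * τ * e 0) *
      I.prod fun k a => (2 * Real.pi * Complex.I * e (k + 1)) ^ a / (a.factorial : ℂ) := rfl

theorem constantCoeff_charExp (τ : ℂ) (e : ℕ → ℂ) :
    MvPowerSeries.constantCoeff (charExp τ e) =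
      Complex.exp (2 * Real.pi * Complex.I * τ * e 0) := by
  rw [← MvPowerSeries.coeff_zero_eq_constantCoeff_apply, coeff_charExp]
  simp

/-- This eigenvector property gives multiplicativity in `e`, and later turns differentiation of a
character into weighting its states by eigenvalues. -/
theorem pderiv_charExp (τ : ℂ) (e : ℕ → ℂ) (k : ℕ) :
    MvPowerSeries.pderiv ℂ k (charExp τ e) =
      (2 * Real.pi * Complex.I * e (k + 1)) • charExp τ e := by
  ext I
  rw [MvPowerSeries.coeff_pderiv, map_smul, coeff_charExp, coeff_charExp, smul_eq_mul]
  set h : ℕ → ℕ → ℂ :=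
    fun k a => (2 * Real.pi * Complex.I * e (k + 1)) ^ a / (a.factorial : ℂ) with hh
  have h0 : ∀ i, h i 0 = 1 := fun i => by simp [hh]
  rw [← Finsupp.mul_prod_erase' _ k h h0, ← Finsupp.mul_prod_erase' I k h h0]
  have he : Finsupp.erase k (I + Finsupp.single k 1) = Finsupp.erase k I := by
    ext j
    by_cases hj : j = k
    · subst hj; simp
    · simp [Finsupp.erase_ne hj]
  rw [he]
  have hf : h k (I k + 1) * ((I k : ℂ) + 1) = 2 * Real.pi * Complex.I * e (k + 1) * h k (I k) := by
    have h1 : ((I k).factorial : ℂ) ≠ 0 := by exact_mod_cast (I k).factorial_ne_zero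
    have h2 : ((I k : ℂ) + 1) ≠ 0 := by exact_mod_cast (I k).succ_ne_zero
    simp only [hh, Nat.factorial_succ, pow_succ]
    push_cast
    field_simp
  simp only [Finsupp.add_apply, Finsupp.single_eq_same]
  linear_combination Complex.exp (2 * Real.pi * Complex.I * τ * e 0) *
    (Finsupp.erase k I).prod h * hf

/-- A power series is determined by its constant coefficient and its logarithmic derivatives. -/
theorem eq_zero_of_pderiv_eq_smul {f : MvPowerSeries ℕ ℂ} (w : ℕ → ℂ)
    (hf : ∀ k, MvPowerSeries.pderiv ℂ k f = w k • f)
    (h0 : MvPowerSeries.constantCoeff f = 0) : f = 0 := by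
  have key : ∀ (n : ℕ) (I : ℕ →₀ ℕ), I.degree = n → MvPowerSeries.coeff I f = 0 := by
    intro n
    induction n with
    | zero =>
      intro I hI
      rw [Finsupp.degree_eq_zero_iff] at hI
      rw [hI, MvPowerSeries.coeff_zero_eq_constantCoeff_apply, h0]
    | succ n ih =>
      intro I hI
      obtain ⟨k, hk⟩ : ∃ k, I k ≠ 0 := by
        by_contra h
        push Not at h
        have : I = 0 := Finsupp.ext h
        simp [this] at hI
      obtain ⟨J, rfl⟩ : ∃ J, I = J + Finsupp.single k 1 := by
        refine ⟨I - Finsupp.single k 1, (tsub_add_cancel_of_le ?_).symm⟩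
        rw [Finsupp.single_le_iff]
        omega
      have hJ : J.degree = n := by simpa [map_add] using hI
      have h1 := congrArg (MvPowerSeries.coeff J) (hf k)
      rw [MvPowerSeries.coeff_pderiv, map_smul, ih J hJ, smul_zero] at h1
      have h2 : ((J k : ℂ) + 1) ≠ 0 := by exact_mod_cast (J k).succ_ne_zero
      exact (mul_eq_zero.mp h1).resolve_right h2
  ext I
  rw [key _ I rfl, map_zero]

/-- Both sides solve the same equations `∂_k f = w_k f` and have equal constant coefficients, so
their difference vanishes. -/
theorem charExp_add (τ : ℂ) (e e' : ℕ → ℂ) :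
    charExp τ (e + e') = charExp τ e * charExp τ e' := by
  rw [← sub_eq_zero]
  refine eq_zero_of_pderiv_eq_smul (fun k => 2 * Real.pi * Complex.I * (e + e') (k + 1)) ?_ ?_
  · intro k
    rw [map_sub, Derivation.leibniz, pderiv_charExp, pderiv_charExp, pderiv_charExp]
    simp only [smul_eq_mul, Pi.add_apply, MvPowerSeries.smul_eq_C_mul, map_mul, map_add]
    ring
  · rw [map_sub, map_mul, constantCoeff_charExp, constantCoeff_charExp, constantCoeff_charExp,
      ← Complex.exp_add, sub_eq_zero]
    congr 1
    simp only [Pi.add_apply]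
    ring

/-! ## Characters from a basis of joint eigenvectors -/

section Eigenbasis

variable {V ι : Type} [AddCommGroup V] [Module ℂ V]

/-- In coordinates `L r` multiplies the `i`-th coordinate by `ev i r`, so a nonzero coordinate of a
joint eigenvector forces `ev i = e`. -/
theorem jointEigenspace_eq_span (b : Module.Basis ι ℂ V) {L : ℕ → Module.End ℂ V}
    {ev : ι → ℕ → ℂ} (h : ∀ r i, L r (b i) = ev i r • b i) (e : ℕ → ℂ) :
    jointEigenspace L e = Submodule.span ℂ (b '' {i | ev i = e}) := by
  have hrepr : ∀ r i v, b.repr (L r v) i = ev i r * b.repr v i := by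
    intro r i v
    have : (Finsupp.lapply i ∘ₗ b.repr.toLinearMap ∘ₗ L r : V →ₗ[ℂ] ℂ) =
        ev i r • (Finsupp.lapply i ∘ₗ b.repr.toLinearMap) := by
      refine b.ext fun j => ?_
      simp only [LinearMap.comp_apply, LinearMap.smul_apply, h, map_smul, LinearEquiv.coe_coe,
        Module.Basis.repr_self, Finsupp.lapply_apply, smul_eq_mul]
      by_cases hij : j = i
      · rw [hij]
      · simp [Finsupp.single_eq_of_ne (Ne.symm hij)]
    simpa using LinearMap.congr_fun this v
  apply le_antisymm
  · intro v hv
    rw [Module.Basis.mem_span_image]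
    intro i hi
    ext r
    simp only [jointEigenspace, Submodule.mem_iInf, Module.End.mem_eigenspace_iff] at hv
    have h1 := hrepr r i v
    rw [hv r, map_smul, Finsupp.smul_apply, smul_eq_mul] at h1
    exact (mul_right_cancel₀ (Finsupp.mem_support_iff.mp hi) h1).symm
  · rw [Submodule.span_le]
    rintro _ ⟨i, rfl, rfl⟩
    simp only [jointEigenspace, SetLike.mem_coe, Submodule.mem_iInf,
      Module.End.mem_eigenspace_iff]
    exact fun r => h r i

theorem finrank_jointEigenspace (b : Module.Basis ι ℂ V) {L : ℕ → Module.End ℂ V}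
    {ev : ι → ℕ → ℂ} (h : ∀ r i, L r (b i) = ev i r • b i) (e : ℕ → ℂ)
    [Fintype {i // ev i = e}] :
    Module.finrank ℂ (jointEigenspace L e) = Fintype.card {i // ev i = e} := by
  rw [jointEigenspace_eq_span b h]
  have h1 : b '' {i | ev i = e} = Set.range fun i : {i // ev i = e} => b i := by
    ext v; simp
  rw [h1]
  exact finrank_span_eq_card (b.linearIndependent.comp _ Subtype.val_injective)

/-- The sum over basis vectors is regrouped along the fibres of `ev`; the size of a fibre is the
dimension of the joint eigenspace. -/
theorem hasGenCharacter_of_basis (b : Module.Basis ι ℂ V) {L : ℕ → Module.End ℂ V}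
    {ev : ι → ℕ → ℂ} (h : ∀ r i, L r (b i) = ev i r • b i)
    (hs : ∀ (τ : UpperHalfPlane) (I : ℕ →₀ ℕ),
      Summable fun i => ‖MvPowerSeries.coeff I (charExp τ (ev i))‖) :
    HasGenCharacter L ∧ ∀ (τ : UpperHalfPlane) (I : ℕ →₀ ℕ),
      HasSum (fun i => MvPowerSeries.coeff I (charExp τ (ev i)))
        (MvPowerSeries.coeff I (genCharacter L τ)) := by
  -- An infinite fibre would make a nonzero constant family summable: at `τ = i`, `I = 0` the terms
  -- are all the same exponential.
  have hfin : ∀ e, Finite {i // ev i = e} := by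
    intro e
    by_contra hinf
    rw [not_finite_iff_infinite] at hinf
    have h1 := (hs UpperHalfPlane.I 0).comp_injective
      (Subtype.val_injective (p := fun i => ev i = e))
    have h2 : ((fun i => ‖MvPowerSeries.coeff 0 (charExp UpperHalfPlane.I (ev i))‖) ∘
        (Subtype.val : {i // ev i = e} → ι)) =
        fun _ => ‖MvPowerSeries.coeff 0 (charExp UpperHalfPlane.I e)‖ := by
      ext ⟨i, hi⟩
      simp [hi]
    rw [h2, summable_const_iff, norm_eq_zero, MvPowerSeries.coeff_zero_eq_constantCoeff_apply,
      constantCoeff_charExp] at h1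
    exact Complex.exp_ne_zero _ h1
  have hfib : ∀ (τ : UpperHalfPlane) I, ∀ {a : ℂ}, HasSum (fun i => MvPowerSeries.coeff I (charExp τ (ev i))) a →
      HasSum (characterTerm L τ I) a := by
    intro τ I a ha
    rw [← (Equiv.sigmaFiberEquiv ev).hasSum_iff] at ha
    refine ha.sigma fun e => ?_
    have : Fintype {i // ev i = e} := Fintype.ofFinite _
    have h1 : characterTerm L τ I e =
        ∑ i : {i // ev i = e}, MvPowerSeries.coeff I (charExp τ (ev i)) := by
      rw [characterTerm, finrank_jointEigenspace b h, ← coeff_charExp,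
        Finset.sum_congr rfl fun i _ => by rw [i.2], Finset.sum_const, Finset.card_univ,
        nsmul_eq_mul]
    rw [h1]
    exact hasSum_fintype _
  refine ⟨⟨?_, ?_, ?_⟩, ?_⟩
  · rw [eq_top_iff, ← b.span_eq, Submodule.span_le]
    rintro _ ⟨i, rfl⟩
    refine Submodule.mem_iSup_of_mem (ev i) ?_
    simp only [jointEigenspace, Submodule.mem_iInf, Module.End.mem_eigenspace_iff]
    exact fun r => h r i
  · intro e
    have : Finite {i | ev i = e} := hfin e
    rw [jointEigenspace_eq_span b h]
    exact FiniteDimensional.span_of_finite ℂ ((Set.toFinite {i | ev i = e}).image b)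
  · exact fun τ I => (hfib τ I (hs τ I).of_norm.hasSum).summable
  · intro τ I
    have h1 := hfib τ I (hs τ I).of_norm.hasSum
    have h2 : MvPowerSeries.coeff I (genCharacter L τ) = ∑' e, characterTerm L τ I e := rfl
    rw [h2, h1.tsum_eq]
    exact (hs τ I).of_norm.hasSum

end Eigenbasis

end

/-! ### Occupation numbers and diagonalization of the Cartan operators -/

section

/-- The eigenvalue `∑_n a_n λ_n^{2r+1}` of occupation numbers `a` of modes with energies `λ`. -/
def energy (lam : ℕ → ℝ) (a : ℕ →₀ ℕ) (r : ℕ) : ℝ := a.sum fun n m => m * lam n ^ (2 * r + 1)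

/-- Folds a sum over all modes `k ∈ ℤ` into pairs of opposite modes, of which only the occupied ones
contribute. -/
theorem finsum_eq_sum_add {M : Type} [AddCommGroup M] {f : ℤ → M} (s : Finset ℕ) {g h : ℕ → ℤ}
    (hg : Function.Injective g) (hh : Function.Injective h) (hgh : ∀ m n, g m ≠ h n)
    (hf : ∀ k, f k ≠ 0 → ∃ n ∈ s, g n = k ∨ h n = k) :
    ∑ᶠ k, f k = ∑ n ∈ s, (f (g n) + f (h n)) := by
  have h1 : Function.support f ⊆ (s.image g ∪ s.image h : Finset ℤ) := by
    intro k hk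
    obtain ⟨n, hn, h1 | h1⟩ := hf k hk
    · exact Finset.mem_union_left _ (Finset.mem_image.mpr ⟨n, hn, h1⟩)
    · exact Finset.mem_union_right _ (Finset.mem_image.mpr ⟨n, hn, h1⟩)
  rw [finsum_eq_sum_of_support_subset _ h1, Finset.sum_union, Finset.sum_image hg.injOn,
    Finset.sum_image hh.injOn, Finset.sum_add_distrib]
  rw [Finset.disjoint_left]
  intro k hk hk'
  obtain ⟨m, -, rfl⟩ := Finset.mem_image.mp hk
  obtain ⟨n, -, h2⟩ := Finset.mem_image.mp hk'
  exact hgh m n h2.symm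

/-! ## Eigenvectors in the bosonic Fock space -/

theorem hMode_mul_monomial (n : ℕ) (a : ℕ →₀ ℕ) :
    (hMode (Int.negSucc n) * hMode (Int.ofNat (n + 1))) (MvPolynomial.monomial a 1) =
      (((n : ℂ) + 1) * a n) • MvPolynomial.monomial a (1 : ℂ) := by
  rw [Module.End.mul_apply]
  simp only [hMode, LinearMap.smul_apply, map_smul, LinearMap.mulLeft_apply]
  change _ • (MvPolynomial.X n * MvPolynomial.pderiv n (MvPolynomial.monomial a (1 : ℂ))) = _
  rw [MvPolynomial.pderiv_monomial, one_mul]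
  rw [mul_smul, MvPolynomial.X, MvPolynomial.monomial_mul, one_mul, MvPolynomial.smul_monomial]
  -- For `a n = 0` the scalar vanishes, so the truncated subtraction in the exponent does no harm.
  by_cases h : a n = 0
  · simp [h]
  · rw [add_tsub_cancel_of_le (by rw [Finsupp.single_le_iff]; omega)]
    simp [MvPolynomial.smul_monomial]

/-- The modes `k` and `-k` give the same number operator, which cancels the factor `1/2`. Here
`(-k)^r k^r = (-1)^r k^{2r}`, and the remaining power of `k` comes from `h(k) = k ∂/∂h(-k)`. -/
theorem bosonL_monomial (r : ℕ) (a : ℕ →₀ ℕ) :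
    bosonL r (MvPolynomial.monomial a 1) =
      ((-1 : ℂ) ^ r * energy (fun n => n + 1) a r) • MvPolynomial.monomial a (1 : ℂ) := by
  have hpos : ∀ n : ℕ, hNormal (Int.ofNat (n + 1)) (-(Int.ofNat (n + 1))) =
      hMode (Int.negSucc n) * hMode (Int.ofNat (n + 1)) := by
    intro n
    rw [hNormal, if_neg (by simp only [Int.ofNat_eq_natCast]; omega)]
    rfl
  have hneg : ∀ n : ℕ, hNormal (Int.negSucc n) (-(Int.negSucc n)) =
      hMode (Int.negSucc n) * hMode (Int.ofNat (n + 1)) := by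
    intro n
    rw [hNormal, if_pos (by omega)]
    rfl
  rw [bosonL, LinearMap.smul_apply]
  change (1 / 2 : ℂ) • (∑ᶠ k : ℤ, (((-(k : ℂ)) ^ r * (k : ℂ) ^ r) • hNormal k (-k))
    (MvPolynomial.monomial a 1)) = _
  rw [finsum_eq_sum_add a.support (g := fun n => Int.ofNat (n + 1)) (h := Int.negSucc)]
  · simp only [LinearMap.smul_apply, hpos, hneg, hMode_mul_monomial, smul_smul, ← add_smul,
      ← Finset.sum_smul]
    congr 1
    rw [energy, Finsupp.sum, Complex.ofReal_sum, Finset.mul_sum, Finset.mul_sum]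
    refine Finset.sum_congr rfl fun n _ => ?_
    have h1 : ((Int.negSucc n : ℤ) : ℂ) = -((n : ℂ) + 1) := by
      rw [Int.cast_negSucc]; push_cast; ring
    have h2 : ((Int.ofNat (n + 1) : ℤ) : ℂ) = (n : ℂ) + 1 := by
      simp
    rw [h1, h2, neg_neg, ← mul_pow, ← mul_pow]
    push_cast
    rw [show -((n : ℂ) + 1) * ((n : ℂ) + 1) = -1 * ((n : ℂ) + 1) ^ 2 by ring,
      show ((n : ℂ) + 1) * -((n : ℂ) + 1) = -1 * ((n : ℂ) + 1) ^ 2 by ring, mul_pow, ← pow_mul]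
    ring
  · intro m n h; simpa using h
  · intro m n h; simpa using h
  · intro m n h
    simp only [Int.ofNat_eq_natCast] at h
    omega
  · intro k hk
    match k, hk with
    | Int.ofNat 0, hk => exact absurd (by simp [hNormal, hMode]) hk
    | Int.ofNat (n + 1), hk =>
      refine ⟨n, ?_, Or.inl rfl⟩
      rw [Finsupp.mem_support_iff]
      intro h0
      exact hk (by rw [LinearMap.smul_apply, hpos, hMode_mul_monomial, h0]; simp)
    | Int.negSucc n, hk =>
      refine ⟨n, ?_, Or.inr rfl⟩
      rw [Finsupp.mem_support_iff]
      intro h0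
      exact hk (by rw [LinearMap.smul_apply, hneg, hMode_mul_monomial, h0]; simp)

/-- The constant term `ζ(-2r-1)/2` of the bosonic Cartan operators. -/
def bosonConst (r : ℕ) : ℂ := riemannZeta (-(2 * (r : ℂ) + 1)) / 2

theorem neg_one_pow_mul_self (r : ℕ) : (-1 : ℂ) ^ r * (-1) ^ r = 1 := by
  rw [← mul_pow]; simp

theorem bosonCartan_monomial (r : ℕ) (a : ℕ →₀ ℕ) :
    bosonCartan r (MvPolynomial.basisMonomials ℕ ℂ a) =
      (bosonConst r + energy (fun n => n + 1) a r) • MvPolynomial.basisMonomials ℕ ℂ a := by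
  rw [MvPolynomial.coe_basisMonomials, bosonCartan, bosonLbar, LinearMap.smul_apply,
    LinearMap.add_apply, bosonL_monomial, LinearMap.smul_apply, Module.End.one_apply, ← add_smul,
    smul_smul]
  congr 1
  rw [bosonConst]
  linear_combination (energy (fun n => n + 1) a r + riemannZeta (-(2 * (r : ℂ) + 1)) / 2) *
    neg_one_pow_mul_self r

/-! ## Eigenvectors in the fermionic Fock space -/

/-- The exterior product of the basis vectors with indices in a list. -/
def wedge (l : List ℕ) : FermionFock :=
  (l.map fun n => ExteriorAlgebra.ι ℂ (Finsupp.single n (1 : ℂ))).prod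

theorem phiMode_wedge_of_notMem {n : ℕ} {l : List ℕ} (h : n ∉ l) :
    phiMode (Int.ofNat n) (wedge l) = 0 := by
  induction l with
  | nil =>
    simp only [wedge, List.map_nil, List.prod_nil, phiMode]
    exact CliffordAlgebra.contractLeft_one (Q := (0 : QuadraticForm ℂ (ℕ →₀ ℂ))) _
  | cons m l ih =>
    simp only [List.mem_cons, not_or] at h
    have h1 := ih h.2
    simp only [wedge, List.map_cons, List.prod_cons, phiMode] at h1 ⊢
    erw [CliffordAlgebra.contractLeft_ι_mul]
    rw [h1, mul_zero, sub_zero, Finsupp.lapply_apply, Finsupp.single_eq_of_ne h.1, zero_smul]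

/-- The number operator of the mode `n`. Contraction and multiplication each pick up a sign when
moved past another factor, and the two signs cancel. -/
theorem phiMode_mul_wedge (n : ℕ) {l : List ℕ} (hl : l.Nodup) :
    (phiMode (Int.negSucc n) * phiMode (Int.ofNat n)) (wedge l) =
      (if n ∈ l then (1 : ℂ) else 0) • wedge l := by
  induction l with
  | nil =>
    rw [Module.End.mul_apply, phiMode_wedge_of_notMem (by simp)]
    simp
  | cons m l ih =>
    rw [List.nodup_cons] at hl
    by_cases hn : n ∈ m :: l
    · rw [if_pos hn, one_smul, Module.End.mul_apply]
      have h1 : phiMode (Int.ofNat n) (wedge (m :: l)) =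
          (Finsupp.single m (1 : ℂ) n) • wedge l -
            ExteriorAlgebra.ι ℂ (Finsupp.single m (1 : ℂ)) * phiMode (Int.ofNat n) (wedge l) := by
        simp only [wedge, List.map_cons, List.prod_cons, phiMode]
        erw [CliffordAlgebra.contractLeft_ι_mul]
        rfl
      rw [h1]
      by_cases hnm : n = m
      · subst hnm
        rw [phiMode_wedge_of_notMem hl.1, mul_zero, sub_zero, Finsupp.single_eq_same, one_smul]
        rfl
      · have hnl : n ∈ l := by simpa [hnm] using hn
        have h2 := ih hl.2
        rw [if_pos hnl, one_smul, Module.End.mul_apply] at h2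
        rw [Finsupp.single_eq_of_ne hnm, zero_smul, zero_sub, map_neg]
        simp only [phiMode, LinearMap.mulLeft_apply] at h2 ⊢
        rw [← mul_assoc, ← neg_mul, ← eq_neg_of_add_eq_zero_left (ExteriorAlgebra.ι_add_mul_swap
          (R := ℂ) (Finsupp.single m (1 : ℂ)) (Finsupp.single n (1 : ℂ))), mul_assoc]
        erw [h2]
        rfl
    · rw [if_neg hn, zero_smul, Module.End.mul_apply, phiMode_wedge_of_notMem hn, map_zero]

/-- The basis of the fermionic Fock space of exterior products of the `φ(-(n+1/2))`. -/
def fermionBasis : Module.Basis (Finset ℕ) ℂ FermionFock :=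
  (Finsupp.basisSingleOne (R := ℂ) (ι := ℕ)).ExteriorAlgebra

/-- The list enumerates `S` in increasing order, but its order plays no role later: the number
operators only see which indices occur. -/
theorem exists_fermionBasis_eq_wedge (S : Finset ℕ) :
    ∃ l : List ℕ, l.Nodup ∧ l.toFinset = S ∧ fermionBasis S = wedge l := by
  have h0 : fermionBasis S = ExteriorAlgebra.ιMulti_family ℂ S.card
      (Finsupp.basisSingleOne (R := ℂ) (ι := ℕ)) (Set.powersetCard.ofCard rfl) :=
    ExteriorAlgebra.basis_apply _ S
  set e := Set.powersetCard.ofFinEmbEquiv.symm (Set.powersetCard.ofCard (rfl : S.card = S.card))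
    with he
  refine ⟨List.ofFn e, List.nodup_ofFn.mpr e.injective, ?_, ?_⟩
  · ext n
    rw [List.mem_toFinset, List.mem_ofFn]
    have := Set.powersetCard.mem_range_ofFinEmbEquiv_symm_iff_mem
      (Set.powersetCard.ofCard (rfl : S.card = S.card)) n
    exact this
  · rw [h0, ExteriorAlgebra.ιMulti_family, ExteriorAlgebra.ιMulti_apply, wedge, List.map_ofFn]
    congr 2

/-- The occupation numbers `1` on a finite set and `0` elsewhere. -/
def occupation (S : Finset ℕ) : ℕ →₀ ℕ := Finsupp.indicator S fun _ _ => 1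

theorem occupation_apply (S : Finset ℕ) (n : ℕ) : occupation S n = if n ∈ S then 1 else 0 := by
  simp [occupation, Finsupp.indicator_apply]

theorem occupation_injective : Function.Injective occupation := by
  intro S T h
  ext n
  have := DFunLike.congr_fun h n
  simp only [occupation_apply] at this
  by_cases h1 : n ∈ S <;> by_cases h2 : n ∈ T <;> simp_all

theorem energy_occupation (lam : ℕ → ℝ) (S : Finset ℕ) (r : ℕ) :
    energy lam (occupation S) r = ∑ n ∈ S, lam n ^ (2 * r + 1) := by
  rw [energy, occupation, Finsupp.sum_indicator_index _ (by simp)]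
  simp

/-- The coefficient `(-k)^{r+1} k^r` is odd in `k`, and normal ordering contributes a minus sign
exactly for `k > 0`. The two halves of the sum therefore agree and cancel the factor `1/2`. -/
theorem fermionL_basis (r : ℕ) (S : Finset ℕ) :
    fermionL r (fermionBasis S) =
      ((-1 : ℂ) ^ r * energy (fun n => n + 1 / 2) (occupation S) r) • fermionBasis S := by
  obtain ⟨l, hl, rfl, hS⟩ := exists_fermionBasis_eq_wedge S
  rw [hS]
  have hpos : ∀ n : ℕ, phiNormal (Int.ofNat n) (-(Int.ofNat n) - 1) =
      -(phiMode (Int.negSucc n) * phiMode (Int.ofNat n)) := by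
    intro n
    rw [phiNormal, if_neg (by simp only [Int.ofNat_eq_natCast]; omega)]
    congr 3
    simp only [Int.ofNat_eq_natCast]; omega
  have hneg : ∀ n : ℕ, phiNormal (Int.negSucc n) (-(Int.negSucc n) - 1) =
      phiMode (Int.negSucc n) * phiMode (Int.ofNat n) := by
    intro n
    rw [phiNormal, if_pos (by omega)]
    congr 2
    simp [Int.neg_negSucc]
  rw [fermionL, LinearMap.smul_apply]
  change (1 / 2 : ℂ) • (∑ᶠ n : ℤ, (((-((n : ℂ) + 1 / 2)) ^ (r + 1) * ((n : ℂ) + 1 / 2) ^ r) •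
    phiNormal n (-n - 1)) (wedge l)) = _
  rw [finsum_eq_sum_add l.toFinset (g := Int.ofNat) (h := Int.negSucc)]
  · simp only [LinearMap.smul_apply, hpos, hneg, LinearMap.neg_apply, phiMode_mul_wedge _ hl]
    rw [energy_occupation, Complex.ofReal_sum, Finset.mul_sum, Finset.sum_smul, Finset.smul_sum]
    refine Finset.sum_congr rfl fun n hn => ?_
    rw [if_pos (List.mem_toFinset.mp hn), one_smul, smul_neg, ← neg_smul, ← add_smul, smul_smul]
    congr 1
    have h1 : ((Int.negSucc n : ℤ) : ℂ) + 1 / 2 = -((n : ℂ) + 1 / 2) := by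
      rw [Int.cast_negSucc]; push_cast; ring
    have h2 : ((Int.ofNat n : ℤ) : ℂ) = (n : ℂ) := by simp
    rw [h1, h2, neg_neg]
    push_cast
    rw [neg_pow ((n : ℂ) + 1 / 2), neg_pow ((n : ℂ) + 1 / 2)]
    ring
  · exact Int.ofNat_injective
  · intro m n h; simpa using h
  · intro m n h
    simp only [Int.ofNat_eq_natCast] at h
    omega
  · intro k hk
    match k, hk with
    | Int.ofNat n, hk =>
      refine ⟨n, ?_, Or.inl rfl⟩
      rw [List.mem_toFinset]
      by_contra h0
      exact hk (by rw [LinearMap.smul_apply, hpos, LinearMap.neg_apply, phiMode_mul_wedge _ hl,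
        if_neg h0]; simp)
    | Int.negSucc n, hk =>
      refine ⟨n, ?_, Or.inr rfl⟩
      rw [List.mem_toFinset]
      by_contra h0
      exact hk (by rw [LinearMap.smul_apply, hneg, phiMode_mul_wedge _ hl, if_neg h0]; simp)

/-- The constant term `-ζ(-2r-1, 1/2)/2` of the fermionic Cartan operators. -/
def fermionConst (r : ℕ) : ℂ := -zetaHalf (-(2 * (r : ℂ) + 1)) / 2

theorem fermionCartan_basis (r : ℕ) (S : Finset ℕ) :
    fermionCartan r (fermionBasis S) =
      (fermionConst r + energy (fun n => n + 1 / 2) (occupation S) r) • fermionBasis S := by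
  rw [fermionCartan, fermionLbar, LinearMap.smul_apply, LinearMap.add_apply, fermionL_basis,
    LinearMap.smul_apply, Module.End.one_apply, ← add_smul, smul_smul]
  congr 1
  rw [fermionConst, pow_succ]
  linear_combination (energy (fun n => n + 1 / 2) (occupation S) r -
    zetaHalf (-(2 * (r : ℂ) + 1)) / 2) * neg_one_pow_mul_self r

/-! ## Eigenvectors in the tensor product -/

theorem cartan_basis {ι κ : Type} {b : Module.Basis ι ℂ BosonFock}
    {c : Module.Basis κ ℂ FermionFock} {ev : ι → ℕ → ℂ} {ev' : κ → ℕ → ℂ}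
    (h : ∀ r i, bosonCartan r (b i) = ev i r • b i)
    (h' : ∀ r j, fermionCartan r (c j) = ev' j r • c j) (r : ℕ) (i : ι × κ) :
    cartan r (b.tensorProduct c i) = (ev i.1 + ev' i.2) r • b.tensorProduct c i := by
  rw [Module.Basis.tensorProduct_apply', cartan, LinearMap.add_apply, LinearMap.rTensor_tmul,
    LinearMap.lTensor_tmul, h, h', ← TensorProduct.smul_tmul', TensorProduct.tmul_smul, ← add_smul]
  rfl

end

section

/-! ## Convergence of sums over occupation numbers -/

/-- Bounds on the energies of the modes. -/
structure IsModeSeq (lam : ℕ → ℝ) : Prop where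
  lower : ∀ n : ℕ, ((n : ℝ) + 1) / 2 ≤ lam n
  upper : ∀ n : ℕ, lam n ≤ n + 1

theorem isModeSeq_boson : IsModeSeq fun n : ℕ => (n : ℝ) + 1 :=
  ⟨fun n => by have : (0 : ℝ) ≤ n := n.cast_nonneg; linarith, fun n => le_rfl⟩

theorem isModeSeq_fermion : IsModeSeq fun n : ℕ => (n : ℝ) + 1 / 2 :=
  ⟨fun n => by have : (0 : ℝ) ≤ n := n.cast_nonneg; linarith, fun n => by linarith⟩

theorem IsModeSeq.half_le {lam : ℕ → ℝ} (h : IsModeSeq lam) (n : ℕ) : 1 / 2 ≤ lam n :=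
  le_trans (by have : (0 : ℝ) ≤ n := n.cast_nonneg; linarith) (h.lower n)

theorem IsModeSeq.pos {lam : ℕ → ℝ} (h : IsModeSeq lam) (n : ℕ) : 0 < lam n :=
  lt_of_lt_of_le (by norm_num) (h.half_le n)

theorem summable_succ_pow_mul_exp (s : ℕ) {c : ℝ} (hc : 0 < c) :
    Summable fun n : ℕ => ((n : ℝ) + 1) ^ s * Real.exp (-c * ((n : ℝ) + 1)) := by
  have := (summable_nat_add_iff 1).mpr (Real.summable_pow_mul_exp_neg_nat_mul s hc)
  simpa using this

theorem IsModeSeq.summable_lambert {lam : ℕ → ℝ} (h : IsModeSeq lam) (u s : ℕ) {t : ℝ}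
    (ht : 0 < t) : Summable fun p : ℕ × ℕ =>
      ((p.2 : ℝ) + 1) ^ u * lam p.1 ^ s * Real.exp (-t * (((p.2 : ℝ) + 1) * lam p.1)) := by
  have h1 := (summable_succ_pow_mul_exp s (c := t / 4) (by positivity)).mul_of_nonneg
    (summable_succ_pow_mul_exp u (c := t / 4) (by positivity))
    (fun n => by positivity) (fun n => by positivity)
  refine h1.of_nonneg_of_le (fun p => ?_) (fun p => ?_)
  · have := (h.pos p.1).le
    positivity
  · have h2 := (h.pos p.1).le
    have h3 := h.upper p.1
    have h4 := h.lower p.1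
    have h5 : (0 : ℝ) ≤ p.1 := p.1.cast_nonneg
    have h6 : (0 : ℝ) ≤ p.2 := p.2.cast_nonneg
    -- From `2xy ≥ x + y` for `x, y ≥ 1` and `λ_n ≥ (n+1)/2`. The sum decouples the exponential, so
    -- a product of two one-variable series dominates.
    have h7 : ((p.1 : ℝ) + 1) / 4 + ((p.2 : ℝ) + 1) / 4 ≤ ((p.2 : ℝ) + 1) * lam p.1 := by
      have : ((p.2 : ℝ) + 1) * (((p.1 : ℝ) + 1) / 2) ≤ ((p.2 : ℝ) + 1) * lam p.1 := by gcongr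
      nlinarith [mul_nonneg h5 h6]
    calc _ ≤ ((p.2 : ℝ) + 1) ^ u * ((p.1 : ℝ) + 1) ^ s *
          Real.exp (-t * (((p.1 : ℝ) + 1) / 4 + ((p.2 : ℝ) + 1) / 4)) := by
          gcongr ?_ * ?_ ^ s * Real.exp ?_
          nlinarith
      _ = _ := by
          rw [show -t * (((p.1 : ℝ) + 1) / 4 + ((p.2 : ℝ) + 1) / 4) =
            -(t / 4) * ((p.1 : ℝ) + 1) + -(t / 4) * ((p.2 : ℝ) + 1) by ring, Real.exp_add]
          ring

theorem energy_add (lam : ℕ → ℝ) (a b : ℕ →₀ ℕ) (r : ℕ) :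
    energy lam (a + b) r = energy lam a r + energy lam b r := by
  rw [energy, Finsupp.sum_add_index'] <;> intros <;> simp [energy, add_mul]

theorem energy_single (lam : ℕ → ℝ) (n m r : ℕ) :
    energy lam (Finsupp.single n m) r = m * lam n ^ (2 * r + 1) := by
  rw [energy, Finsupp.sum_single_index (by simp)]

theorem IsModeSeq.energy_nonneg {lam : ℕ → ℝ} (h : IsModeSeq lam) (a : ℕ →₀ ℕ) (r : ℕ) :
    0 ≤ energy lam a r :=
  Finset.sum_nonneg fun n _ => mul_nonneg (Nat.cast_nonneg _) (pow_nonneg (h.pos n).le _)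

theorem IsModeSeq.mul_le_energy {lam : ℕ → ℝ} (h : IsModeSeq lam) (a : ℕ →₀ ℕ) (n : ℕ) :
    a n * lam n ≤ energy lam a 0 := by
  by_cases hn : n ∈ a.support
  · have := Finset.single_le_sum (f := fun n => (a n : ℝ) * lam n ^ (2 * 0 + 1))
      (fun n _ => mul_nonneg (Nat.cast_nonneg _) (pow_nonneg (h.pos n).le _)) hn
    simpa [energy, Finsupp.sum] using this
  · rw [Finsupp.notMem_support_iff.mp hn]
    simpa using h.energy_nonneg a 0

theorem IsModeSeq.le_energy {lam : ℕ → ℝ} (h : IsModeSeq lam) (a : ℕ →₀ ℕ) (n : ℕ) :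
    (a n : ℝ) ≤ 2 * energy lam a 0 := by
  have h1 := h.mul_le_energy a n
  have h2 : (a n : ℝ) * (1 / 2) ≤ a n * lam n :=
    mul_le_mul_of_nonneg_left (h.half_le n) (Nat.cast_nonneg _)
  linarith

/-- Each occupied mode has energy at most the total `E`, so `∑ a_n λ_n^{2r+1} ≤ E^{2r} ∑ a_n λ_n`.
All eigenvalues thus grow at most polynomially in the energy. -/
theorem IsModeSeq.energy_le_pow {lam : ℕ → ℝ} (h : IsModeSeq lam) (a : ℕ →₀ ℕ) (r : ℕ) :
    energy lam a r ≤ energy lam a 0 ^ (2 * r + 1) := by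
  have h0 : energy lam a 0 = ∑ n ∈ a.support, (a n : ℝ) * lam n := by simp [energy, Finsupp.sum]
  conv_rhs => rw [pow_succ', h0, Finset.sum_mul]
  rw [energy, Finsupp.sum]
  refine Finset.sum_le_sum fun n hn => ?_
  rw [pow_succ', ← mul_assoc]
  have h1 : lam n ≤ energy lam a 0 := by
    refine le_trans ?_ (h.mul_le_energy a n)
    have : (1 : ℝ) ≤ a n := by
      exact_mod_cast Nat.one_le_iff_ne_zero.mpr (Finsupp.mem_support_iff.mp hn)
    nlinarith [h.pos n]
  have h2 := h.pos n
  rw [← h0]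
  gcongr

/-- A state is determined by its graph, a finite set of pairs `(n, a n)`, and its weight is the
product of `f` over that graph. Summability of `f` makes the products over all finite subsets of `ℕ
× ℕ` summable. -/
theorem IsModeSeq.summable_exp_energy {lam : ℕ → ℝ} (h : IsModeSeq lam) {t : ℝ} (ht : 0 < t) :
    Summable fun a : ℕ →₀ ℕ => Real.exp (-t * energy lam a 0) := by
  -- Pairs `(n, 0)` never lie in a graph; had they kept the value `exp 0 = 1`, `f` would not be
  -- summable.
  let f : ℕ × ℕ → ℝ := fun p => if p.2 = 0 then 0 else Real.exp (-t * (p.2 * lam p.1))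
  have hf0 : ∀ p, 0 ≤ f p := fun p => by
    simp only [f]; split_ifs <;> positivity
  have hf : Summable f := by
    have hinj : Function.Injective fun p : ℕ × ℕ => (p.1, p.2 + 1) := by
      rintro ⟨a, b⟩ ⟨c, d⟩ h
      simpa using h
    rw [← hinj.summable_iff]
    · refine (h.summable_lambert 0 0 ht).congr fun p => ?_
      simp [f]
    · rintro ⟨a, b⟩ hp
      have : b = 0 := by
        by_contra hb
        exact hp ⟨(a, b - 1), by simp only [Prod.mk.injEq, true_and]; omega⟩
      simp [f, this]
  have h1 := (summable_finsetProd_of_summable_nonneg hf0 hf).comp_injective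
    (Finsupp.graph_injective ℕ ℕ)
  refine h1.congr fun a => ?_
  simp only [Function.comp_apply, Finsupp.graph, Finset.prod_map]
  rw [energy, Finsupp.sum, Finset.mul_sum, Real.exp_sum]
  refine Finset.prod_congr rfl fun n hn => ?_
  change (if a n = 0 then 0 else Real.exp (-t * (a n * lam n))) = _
  rw [if_neg (Finsupp.mem_support_iff.mp hn)]
  simp

theorem IsModeSeq.summable_energy_pow_mul_exp {lam : ℕ → ℝ} (h : IsModeSeq lam) (N : ℕ) {t : ℝ}
    (ht : 0 < t) :
    Summable fun a : ℕ →₀ ℕ => (1 + energy lam a 0) ^ N * Real.exp (-t * energy lam a 0) := by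
  -- Half of the exponential absorbs the polynomial: the constant comes from `x^N / N! ≤ exp x` at
  -- `x = t(1+u)/2`.
  refine ((h.summable_exp_energy (half_pos ht)).mul_left
    (N.factorial * (2 / t) ^ N * Real.exp (t / 2))).of_nonneg_of_le (fun a => ?_) (fun a => ?_)
  · have := h.energy_nonneg a 0
    positivity
  · have h0 := h.energy_nonneg a 0
    set u := energy lam a 0
    have h1 := Real.pow_div_factorial_le_exp (t / 2 * (1 + u)) (by positivity) N
    have h2 : (1 + u) ^ N ≤ N.factorial * (2 / t) ^ N * Real.exp (t / 2 * (1 + u)) := by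
      rw [div_le_iff₀ (by positivity), mul_pow] at h1
      calc (1 + u) ^ N = (2 / t) ^ N * ((t / 2) ^ N * (1 + u) ^ N) := by
            rw [← mul_assoc, ← mul_pow]
            field_simp
            simp
        _ ≤ (2 / t) ^ N * (Real.exp (t / 2 * (1 + u)) * N.factorial) := by gcongr
        _ = _ := by ring
    calc (1 + u) ^ N * Real.exp (-t * u)
        ≤ N.factorial * (2 / t) ^ N * Real.exp (t / 2 * (1 + u)) * Real.exp (-t * u) := by gcongr
      _ = N.factorial * (2 / t) ^ N * Real.exp (t / 2) * Real.exp (-(t / 2) * u) := by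
        rw [mul_assoc, ← Real.exp_add, mul_assoc _ (Real.exp (t / 2)), ← Real.exp_add]
        ring_nf

theorem norm_exp_mul (τ : ℂ) (x : ℝ) :
    ‖Complex.exp (2 * Real.pi * Complex.I * τ * x)‖ = Real.exp (-(2 * Real.pi * τ.im) * x) := by
  rw [Complex.norm_exp]
  congr 1
  simp

/-- The eigenvalues of a state with given occupation numbers. -/
def stateEv (lam : ℕ → ℝ) (c : ℕ → ℂ) (a : ℕ →₀ ℕ) : ℕ → ℂ := fun r => c r + energy lam a r

/-- The coefficient at `I` is `q^{energy}` times a monomial in finitely many eigenvalues, each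
polynomially bounded in the energy. -/
theorem IsModeSeq.norm_coeff_charExp_le {lam : ℕ → ℝ} (h : IsModeSeq lam) (c : ℕ → ℂ)
    (τ : UpperHalfPlane) (I : ℕ →₀ ℕ) : ∃ (C : ℝ) (N : ℕ), 0 ≤ C ∧ ∀ a : ℕ →₀ ℕ,
      ‖MvPowerSeries.coeff I (charExp τ (stateEv lam c a))‖ ≤
        C * ((1 + energy lam a 0) ^ N * Real.exp (-(2 * Real.pi * τ.im) * energy lam a 0)) := by
  have key : ∀ s : Finset ℕ, ∃ (C : ℝ) (N : ℕ), 0 ≤ C ∧ ∀ a : ℕ →₀ ℕ,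
      ‖∏ k ∈ s, (2 * Real.pi * Complex.I * stateEv lam c a (k + 1)) ^ I k /
        ((I k).factorial : ℂ)‖ ≤ C * (1 + energy lam a 0) ^ N := by
    intro s
    induction s using Finset.induction_on with
    | empty => exact ⟨1, 0, by norm_num, fun a => by simp⟩
    | insert k s hk ih =>
      obtain ⟨C, N, hC, hb⟩ := ih
      refine ⟨(2 * Real.pi * (‖c (k + 1)‖ + 1)) ^ I k * C, (2 * (k + 1) + 1) * I k + N,
        by positivity, fun a => ?_⟩
      have h0 := h.energy_nonneg a 0
      have h0' := h.energy_nonneg a (k + 1)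
      rw [Finset.prod_insert hk, norm_mul]
      have h1 : ‖stateEv lam c a (k + 1)‖ ≤
          (‖c (k + 1)‖ + 1) * (1 + energy lam a 0) ^ (2 * (k + 1) + 1) := by
        have h2 : energy lam a (k + 1) ≤ (1 + energy lam a 0) ^ (2 * (k + 1) + 1) :=
          (h.energy_le_pow a (k + 1)).trans (by gcongr; linarith)
        have h3 : 1 ≤ (1 + energy lam a 0) ^ (2 * (k + 1) + 1) :=
          one_le_pow₀ (by linarith)
        calc ‖stateEv lam c a (k + 1)‖ ≤ ‖c (k + 1)‖ + ‖(energy lam a (k + 1) : ℂ)‖ :=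
              norm_add_le _ _
          _ = ‖c (k + 1)‖ * 1 + energy lam a (k + 1) := by
              rw [Complex.norm_real, Real.norm_of_nonneg h0', mul_one]
          _ ≤ ‖c (k + 1)‖ * (1 + energy lam a 0) ^ (2 * (k + 1) + 1) +
                (1 + energy lam a 0) ^ (2 * (k + 1) + 1) := by gcongr
          _ = _ := by ring
      have h4 : ‖(2 * Real.pi * Complex.I * stateEv lam c a (k + 1)) ^ I k /
          ((I k).factorial : ℂ)‖ ≤ (2 * Real.pi * (‖c (k + 1)‖ + 1)) ^ I k *
            (1 + energy lam a 0) ^ ((2 * (k + 1) + 1) * I k) := by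
        rw [norm_div, norm_pow, norm_mul, norm_mul, norm_mul, Complex.norm_I, Complex.norm_natCast,
          Complex.norm_real, Complex.norm_ofNat, Real.norm_of_nonneg Real.pi_pos.le, mul_one]
        have h5 : (1 : ℝ) ≤ (I k).factorial := by exact_mod_cast (I k).factorial_pos
        refine (div_le_self (by positivity) h5).trans ?_
        rw [pow_mul, ← mul_pow]
        refine pow_le_pow_left₀ (by positivity) ?_ _
        rw [mul_assoc (2 * Real.pi)]
        gcongr
      calc _ ≤ ((2 * Real.pi * (‖c (k + 1)‖ + 1)) ^ I k *
            (1 + energy lam a 0) ^ ((2 * (k + 1) + 1) * I k)) * (C * (1 + energy lam a 0) ^ N) :=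
            mul_le_mul h4 (hb a) (norm_nonneg _) (by positivity)
        _ = _ := by rw [pow_add]; ring
  obtain ⟨C, N, hC, hb⟩ := key I.support
  refine ⟨‖Complex.exp (2 * Real.pi * Complex.I * τ * c 0)‖ * C, N, by positivity, fun a => ?_⟩
  rw [coeff_charExp, norm_mul, stateEv, mul_add, Complex.exp_add, norm_mul, norm_exp_mul,
    UpperHalfPlane.coe_im]
  have := mul_le_mul_of_nonneg_left (hb a) (mul_nonneg (norm_nonneg
    (Complex.exp (2 * Real.pi * Complex.I * τ * c 0)))
    (Real.exp_pos (-(2 * Real.pi * τ.im) * energy lam a 0)).le)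
  refine this.trans_eq ?_
  ring

theorem IsModeSeq.summable_energy_pow_mul_charExp {lam : ℕ → ℝ} (h : IsModeSeq lam) (c : ℕ → ℂ)
    (τ : UpperHalfPlane) (I : ℕ →₀ ℕ) (M : ℕ) : Summable fun a : ℕ →₀ ℕ =>
      (1 + energy lam a 0) ^ M * ‖MvPowerSeries.coeff I (charExp τ (stateEv lam c a))‖ := by
  obtain ⟨C, N, hC, hb⟩ := h.norm_coeff_charExp_le c τ I
  have ht : 0 < 2 * Real.pi * τ.im := by have := τ.im_pos; positivity
  refine ((h.summable_energy_pow_mul_exp (M + N) ht).mul_left C).of_nonneg_of_le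
    (fun a => ?_) (fun a => ?_)
  · have := h.energy_nonneg a 0
    positivity
  · have := h.energy_nonneg a 0
    calc _ ≤ (1 + energy lam a 0) ^ M * (C * ((1 + energy lam a 0) ^ N *
          Real.exp (-(2 * Real.pi * τ.im) * energy lam a 0))) := by gcongr; exact hb a
      _ = _ := by rw [pow_add]; ring

theorem IsModeSeq.summable_norm_charExp {lam : ℕ → ℝ} (h : IsModeSeq lam) (c : ℕ → ℂ)
    (τ : UpperHalfPlane) (I : ℕ →₀ ℕ) : Summable fun a : ℕ →₀ ℕ =>
      ‖MvPowerSeries.coeff I (charExp τ (stateEv lam c a))‖ := by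
  simpa using h.summable_energy_pow_mul_charExp c τ I 0

end

section

open scoped MvPowerSeries.WithPiTopology

/-! ## The logarithmic derivatives of the characters -/

/-- The contribution of one particle in the mode `n` to the eigenvalues. -/
def modeEv (lam : ℕ → ℝ) (n : ℕ) : ℕ → ℂ := fun r => (lam n : ℂ) ^ (2 * r + 1)

theorem stateEv_add_single (lam : ℕ → ℝ) (c : ℕ → ℂ) (a : ℕ →₀ ℕ) (n : ℕ) :
    stateEv lam c (a + Finsupp.single n 1) = modeEv lam n + stateEv lam c a := by
  ext r
  simp only [stateEv, modeEv, Pi.add_apply, energy_add, energy_single]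
  push_cast
  ring

theorem charExp_stateEv_add_single (lam : ℕ → ℝ) (c : ℕ → ℂ) (τ : ℂ) (a : ℕ →₀ ℕ) (n : ℕ) :
    charExp τ (stateEv lam c (a + Finsupp.single n 1)) =
      charExp τ (modeEv lam n) * charExp τ (stateEv lam c a) := by
  rw [stateEv_add_single, charExp_add]

/-- Adding a particle in mode `n` maps all states bijectively onto those with `a n > 0`, multiplies
the exponential by that of the mode, and raises the occupation to `a n + 1`. States outside the
image have weight zero in `A`. -/
theorem boson_occupation_relation {lam : ℕ → ℝ} {c : ℕ → ℂ} {τ : ℂ} {Z A : MvPowerSeries ℕ ℂ}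
    {n : ℕ} (hZ : HasSum (fun a => charExp τ (stateEv lam c a)) Z)
    (hA : HasSum (fun a => (a n : ℂ) • charExp τ (stateEv lam c a)) A) :
    A = charExp τ (modeEv lam n) * (Z + A) := by
  have h1 := (hZ.add hA).mul_left (charExp τ (modeEv lam n))
  have hinj : Function.Injective fun a : ℕ →₀ ℕ => a + Finsupp.single n 1 :=
    add_left_injective _
  refine hA.unique ((hinj.hasSum_iff ?_).mp (h1.congr_fun fun a => ?_))
  · intro a ha
    have h0 : a n = 0 := by
      by_contra h0
      refine ha ⟨a - Finsupp.single n 1, tsub_add_cancel_of_le ?_⟩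
      rw [Finsupp.single_le_iff]
      omega
    rw [h0, Nat.cast_zero, zero_smul]
  · simp only [Function.comp_apply, charExp_stateEv_add_single, Finsupp.add_apply,
      Finsupp.single_eq_same, MvPowerSeries.smul_eq_C_mul]
    push_cast
    rw [map_add, map_one]
    ring

/-- The states are reindexed by the involution which toggles `n`. The factor `1 - occupation` on the
right kills the states already containing `n`, reflecting the exclusion principle. -/
theorem fermion_occupation_relation {lam : ℕ → ℝ} {c : ℕ → ℂ} {τ : ℂ}
    {Z A : MvPowerSeries ℕ ℂ} {n : ℕ}
    (hZ : HasSum (fun S => charExp τ (stateEv lam c (occupation S))) Z)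
    (hA : HasSum (fun S => (occupation S n : ℂ) • charExp τ (stateEv lam c (occupation S))) A) :
    A = charExp τ (modeEv lam n) * (Z + (-1 : ℂ) • A) := by
  have h1 := (hZ.add (hA.const_smul (-1 : ℂ))).mul_left (charExp τ (modeEv lam n))
  have hinv : Function.Involutive fun S : Finset ℕ => symmDiff S {n} := fun S =>
    symmDiff_symmDiff_cancel_right {n} S
  refine hA.unique ((hinv.toPerm.hasSum_iff).mp (h1.congr_fun fun S => ?_))
  simp only [Function.comp_apply, Function.Involutive.coe_toPerm]
  by_cases hn : n ∈ S
  · have h2 : occupation (symmDiff S {n}) n = 0 := by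
      rw [occupation_apply, if_neg]
      simp [Finset.mem_symmDiff, hn]
    rw [h2, occupation_apply, if_pos hn]
    simp
  · have h2 : occupation (symmDiff S {n}) = occupation S + Finsupp.single n 1 := by
      ext m
      rw [Finsupp.add_apply, occupation_apply, occupation_apply]
      by_cases hm : m = n
      · subst hm
        simp [Finset.mem_symmDiff, hn]
      · simp [Finset.mem_symmDiff, hm]
    rw [h2, charExp_stateEv_add_single, Finsupp.add_apply, occupation_apply, if_neg hn]
    simp

/-- The terms of the Lambert series
`∑_{n,m} ε^m (m+1)^u λ_n^s q^{(m+1)λ_n}`. -/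
def lambertTerm (ε : ℂ) (lam : ℕ → ℝ) (u s : ℕ) (τ : ℂ) (p : ℕ × ℕ) : ℂ :=
  ε ^ p.2 * ((p.2 : ℂ) + 1) ^ u * (lam p.1 : ℂ) ^ s *
    Complex.exp (2 * Real.pi * Complex.I * τ * (((p.2 : ℝ) + 1) * lam p.1 : ℝ))

theorem IsModeSeq.summable_norm_lambertTerm {lam : ℕ → ℝ} (h : IsModeSeq lam) {ε : ℂ}
    (hε : ‖ε‖ = 1) (u s : ℕ) (τ : UpperHalfPlane) :
    Summable fun p => ‖lambertTerm ε lam u s τ p‖ := by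
  have ht : 0 < 2 * Real.pi * τ.im := by have := τ.im_pos; positivity
  refine (h.summable_lambert u s ht).congr fun p => ?_
  have h0 := (h.pos p.1).le
  have h1 : ‖(p.2 : ℂ) + 1‖ = (p.2 : ℝ) + 1 := by exact_mod_cast Complex.norm_natCast (p.2 + 1)
  rw [lambertTerm, norm_mul, norm_mul, norm_mul, norm_pow, norm_pow, norm_pow, hε, one_pow,
    one_mul, h1, Complex.norm_real, Real.norm_of_nonneg h0, norm_exp_mul, UpperHalfPlane.coe_im]

/-- The Lambert series `∑_{n,m} ε^m (m+1)^u λ_n^s q^{(m+1)λ_n}`. -/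
def lambert (ε : ℂ) (lam : ℕ → ℝ) (u s : ℕ) (τ : ℂ) : ℂ := ∑' p, lambertTerm ε lam u s τ p

theorem coeff_charExp_nsmul_modeEv (lam : ℕ → ℝ) (τ : ℂ) (n m : ℕ) (I : ℕ →₀ ℕ) :
    MvPowerSeries.coeff I (charExp τ ((m + 1) • modeEv lam n)) =
      (2 * Real.pi * Complex.I) ^ I.degree / (I.prod fun _ a => (a.factorial : ℂ)) *
        (((m : ℂ) + 1) ^ I.degree * (lam n : ℂ) ^ (I.sum fun k a => (2 * k + 3) * a) *
          Complex.exp (2 * Real.pi * Complex.I * τ * (((m : ℝ) + 1) * lam n : ℝ))) := by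
  have h1 : (I.prod fun k a => (2 * Real.pi * Complex.I * ((m + 1) • modeEv lam n) (k + 1)) ^ a /
      (a.factorial : ℂ)) = (2 * Real.pi * Complex.I) ^ I.degree *
        ((m : ℂ) + 1) ^ I.degree * (lam n : ℂ) ^ (I.sum fun k a => (2 * k + 3) * a) /
          (I.prod fun _ a => (a.factorial : ℂ)) := by
    simp only [Finsupp.prod, Finsupp.sum, Finset.prod_div_distrib, Finsupp.degree_apply,
      ← Finset.prod_pow_eq_pow_sum, ← Finset.prod_mul_distrib]
    congr 1
    refine Finset.prod_congr rfl fun k _ => ?_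
    simp only [Pi.smul_apply, modeEv, nsmul_eq_mul, pow_mul, mul_pow]
    push_cast
    ring_nf
  rw [coeff_charExp, h1]
  have h2 : (2 * Real.pi * Complex.I * τ * ((m + 1) • modeEv lam n) 0 : ℂ) =
      2 * Real.pi * Complex.I * τ * (((m : ℝ) + 1) * lam n : ℝ) := by
    simp [modeEv]
  rw [h2]
  ring

/-- The power series `∑_{n,m} ε^m λ_n^{2r+1} exp (2πi (m+1) ∑_k τ_{2k+1} λ_n^{2k+1})`. -/
def lambertSeries (ε : ℂ) (lam : ℕ → ℝ) (τ : ℂ) (r : ℕ) : MvPowerSeries ℕ ℂ := fun I : ℕ →₀ ℕ =>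
  (2 * Real.pi * Complex.I) ^ I.degree / (I.prod fun _ a => (a.factorial : ℂ)) *
    lambert ε lam I.degree (2 * r + 1 + I.sum fun k a => (2 * k + 3) * a) τ

/-- The logarithmic derivative `c_r + ∑_{n,m} ε^m λ_n^{2r+1} ⋯` of a character. -/
def logSeries (ε : ℂ) (lam : ℕ → ℝ) (c : ℕ → ℂ) (τ : ℂ) (r : ℕ) : MvPowerSeries ℕ ℂ :=
  MvPowerSeries.C (c r) + lambertSeries ε lam τ r

theorem coeff_lambertSeries (ε : ℂ) (lam : ℕ → ℝ) (τ : ℂ) (r : ℕ) (I : ℕ →₀ ℕ) :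
    MvPowerSeries.coeff I (lambertSeries ε lam τ r) =
      (2 * Real.pi * Complex.I) ^ I.degree / (I.prod fun _ a => (a.factorial : ℂ)) *
        lambert ε lam I.degree (2 * r + 1 + I.sum fun k a => (2 * k + 3) * a) τ := rfl

theorem coeff_logSeries (ε : ℂ) (lam : ℕ → ℝ) (c : ℕ → ℂ) (τ : ℂ) (r : ℕ) (I : ℕ →₀ ℕ) :
    MvPowerSeries.coeff I (logSeries ε lam c τ r) = (if I = 0 then c r else 0) +
      (2 * Real.pi * Complex.I) ^ I.degree / (I.prod fun _ a => (a.factorial : ℂ)) *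
        lambert ε lam I.degree (2 * r + 1 + I.sum fun k a => (2 * k + 3) * a) τ := by
  rw [logSeries, map_add, MvPowerSeries.coeff_C, coeff_lambertSeries]

section

variable {lam : ℕ → ℝ} (h : IsModeSeq lam) {ε : ℂ} (hε : ‖ε‖ = 1) (τ : UpperHalfPlane)
include h hε

theorem IsModeSeq.hasSum_lambertSeries (r : ℕ) :
    HasSum (fun p : ℕ × ℕ => (ε ^ p.2 * (lam p.1 : ℂ) ^ (2 * r + 1)) •
      charExp τ ((p.2 + 1) • modeEv lam p.1)) (lambertSeries ε lam τ r) := by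
  rw [MvPowerSeries.WithPiTopology.hasSum_iff_hasSum_coeff]
  intro I
  rw [coeff_lambertSeries]
  have h1 := (h.summable_norm_lambertTerm hε I.degree
    (2 * r + 1 + I.sum fun k a => (2 * k + 3) * a) τ).of_norm.hasSum.mul_left
      ((2 * Real.pi * Complex.I) ^ I.degree / (I.prod fun _ a => (a.factorial : ℂ)))
  refine h1.congr_fun fun p => ?_
  rw [map_smul, coeff_charExp_nsmul_modeEv, lambertTerm, smul_eq_mul, pow_add (lam p.1 : ℂ)]
  ring

theorem IsModeSeq.exists_hasSum_mode (n : ℕ) : ∃ y : MvPowerSeries ℕ ℂ,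
    HasSum (fun m : ℕ => ε ^ m • charExp τ ((m + 1) • modeEv lam n)) y := by
  refine MvPowerSeries.WithPiTopology.summable_iff_summable_coeff.mpr fun I => ?_
  have h1 := ((h.summable_norm_lambertTerm hε I.degree
    (I.sum fun k a => (2 * k + 3) * a) τ).of_norm.prod_factor n).mul_left
      ((2 * Real.pi * Complex.I) ^ I.degree / (I.prod fun _ a => (a.factorial : ℂ)))
  refine h1.congr fun m => ?_
  rw [map_smul, coeff_charExp_nsmul_modeEv, lambertTerm, smul_eq_mul]
  ring

omit hε in
theorem IsModeSeq.norm_exp_lt_one (n : ℕ) :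
    ‖Complex.exp (2 * Real.pi * Complex.I * τ * lam n)‖ < 1 := by
  rw [norm_exp_mul, Real.exp_lt_one_iff, UpperHalfPlane.coe_im]
  have h1 := τ.im_pos
  have h2 := h.pos n
  have : 0 < 2 * Real.pi * τ.im * lam n := by positivity
  linarith

/-- The geometric series satisfies `y = X (1 + ε y)`, so `y Z` and `A` solve the same linear
equation. The factor `1 - ε X` can be cancelled in the domain of power series: it is nonzero because
the constant coefficient of `X` has modulus less than one. -/
theorem IsModeSeq.eq_mul_of_relation {n : ℕ} {Z A y : MvPowerSeries ℕ ℂ}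
    (hA : A = charExp τ (modeEv lam n) * (Z + ε • A))
    (hy : HasSum (fun m : ℕ => ε ^ m • charExp τ ((m + 1) • modeEv lam n)) y) :
    A = y * Z := by
  set X := charExp τ (modeEv lam n) with hX
  have h1 : y = X + X * (ε • y) := by
    have h2 := (hasSum_nat_add_iff' (f := fun m : ℕ => ε ^ m •
      charExp τ ((m + 1) • modeEv lam n)) 1).mpr hy
    have h3 : HasSum (fun m : ℕ => ε ^ (m + 1) • charExp τ ((m + 1 + 1) • modeEv lam n))
        (X * (ε • y)) := by
      refine ((hy.const_smul ε).mul_left X).congr_fun fun m => ?_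
      rw [succ_nsmul (modeEv lam n) (m + 1), charExp_add, smul_smul, ← pow_succ', ← hX,
        mul_smul_comm, mul_comm X]
    have h4 := h2.unique h3
    rw [Finset.sum_range_one, pow_zero, one_smul, zero_add, one_smul, ← hX] at h4
    rw [← h4]
    ring
  have hne : 1 - ε • X ≠ 0 := by
    intro h0
    have h5 := congrArg MvPowerSeries.constantCoeff h0
    rw [map_sub, map_one, map_zero, MvPowerSeries.smul_eq_C_mul, map_mul,
      MvPowerSeries.constantCoeff_C, hX, constantCoeff_charExp, sub_eq_zero] at h5
    have h6 := congrArg norm h5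
    rw [norm_one, norm_mul, hε, one_mul] at h6
    have h7 := h.norm_exp_lt_one τ n
    simp only [modeEv, mul_zero, zero_add, pow_one] at h6
    exact absurd h6.symm h7.ne
  rw [MvPowerSeries.smul_eq_C_mul] at h1 hA hne
  refine mul_right_cancel₀ hne ?_
  linear_combination hA - h1 * Z

variable {ι : Type} {occ : ι → ℕ →₀ ℕ} (hocc : Function.Injective occ) (c : ℕ → ℂ)
include hocc

/-- The sum of the exponential series of all states, weighted by an eigenvalue. -/
theorem IsModeSeq.hasSum_stateEv_smul {Z : MvPowerSeries ℕ ℂ}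
    (hZ : HasSum (fun i => charExp τ (stateEv lam c (occ i))) Z)
    (hrel : ∀ (n : ℕ) (A : MvPowerSeries ℕ ℂ),
      HasSum (fun i => (occ i n : ℂ) • charExp τ (stateEv lam c (occ i))) A →
        A = charExp τ (modeEv lam n) * (Z + ε • A)) (r : ℕ) :
    HasSum (fun i => stateEv lam c (occ i) r • charExp τ (stateEv lam c (occ i)))
      (Z * logSeries ε lam c τ r) := by
  choose y hy using h.exists_hasSum_mode hε τ
  have hAs : ∀ n, ∃ A, HasSum (fun i => (occ i n : ℂ) • charExp τ (stateEv lam c (occ i))) A := by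
    intro n
    refine MvPowerSeries.WithPiTopology.summable_iff_summable_coeff.mpr fun I =>
      Summable.of_norm ?_
    refine (((h.summable_energy_pow_mul_charExp c τ I 1).mul_left 2).comp_injective
      hocc).of_nonneg_of_le (fun i => norm_nonneg _) fun i => ?_
    rw [map_smul, norm_smul, Complex.norm_natCast, Function.comp_apply, pow_one, ← mul_assoc]
    have h1 := h.le_energy (occ i) n
    gcongr
    linarith
  choose A hA using hAs
  have hAy : ∀ n, A n = y n * Z := fun n => h.eq_mul_of_relation hε τ (hrel n _ (hA n)) (hy n)
  have hmodes : ∀ I, HasSum (fun n => (lam n : ℂ) ^ (2 * r + 1) * MvPowerSeries.coeff I (A n))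
      (MvPowerSeries.coeff I (Z * lambertSeries ε lam τ r)) := by
    have h1 := (h.hasSum_lambertSeries hε τ r).mul_left Z
    rw [MvPowerSeries.WithPiTopology.hasSum_iff_hasSum_coeff] at h1
    intro I
    refine (h1 I).prod_fiberwise fun n => ?_
    have h2 := ((hy n).const_smul ((lam n : ℂ) ^ (2 * r + 1))).mul_left Z
    rw [MvPowerSeries.WithPiTopology.hasSum_iff_hasSum_coeff] at h2
    have h3 : (lam n : ℂ) ^ (2 * r + 1) * MvPowerSeries.coeff I (A n) =
        MvPowerSeries.coeff I (Z * (lam n : ℂ) ^ (2 * r + 1) • y n) := by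
      rw [hAy, mul_smul_comm, map_smul, smul_eq_mul, mul_comm Z]
    rw [h3]
    refine (h2 I).congr_fun fun m => ?_
    rw [smul_smul, mul_comm (ε ^ m)]
  rw [MvPowerSeries.WithPiTopology.hasSum_iff_hasSum_coeff] at hZ ⊢
  intro I
  -- The double family over states and modes. Summing over modes first yields the energies; summing
  -- over states first yields the `A n = y n * Z`. Absolute convergence, `hf` below, equates the
  -- two.
  let f : ι × ℕ → ℂ := fun p => (lam p.2 : ℂ) ^ (2 * r + 1) *
    (occ p.1 p.2 * MvPowerSeries.coeff I (charExp τ (stateEv lam c (occ p.1))))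
  have hfib : ∀ i, HasSum (fun n => f (i, n)) (energy lam (occ i) r *
      MvPowerSeries.coeff I (charExp τ (stateEv lam c (occ i)))) := by
    intro i
    have h1 := hasSum_sum_of_ne_finset_zero (L := .unconditional ℕ) (f := fun n => f (i, n)) (s := (occ i).support)
      fun n hn => by simp [f, Finsupp.notMem_support_iff.mp hn]
    convert h1 using 1
    rw [energy, Finsupp.sum, Complex.ofReal_sum, Finset.sum_mul]
    refine Finset.sum_congr rfl fun n _ => ?_
    simp only [f]
    push_cast
    ring
  have hfibn : ∀ i, HasSum (fun n => ‖f (i, n)‖) (energy lam (occ i) r *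
      ‖MvPowerSeries.coeff I (charExp τ (stateEv lam c (occ i)))‖) := by
    intro i
    have h1 := hasSum_sum_of_ne_finset_zero (L := .unconditional ℕ) (f := fun n => ‖f (i, n)‖) (s := (occ i).support)
      fun n hn => by simp [f, Finsupp.notMem_support_iff.mp hn]
    convert h1 using 1
    rw [energy, Finsupp.sum, Finset.sum_mul]
    refine Finset.sum_congr rfl fun n _ => ?_
    simp only [f, norm_mul, norm_pow, Complex.norm_real, Real.norm_of_nonneg (h.pos n).le,
      Complex.norm_natCast]
    ring
  have hf : Summable f := by
    refine Summable.of_norm ((summable_prod_of_nonneg fun p => norm_nonneg _).mpr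
      ⟨fun i => (hfibn i).summable, ?_⟩)
    have h1 : (fun i => ∑' n, ‖f (i, n)‖) = fun i => energy lam (occ i) r *
        ‖MvPowerSeries.coeff I (charExp τ (stateEv lam c (occ i)))‖ :=
      funext fun i => (hfibn i).tsum_eq
    rw [h1]
    refine ((h.summable_energy_pow_mul_charExp c τ I (2 * r + 1)).comp_injective
      hocc).of_nonneg_of_le (fun i => mul_nonneg (h.energy_nonneg _ _) (norm_nonneg _))
        fun i => ?_
    have h2 := h.energy_le_pow (occ i) r
    have h3 := h.energy_nonneg (occ i) 0
    refine mul_le_mul_of_nonneg_right (h2.trans ?_) (norm_nonneg _)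
    gcongr
    linarith
  have hS1 := hf.hasSum.prod_fiberwise hfib
  have hS2 : HasSum (fun n => (lam n : ℂ) ^ (2 * r + 1) * MvPowerSeries.coeff I (A n))
      (∑' p, f p) := by
    have h1 : HasSum (f ∘ Prod.swap) (∑' p, f p) :=
      (Equiv.prodComm ℕ ι).hasSum_iff.mpr hf.hasSum
    refine h1.prod_fiberwise fun n => ?_
    have h2 := (MvPowerSeries.WithPiTopology.hasSum_iff_hasSum_coeff.mp (hA n) I).mul_left
      ((lam n : ℂ) ^ (2 * r + 1))
    refine h2.congr_fun fun i => ?_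
    simp [f]
  rw [hS2.unique (hmodes I)] at hS1
  have hC : HasSum (fun i => c r * MvPowerSeries.coeff I (charExp τ (stateEv lam c (occ i))))
      (MvPowerSeries.coeff I (Z * MvPowerSeries.C (c r))) := by
    rw [mul_comm Z, MvPowerSeries.coeff_C_mul]
    exact (hZ I).mul_left _
  rw [logSeries, mul_add, map_add]
  refine (hC.add hS1).congr_fun fun i => ?_
  rw [map_smul, smul_eq_mul, stateEv]
  ring

/-- Formal differentiation only shifts and rescales coefficients, so it passes through the
coefficientwise sum over states and multiplies each state by `2πi` times its eigenvalue. -/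
theorem IsModeSeq.pderiv_eq {Z : MvPowerSeries ℕ ℂ}
    (hZ : HasSum (fun i => charExp τ (stateEv lam c (occ i))) Z)
    (hrel : ∀ (n : ℕ) (A : MvPowerSeries ℕ ℂ),
      HasSum (fun i => (occ i n : ℂ) • charExp τ (stateEv lam c (occ i))) A →
        A = charExp τ (modeEv lam n) * (Z + ε • A)) (k : ℕ) :
    MvPowerSeries.pderiv ℂ k Z =
      (2 * Real.pi * Complex.I : ℂ) • (Z * logSeries ε lam c τ (k + 1)) := by
  have h1 := (h.hasSum_stateEv_smul hε τ hocc c hZ hrel (k + 1)).const_smul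
    (2 * Real.pi * Complex.I : ℂ)
  refine HasSum.unique ?_ h1
  rw [MvPowerSeries.WithPiTopology.hasSum_iff_hasSum_coeff] at hZ ⊢
  intro I
  rw [MvPowerSeries.coeff_pderiv]
  refine ((hZ (I + Finsupp.single k 1)).mul_right ((I k : ℂ) + 1)).congr_fun fun i => ?_
  rw [← MvPowerSeries.coeff_pderiv, pderiv_charExp, smul_smul]

end

end

/-! ### The three characters as sums over states, and holomorphy of exponential sums -/

section

open scoped MvPowerSeries.WithPiTopology

/-! ## The three characters -/

theorem boson_hasGenCharacter : HasGenCharacter bosonCartan ∧ ∀ τ : UpperHalfPlane,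
    HasSum (fun a => charExp τ (stateEv (fun n => n + 1) bosonConst a))
      (genCharacter bosonCartan τ) := by
  have h := hasGenCharacter_of_basis (MvPolynomial.basisMonomials ℕ ℂ)
    (ev := stateEv (fun n => n + 1) bosonConst) bosonCartan_monomial
    fun τ I => isModeSeq_boson.summable_norm_charExp bosonConst τ I
  exact ⟨h.1, fun τ => MvPowerSeries.WithPiTopology.hasSum_iff_hasSum_coeff.mpr (h.2 τ)⟩

theorem fermion_summable_norm_charExp (τ : UpperHalfPlane) (I : ℕ →₀ ℕ) :
    Summable fun S => ‖MvPowerSeries.coeff I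
      (charExp τ (stateEv (fun n => n + 1 / 2) fermionConst (occupation S)))‖ :=
  (isModeSeq_fermion.summable_norm_charExp fermionConst τ I).comp_injective occupation_injective

theorem fermion_hasGenCharacter : HasGenCharacter fermionCartan ∧ ∀ τ : UpperHalfPlane,
    HasSum (fun S => charExp τ (stateEv (fun n => n + 1 / 2) fermionConst (occupation S)))
      (genCharacter fermionCartan τ) := by
  have h := hasGenCharacter_of_basis fermionBasis
    (ev := fun S => stateEv (fun n => n + 1 / 2) fermionConst (occupation S)) fermionCartan_basis
    fermion_summable_norm_charExp
  exact ⟨h.1, fun τ => MvPowerSeries.WithPiTopology.hasSum_iff_hasSum_coeff.mpr (h.2 τ)⟩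

section

variable {ι κ : Type} {f : ι → MvPowerSeries ℕ ℂ} {g : κ → MvPowerSeries ℕ ℂ}
  (hf : ∀ I, Summable fun i => ‖MvPowerSeries.coeff I (f i)‖)
  (hg : ∀ I, Summable fun j => ‖MvPowerSeries.coeff I (g j)‖)
include hf hg

theorem summable_norm_coeff_mul (I : ℕ →₀ ℕ) :
    Summable fun p : ι × κ => ‖MvPowerSeries.coeff I (f p.1 * g p.2)‖ := by
  simp only [MvPowerSeries.coeff_mul]
  have h1 : ∀ q ∈ Finset.HasAntidiagonal.antidiagonal I, Summable fun p : ι × κ =>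
      ‖MvPowerSeries.coeff q.1 (f p.1) * MvPowerSeries.coeff q.2 (g p.2)‖ := fun q _ =>
    Summable.mul_norm (f := fun i => MvPowerSeries.coeff q.1 (f i))
      (g := fun j => MvPowerSeries.coeff q.2 (g j)) (hf q.1) (hg q.2)
  exact (summable_sum h1).of_nonneg_of_le (fun _ => norm_nonneg _) fun _ => norm_sum_le _ _

theorem hasSum_coeff_mul {F G : MvPowerSeries ℕ ℂ} (hF : HasSum f F) (hG : HasSum g G)
    (I : ℕ →₀ ℕ) :
    HasSum (fun p : ι × κ => MvPowerSeries.coeff I (f p.1 * g p.2))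
      (MvPowerSeries.coeff I (F * G)) := by
  simp only [MvPowerSeries.coeff_mul]
  rw [MvPowerSeries.WithPiTopology.hasSum_iff_hasSum_coeff] at hF hG
  refine hasSum_sum fun q _ => ?_
  exact HasSum.mul (f := fun i => MvPowerSeries.coeff q.1 (f i))
    (g := fun j => MvPowerSeries.coeff q.2 (g j)) (hF q.1) (hG q.2)
    (Summable.mul_norm (f := fun i => MvPowerSeries.coeff q.1 (f i))
      (g := fun j => MvPowerSeries.coeff q.2 (g j)) (hf q.1) (hg q.2)).of_norm

end

/-- On tensor products of eigenvectors the eigenvalues add, hence the exponentials multiply, and the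
sum over pairs of states is a product of absolutely convergent sums. -/
theorem hasGenCharacter_cartan_of_basis {ι κ : Type} {b : Module.Basis ι ℂ BosonFock}
    {c : Module.Basis κ ℂ FermionFock} {ev : ι → ℕ → ℂ} {ev' : κ → ℕ → ℂ}
    (h : ∀ r i, bosonCartan r (b i) = ev i r • b i)
    (h' : ∀ r j, fermionCartan r (c j) = ev' j r • c j)
    (hf : ∀ (τ : UpperHalfPlane) I, Summable fun i => ‖MvPowerSeries.coeff I (charExp τ (ev i))‖)
    (hg : ∀ (τ : UpperHalfPlane) I,
      Summable fun j => ‖MvPowerSeries.coeff I (charExp τ (ev' j))‖) :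
    HasGenCharacter cartan ∧ ∀ τ : UpperHalfPlane,
      genCharacter cartan τ = genCharacter bosonCartan τ * genCharacter fermionCartan τ := by
  have hB := hasGenCharacter_of_basis (b.tensorProduct c) (L := cartan)
    (ev := fun p => ev p.1 + ev' p.2) (cartan_basis h h') fun τ I => by
      simp only [charExp_add]
      exact summable_norm_coeff_mul (hf τ) (hg τ) I
  refine ⟨hB.1, fun τ => ?_⟩
  ext I
  refine (hB.2 τ I).unique ?_
  simp only [charExp_add]
  exact hasSum_coeff_mul (hf τ) (hg τ)
    (MvPowerSeries.WithPiTopology.hasSum_iff_hasSum_coeff.mpr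
      ((hasGenCharacter_of_basis b h hf).2 τ))
    (MvPowerSeries.WithPiTopology.hasSum_iff_hasSum_coeff.mpr
      ((hasGenCharacter_of_basis c h' hg).2 τ)) I

theorem cartan_hasGenCharacter : HasGenCharacter cartan ∧ ∀ τ : UpperHalfPlane,
    genCharacter cartan τ = genCharacter bosonCartan τ * genCharacter fermionCartan τ :=
  hasGenCharacter_cartan_of_basis bosonCartan_monomial fermionCartan_basis
    (fun τ I => isModeSeq_boson.summable_norm_charExp bosonConst τ I)
    fermion_summable_norm_charExp

theorem boson_relation (τ : UpperHalfPlane) (n : ℕ) (A : MvPowerSeries ℕ ℂ)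
    (hA : HasSum (fun a => (a n : ℂ) • charExp τ (stateEv (fun n => n + 1) bosonConst a)) A) :
    A = charExp τ (modeEv (fun n => n + 1) n) * (genCharacter bosonCartan τ + (1 : ℂ) • A) := by
  rw [one_smul]
  exact boson_occupation_relation (boson_hasGenCharacter.2 τ) hA

theorem pderiv_boson (τ : UpperHalfPlane) (k : ℕ) :
    MvPowerSeries.pderiv ℂ k (genCharacter bosonCartan τ) = (2 * Real.pi * Complex.I : ℂ) •
      (genCharacter bosonCartan τ * logSeries 1 (fun n => n + 1) bosonConst τ (k + 1)) :=
  isModeSeq_boson.pderiv_eq (by simp) τ (occ := id) Function.injective_id bosonConst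
    (boson_hasGenCharacter.2 τ) (boson_relation τ) k

theorem pderiv_fermion (τ : UpperHalfPlane) (k : ℕ) :
    MvPowerSeries.pderiv ℂ k (genCharacter fermionCartan τ) = (2 * Real.pi * Complex.I : ℂ) •
      (genCharacter fermionCartan τ *
        logSeries (-1) (fun n => n + 1 / 2) fermionConst τ (k + 1)) :=
  isModeSeq_fermion.pderiv_eq (by simp) τ occupation_injective fermionConst
    (fermion_hasGenCharacter.2 τ)
    (fun _ _ => fermion_occupation_relation (fermion_hasGenCharacter.2 τ)) k

/-! ## Sums of exponentials -/

/-- Absolute convergence of `∑ a_i q^{μ_i}` for all `|q| < 1`. -/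
structure ExpSummable {ι : Type} (a : ι → ℂ) (μ : ι → ℝ) : Prop where
  nonneg : ∀ i, 0 ≤ μ i
  summable : ∀ t : ℝ, 0 < t → Summable fun i => ‖a i‖ * Real.exp (-t * μ i)

/-- The function `∑ a_i q^{μ_i}` on the upper half-plane. -/
def expSum {ι : Type} (a : ι → ℂ) (μ : ι → ℝ) (τ : UpperHalfPlane) : ℂ :=
  ∑' i, a i * Complex.exp (2 * Real.pi * Complex.I * τ * μ i)

section

variable {ι : Type} {a : ι → ℂ} {μ : ι → ℝ}

theorem ExpSummable.mul (h : ExpSummable a μ) : ExpSummable (fun i => a i * μ i) μ := by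
  refine ⟨h.nonneg, fun t ht => ?_⟩
  refine ((h.summable (t / 2) (by positivity)).mul_left (2 / t)).of_nonneg_of_le
    (fun i => by positivity) fun i => ?_
  have h1 := h.nonneg i
  have h2 : t / 2 * μ i ≤ Real.exp (t / 2 * μ i) := by
    linarith [Real.add_one_le_exp (t / 2 * μ i)]
  have h3 : μ i ≤ 2 / t * Real.exp (t / 2 * μ i) := by
    rw [div_mul_eq_mul_div, le_div_iff₀ ht]
    linarith
  rw [norm_mul, Complex.norm_real, Real.norm_of_nonneg h1]
  calc ‖a i‖ * μ i * Real.exp (-t * μ i)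
      ≤ ‖a i‖ * (2 / t * Real.exp (t / 2 * μ i)) * Real.exp (-t * μ i) := by gcongr
    _ = 2 / t * (‖a i‖ * (Real.exp (t / 2 * μ i) * Real.exp (-t * μ i))) := by ring
    _ = _ := by
      rw [← Real.exp_add]
      ring_nf

theorem ExpSummable.summable_norm (h : ExpSummable a μ) (τ : UpperHalfPlane) :
    Summable fun i => ‖a i * Complex.exp (2 * Real.pi * Complex.I * τ * μ i)‖ := by
  have ht : 0 < 2 * Real.pi * τ.im := by have := τ.im_pos; positivity
  refine (h.summable _ ht).congr fun i => ?_
  rw [norm_mul, norm_exp_mul, UpperHalfPlane.coe_im]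

theorem ExpSummable.hasSum (h : ExpSummable a μ) (τ : UpperHalfPlane) :
    HasSum (fun i => a i * Complex.exp (2 * Real.pi * Complex.I * τ * μ i)) (expSum a μ τ) :=
  (h.summable_norm τ).of_norm.hasSum

theorem ExpSummable.hasDerivAt (h : ExpSummable a μ) (τ : UpperHalfPlane) :
    HasDerivAt (fun z : ℂ => ∑' i, a i * Complex.exp (2 * Real.pi * Complex.I * z * μ i))
      (2 * Real.pi * Complex.I * expSum (fun i => a i * μ i) μ τ) τ := by
  set y := τ.im with hy
  have hy0 : 0 < y := τ.im_pos
  have ht : 0 < Real.pi * y := by positivity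
  have hu := (h.mul.summable (Real.pi * y) ht).mul_left (2 * Real.pi)
  -- On this half-plane `exp(-πyμ)` bounds every exponential, which gives a summable majorant for
  -- the termwise derivatives.
  have hopen : IsOpen {z : ℂ | y / 2 < z.im} := isOpen_lt continuous_const Complex.continuous_im
  have hconn : IsPreconnected {z : ℂ | y / 2 < z.im} :=
    (convex_halfSpace_im_gt (y / 2)).isPreconnected
  have hmem : (τ : ℂ) ∈ {z : ℂ | y / 2 < z.im} := by
    simp only [Set.mem_ofPred_eq, UpperHalfPlane.coe_im]
    linarith
  have h1 := hasDerivAt_tsum_of_isPreconnected hu hopen hconn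
    (g := fun i z => a i * Complex.exp (2 * Real.pi * Complex.I * z * μ i))
    (g' := fun i z => 2 * Real.pi * Complex.I *
      (a i * μ i * Complex.exp (2 * Real.pi * Complex.I * z * μ i))) (y₀ := τ)
    (fun i z _ => ?_) (fun i z hz => ?_) hmem (h.summable_norm τ).of_norm hmem
  · rw [tsum_mul_left] at h1
    exact h1
  · have h2 : HasDerivAt (fun z : ℂ => 2 * Real.pi * Complex.I * z * μ i)
        (2 * Real.pi * Complex.I * μ i) z := by
      simpa using ((hasDerivAt_id z).const_mul (2 * Real.pi * Complex.I : ℂ)).mul_const (μ i : ℂ)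
    refine (h2.cexp.const_mul (a i)).congr_deriv ?_
    ring
  · rw [norm_mul, norm_mul, norm_mul, norm_mul, norm_exp_mul, Complex.norm_I, Complex.norm_real,
      Complex.norm_ofNat, Real.norm_of_nonneg Real.pi_pos.le, mul_one]
    have h3 := h.nonneg i
    have h4 : y / 2 < z.im := hz
    have h5 : -(2 * Real.pi * z.im) * μ i ≤ -(Real.pi * y) * μ i := by
      refine mul_le_mul_of_nonneg_right ?_ h3
      nlinarith [Real.pi_pos]
    gcongr

theorem ExpSummable.comp_ofComplex_eq (a : ι → ℂ) (μ : ι → ℝ) (τ : UpperHalfPlane) :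
    expSum a μ ∘ UpperHalfPlane.ofComplex =ᶠ[nhds (τ : ℂ)]
      fun z : ℂ => ∑' i, a i * Complex.exp (2 * Real.pi * Complex.I * z * μ i) := by
  filter_upwards [UpperHalfPlane.isOpen_upperHalfPlaneSet.mem_nhds τ.im_pos] with z hz
  rw [Function.comp_apply, UpperHalfPlane.ofComplex_apply_of_im_pos hz]
  rfl

theorem ExpSummable.mdiff (h : ExpSummable a μ) : MDiff (expSum a μ) := by
  intro τ
  rw [UpperHalfPlane.mdifferentiableAt_iff]
  exact ((h.hasDerivAt τ).congr_of_eventuallyEq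
    (ExpSummable.comp_ofComplex_eq a μ τ)).differentiableAt

theorem ExpSummable.deriv (h : ExpSummable a μ) :
    Derivative.normalizedDerivOfComplex (expSum a μ) = expSum (fun i => a i * μ i) μ := by
  ext τ
  rw [Derivative.normalizedDerivOfComplex, ((h.hasDerivAt τ).congr_of_eventuallyEq
    (ExpSummable.comp_ofComplex_eq a μ τ)).deriv]
  field_simp [Real.pi_ne_zero]

end

theorem IsModeSeq.expSummable_lambert {lam : ℕ → ℝ} (h : IsModeSeq lam) {ε : ℂ}
    (hε : ‖ε‖ = 1) (u s : ℕ) :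
    ExpSummable (fun p : ℕ × ℕ => ε ^ p.2 * ((p.2 : ℂ) + 1) ^ u * (lam p.1 : ℂ) ^ s)
      (fun p => ((p.2 : ℝ) + 1) * lam p.1) := by
  refine ⟨fun p => mul_nonneg (by positivity) (h.pos p.1).le, fun t ht => ?_⟩
  refine (h.summable_lambert u s ht).congr fun p => ?_
  have h1 : ‖(p.2 : ℂ) + 1‖ = (p.2 : ℝ) + 1 := by exact_mod_cast Complex.norm_natCast (p.2 + 1)
  rw [norm_mul, norm_mul, norm_pow, norm_pow, norm_pow, hε, one_pow, one_mul, h1,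
    Complex.norm_real, Real.norm_of_nonneg (h.pos p.1).le]

theorem lambert_eq_expSum (ε : ℂ) (lam : ℕ → ℝ) (u s : ℕ) :
    (fun τ : UpperHalfPlane => lambert ε lam u s τ) =
      expSum (fun p : ℕ × ℕ => ε ^ p.2 * ((p.2 : ℂ) + 1) ^ u * (lam p.1 : ℂ) ^ s)
        (fun p => ((p.2 : ℝ) + 1) * lam p.1) := rfl

theorem IsModeSeq.mdiff_lambert {lam : ℕ → ℝ} (h : IsModeSeq lam) {ε : ℂ} (hε : ‖ε‖ = 1)
    (u s : ℕ) : MDiff (fun τ : UpperHalfPlane => lambert ε lam u s τ) := by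
  rw [lambert_eq_expSum]
  exact (h.expSummable_lambert hε u s).mdiff

theorem IsModeSeq.deriv_lambert {lam : ℕ → ℝ} (h : IsModeSeq lam) {ε : ℂ} (hε : ‖ε‖ = 1)
    (u s : ℕ) :
    Derivative.normalizedDerivOfComplex (fun τ : UpperHalfPlane => lambert ε lam u s τ) =
      fun τ : UpperHalfPlane => lambert ε lam (u + 1) (s + 1) τ := by
  rw [lambert_eq_expSum, lambert_eq_expSum, (h.expSummable_lambert hε u s).deriv]
  congr 1
  ext p
  push_cast
  ring

theorem IsModeSeq.iterate_deriv_lambert {lam : ℕ → ℝ} (h : IsModeSeq lam) {ε : ℂ}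
    (hε : ‖ε‖ = 1) (c : ℂ) (u s n : ℕ) :
    Derivative.normalizedDerivOfComplex^[n] (fun τ : UpperHalfPlane => c + lambert ε lam u s τ) =
      fun τ : UpperHalfPlane => (if n = 0 then c else 0) + lambert ε lam (u + n) (s + n) τ := by
  induction n with
  | zero => simp
  | succ n ih =>
    rw [Function.iterate_succ_apply', ih]
    have h1 := Derivative.normalizedDerivOfComplex_add
      (fun _ : UpperHalfPlane => if n = 0 then c else 0)
      (fun τ : UpperHalfPlane => lambert ε lam (u + n) (s + n) τ) mdifferentiable_const
      (h.mdiff_lambert hε _ _)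
    have h2 := Derivative.normalizedDerivOfComplex_const (if n = 0 then c else 0)
    rw [h2, h.deriv_lambert hε, zero_add] at h1
    refine h1.trans ?_
    ext τ
    simp [add_assoc]

/-- The `τ₁`-logarithmic derivative of the leading coefficient of a character. -/
theorem IsModeSeq.deriv_constantCoeff {lam : ℕ → ℝ} (h : IsModeSeq lam) {ε : ℂ} (hε : ‖ε‖ = 1)
    {ι : Type} {occ : ι → ℕ →₀ ℕ} (hocc : Function.Injective occ) (c : ℕ → ℂ)
    {Z : UpperHalfPlane → MvPowerSeries ℕ ℂ}
    (hZ : ∀ τ : UpperHalfPlane, HasSum (fun i => charExp τ (stateEv lam c (occ i))) (Z τ))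
    (hrel : ∀ (τ : UpperHalfPlane) (n : ℕ) (A : MvPowerSeries ℕ ℂ),
      HasSum (fun i => (occ i n : ℂ) • charExp τ (stateEv lam c (occ i))) A →
        A = charExp τ (modeEv lam n) * (Z τ + ε • A)) (τ : UpperHalfPlane) :
    Derivative.normalizedDerivOfComplex (fun z => MvPowerSeries.constantCoeff (Z z)) τ =
      MvPowerSeries.constantCoeff (Z τ) * (c 0 + lambert ε lam 0 1 τ) := by
  have hS : ExpSummable (fun _ : ι => (1 : ℂ)) (fun i => energy lam (occ i) 0) := by
    refine ⟨fun i => h.energy_nonneg _ _, fun t ht => ?_⟩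
    simpa [Function.comp_def] using (h.summable_exp_energy ht).comp_injective hocc
  -- The factor `q^{c_0}` is split off, so that the remaining exponents are nonnegative reals as
  -- `ExpSummable` requires.
  let E : UpperHalfPlane → ℂ := fun z => Complex.exp (2 * Real.pi * Complex.I * c 0 * z)
  have hE : ∀ z : UpperHalfPlane, HasDerivAt (E ∘ UpperHalfPlane.ofComplex)
      (2 * Real.pi * Complex.I * c 0 * E z) z := by
    intro z
    have h1 : HasDerivAt (fun w : ℂ => Complex.exp (2 * Real.pi * Complex.I * c 0 * w))
        (Complex.exp (2 * Real.pi * Complex.I * c 0 * z) * (2 * Real.pi * Complex.I * c 0 * 1))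
        z := ((hasDerivAt_id (z : ℂ)).const_mul (2 * Real.pi * Complex.I * c 0)).cexp
    refine (h1.congr_of_eventuallyEq ?_).congr_deriv (by simp only [E]; ring)
    filter_upwards [UpperHalfPlane.isOpen_upperHalfPlaneSet.mem_nhds z.im_pos] with w hw
    simp only [Function.comp_apply, E]
    rw [UpperHalfPlane.ofComplex_apply_of_im_pos hw]
  have hEm : MDiff E := fun z => by
    rw [UpperHalfPlane.mdifferentiableAt_iff]
    exact (hE z).differentiableAt
  have hcoeff : ∀ z : UpperHalfPlane, HasSum (fun i => Complex.exp (2 * Real.pi * Complex.I * z *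
      stateEv lam c (occ i) 0)) (MvPowerSeries.constantCoeff (Z z)) := by
    intro z
    have h1 := MvPowerSeries.WithPiTopology.hasSum_iff_hasSum_coeff.mp (hZ z) 0
    simpa only [MvPowerSeries.coeff_zero_eq_constantCoeff_apply, constantCoeff_charExp] using h1
  have hsplit : ∀ (z : UpperHalfPlane) i, Complex.exp (2 * Real.pi * Complex.I * z *
      stateEv lam c (occ i) 0) =
        E z * Complex.exp (2 * Real.pi * Complex.I * z * energy lam (occ i) 0) := by
    intro z i
    rw [stateEv, ← Complex.exp_add]
    ring_nf
  have hZ0 : (fun z => MvPowerSeries.constantCoeff (Z z)) =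
      E * expSum (fun _ : ι => (1 : ℂ)) (fun i => energy lam (occ i) 0) := by
    ext z
    refine (hcoeff z).unique (((hS.hasSum z).mul_left (E z)).congr_fun fun i => ?_)
    rw [hsplit, one_mul]
  rw [hZ0, Derivative.normalizedDerivOfComplex_mul _ _ hEm hS.mdiff, hS.deriv]
  have hDE : Derivative.normalizedDerivOfComplex E τ = c 0 * E τ := by
    rw [Derivative.normalizedDerivOfComplex, (hE τ).deriv]
    field_simp [Real.pi_ne_zero]
  have h2 := MvPowerSeries.WithPiTopology.hasSum_iff_hasSum_coeff.mp
    (h.hasSum_stateEv_smul hε τ hocc c (hZ τ) (hrel τ) 0) 0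
  simp only [MvPowerSeries.coeff_zero_eq_constantCoeff_apply, map_mul,
    MvPowerSeries.smul_eq_C_mul, MvPowerSeries.constantCoeff_C, constantCoeff_charExp] at h2
  have h3 : MvPowerSeries.constantCoeff (logSeries ε lam c τ 0) = c 0 + lambert ε lam 0 1 τ := by
    rw [← MvPowerSeries.coeff_zero_eq_constantCoeff_apply, coeff_logSeries]
    simp
  have hZτ : MvPowerSeries.constantCoeff (Z τ) =
      E τ * expSum (fun _ : ι => (1 : ℂ)) (fun i => energy lam (occ i) 0) τ := congrFun hZ0 τ
  rw [h3] at h2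
  rw [hZτ] at h2
  rw [hZτ]
  refine HasSum.unique ?_ h2
  simp only [Pi.add_apply, Pi.mul_apply, hDE]
  refine (((hS.hasSum τ).mul_left (c 0 * E τ)).add
    ((hS.mul.hasSum τ).mul_left (E τ))).congr_fun fun i => ?_
  rw [hsplit, stateEv]
  ring

end

/-! ### Formal logarithms, zeta values and Lambert expansions -/

section

/-! ## Logarithms of power series -/

/-- The logarithm of a power series is determined by its logarithmic derivatives. -/
theorem logCoeff_add_single {f g : MvPowerSeries ℕ ℂ} {w : ℂ} {k : ℕ}
    (h0 : MvPowerSeries.constantCoeff f ≠ 0)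
    (hf : MvPowerSeries.pderiv ℂ k f = w • (f * g)) (I : ℕ →₀ ℕ) :
    logCoeff f (I + Finsupp.single k 1) * ((I k : ℂ) + 1) = w * MvPowerSeries.coeff I g := by
  set u : MvPowerSeries ℕ ℂ := MvPowerSeries.C (MvPowerSeries.constantCoeff f)⁻¹ * f - 1 with hu
  have hu0 : MvPowerSeries.constantCoeff u = 0 := by
    rw [hu, map_sub, map_mul, MvPowerSeries.constantCoeff_C, map_one, inv_mul_cancel₀ h0, sub_self]
  have hdu : MvPowerSeries.pderiv ℂ k u = MvPowerSeries.C w * ((1 + u) * g) := by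
    rw [hu, map_sub, Derivation.leibniz, MvPowerSeries.pderiv_C, hf, MvPowerSeries.pderiv_one]
    simp only [smul_eq_mul, MvPowerSeries.smul_eq_C_mul]
    ring
  -- The logarithm is truncated at the degree of the index `I + single k 1`, which is `N`.
  set N := I.degree + 1 with hN
  have hdeg : (I + Finsupp.single k 1).degree = N := by simp [hN, map_add]
  set L : MvPowerSeries ℕ ℂ := ∑ n ∈ Finset.range N, ((-1 : ℂ) ^ n / ((n + 1 : ℕ) : ℂ)) • u ^ (n + 1)
    with hL
  have hlog : logCoeff f (I + Finsupp.single k 1) =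
      MvPowerSeries.coeff (I + Finsupp.single k 1) L := by
    rw [logCoeff, hdeg, hL, map_sum, ← Finset.Ico_add_one_right_eq_Icc,
      Finset.sum_Ico_eq_sum_range, Nat.add_sub_cancel]
    refine Finset.sum_congr rfl fun n _ => ?_
    rw [MvPowerSeries.coeff_smul, Nat.add_sub_cancel_left, add_comm 1 n]
  rw [hlog, ← MvPowerSeries.coeff_pderiv]
  -- Differentiating the truncated logarithm gives the geometric sum `∑_{n<N} (-u)^n`, and the
  -- factor `1 + u` of the derivative of `u` telescopes it.
  have hdL : MvPowerSeries.pderiv ℂ k L = MvPowerSeries.C w * g -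
      (-u) ^ N * (MvPowerSeries.C w * g) := by
    have h1 : MvPowerSeries.pderiv ℂ k L =
        (∑ n ∈ Finset.range N, (-u) ^ n) * MvPowerSeries.pderiv ℂ k u := by
      rw [hL, map_sum, Finset.sum_mul]
      refine Finset.sum_congr rfl fun n _ => ?_
      rw [Derivation.map_smul, Derivation.leibniz_pow, Nat.add_sub_cancel]
      have h5 : ((n : ℂ) + 1) ≠ 0 := Nat.cast_add_one_ne_zero n
      rw [← Nat.cast_smul_eq_nsmul ℂ, smul_smul, Nat.cast_add_one, div_mul_cancel₀ _ h5, neg_pow u,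
        smul_eq_mul, MvPowerSeries.smul_eq_C_mul, map_pow, map_neg, map_one, mul_assoc]
    rw [h1, hdu]
    have h2 := mul_neg_geom_sum (-u) N
    rw [sub_neg_eq_add] at h2
    linear_combination MvPowerSeries.C w * g * h2
  -- Since `u` has no constant term, `(-u)^N` starts in degree `N > |I|`, so the truncation error is
  -- invisible at `I`.
  have hord : MvPowerSeries.coeff I ((-u) ^ N * (MvPowerSeries.C w * g)) = 0 := by
    refine MvPowerSeries.coeff_of_lt_order (lt_of_lt_of_le ?_ MvPowerSeries.le_order_mul)
    have h3 := MvPowerSeries.le_order_pow_of_constantCoeff_eq_zero N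
      (f := -u) (by rw [map_neg, hu0, neg_zero])
    refine lt_of_lt_of_le ?_ (h3.trans le_self_add)
    rw [hN]
    exact_mod_cast Nat.lt_succ_self _
  rw [hdL, map_sub, hord, sub_zero, MvPowerSeries.coeff_C_mul]

/-! ## Special values of zeta functions -/

/-- The L-function of the trivial character modulo `2` is computed twice: as `2^{-s} ζ(s, 1/2)`, and
as `ζ(s)` without its Euler factor at `2`. -/
theorem zetaHalf_eq {s : ℂ} (hs : s ≠ 1) : zetaHalf s = (2 ^ s - 1) * riemannZeta s := by
  have h1 := DirichletCharacter.LFunctionTrivChar_eq_mul_riemannZeta (N := 2) hs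
  have h2 : DirichletCharacter.LFunctionTrivChar 2 s = (2 : ℂ) ^ (-s) * zetaHalf s := by
    rw [DirichletCharacter.LFunctionTrivChar, DirichletCharacter.LFunction, ZMod.LFunction]
    have hu : (Finset.univ : Finset (ZMod 2)) = {0, 1} := by decide
    rw [hu, Finset.sum_pair (by decide), MulChar.map_zero, zero_mul, zero_add, map_one, one_mul,
      ZMod.toAddCircle_apply, zetaHalf]
    have h3 : (1 : ZMod 2).val = 1 := rfl
    rw [h3]
    norm_num
  rw [h2, Nat.Prime.primeFactors Nat.prime_two, Finset.prod_singleton, Complex.cpow_neg] at h1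
  have h4 : (2 : ℂ) ^ s ≠ 0 := by simp [Complex.cpow_eq_zero_iff]
  rw [Complex.cpow_neg, Nat.cast_ofNat] at h1
  field_simp at h1
  rw [h1]

theorem bosonConst_zero : bosonConst 0 = -1 / 24 := by
  have h := riemannZeta_neg_nat_eq_bernoulli 1
  rw [bernoulli_two] at h
  rw [bosonConst]
  norm_num at h ⊢
  rw [h]
  norm_num

theorem fermionConst_eq (r : ℕ) :
    fermionConst r = (2 ^ (2 * r + 1) - 1) / 2 ^ (2 * r + 1) * bosonConst r := by
  have h1 : (-(2 * (r : ℂ) + 1)) ≠ 1 := by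
    intro h
    have := congrArg Complex.re h
    simp at this
    have h2 : (0 : ℝ) ≤ r := r.cast_nonneg
    linarith
  have h2 : (2 : ℂ) ^ (-(2 * (r : ℂ) + 1)) = (2 ^ (2 * r + 1))⁻¹ := by
    rw [Complex.cpow_neg, ← Complex.cpow_natCast]
    push_cast
    rfl
  rw [fermionConst, zetaHalf_eq h1, h2, bosonConst]
  field_simp
  ring

theorem fermionConst_zero : fermionConst 0 = -1 / 48 := by
  rw [fermionConst_eq, bosonConst_zero]
  norm_num

/-! ## Lambert expansions of the Eisenstein series -/

theorem tsum_even_add_tsum_odd {f : ℕ × ℕ → ℂ} (hf : Summable f) :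
    ∑' p : ℕ × ℕ, f (2 * p.1, p.2) + ∑' p : ℕ × ℕ, f (2 * p.1 + 1, p.2) = ∑' p, f p := by
  have he : Function.Injective fun p : ℕ × ℕ => (2 * p.1, p.2) := by
    rintro ⟨a, b⟩ ⟨c, d⟩ h
    simpa using h
  have ho : Function.Injective fun p : ℕ × ℕ => (2 * p.1 + 1, p.2) := by
    rintro ⟨a, b⟩ ⟨c, d⟩ h
    simpa using h
  have hfe := hf.comp_injective he
  have hfo := hf.comp_injective ho
  have h1 := hf.prod
  have h2 := tsum_even_add_odd (f := fun b => ∑' c, f (b, c))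
    (h1.comp_injective (i := fun k : ℕ => 2 * k) fun a b h => by simpa using h)
    (h1.comp_injective (i := fun k : ℕ => 2 * k + 1) fun a b h => by simpa using h)
  have h3 := Summable.tsum_prod (f := fun p : ℕ × ℕ => f (2 * p.1, p.2)) hfe
  have h4 := Summable.tsum_prod (f := fun p : ℕ × ℕ => f (2 * p.1 + 1, p.2)) hfo
  rw [hf.tsum_prod, ← h2, h3, h4]

theorem tsum_even_add_tsum_odd' {f : ℕ × ℕ → ℂ} (hf : Summable f) :
    ∑' p : ℕ × ℕ, f (p.1, 2 * p.2) + ∑' p : ℕ × ℕ, f (p.1, 2 * p.2 + 1) = ∑' p, f p := by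
  have h1 := tsum_even_add_tsum_odd ((Equiv.prodComm ℕ ℕ).summable_iff.mpr hf)
  have h2 := (Equiv.prodComm ℕ ℕ).tsum_eq f
  have h3 := (Equiv.prodComm ℕ ℕ).tsum_eq fun p : ℕ × ℕ => f (p.1, 2 * p.2)
  have h4 := (Equiv.prodComm ℕ ℕ).tsum_eq fun p : ℕ × ℕ => f (p.1, 2 * p.2 + 1)
  rw [← h2, ← h3, ← h4]
  exact h1

/-- The divisor sums are expanded into a double series over `N = (m+1)(n+1)`. The zeta-regularized
constant of the bosonic operators is exactly the constant term of `G_{2r+2}`. -/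
theorem eisG_eq (r : ℕ) (τ : UpperHalfPlane) :
    eisG (2 * (r + 1)) τ = bosonConst r + lambert 1 (fun n => n + 1) 0 (2 * r + 1) τ := by
  rw [eisG, bosonConst]
  have h0 : (1 : ℂ) - ((2 * (r + 1) : ℕ) : ℂ) = -(2 * (r : ℂ) + 1) := by
    push_cast
    ring
  rw [h0]
  refine congrArg₂ (· + ·) rfl ?_
  · have hs := (isModeSeq_boson.summable_norm_lambertTerm (ε := 1) (by simp) 0 (2 * r + 1)
      τ).of_norm
    have h1 := tsum_prod_pow_eq_tsum_sigma (2 * r + 1)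
      (UpperHalfPlane.norm_exp_two_pi_I_lt_one τ)
    rw [tsum_pnat_eq_tsum_succ (f := fun e : ℕ => (ArithmeticFunction.sigma (2 * r + 1) e : ℂ) *
      Complex.exp (2 * Real.pi * Complex.I * τ) ^ e)] at h1
    have h2 : 2 * (r + 1) - 1 = 2 * r + 1 := by omega
    rw [h2]
    have h3 : ∀ n : ℕ, Complex.exp (2 * Real.pi * Complex.I * ((n : ℂ) + 1) * τ) =
        Complex.exp (2 * Real.pi * Complex.I * τ) ^ (n + 1) := by
      intro n
      rw [← Complex.exp_nat_mul]
      push_cast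
      ring_nf
    simp only [h3]
    have h4 := Summable.tsum_prod ((Equiv.prodComm ℕ ℕ).summable_iff.mpr hs)
    simp only [Function.comp_apply] at h4
    rw [← h1, lambert, ← (Equiv.prodComm ℕ ℕ).tsum_eq, h4]
    rw [tsum_pnat_eq_tsum_succ (f := fun d : ℕ => ∑' c : ℕ+, ((c : ℕ) : ℂ) ^ (2 * r + 1) *
      Complex.exp (2 * Real.pi * Complex.I * τ) ^ (d * (c : ℕ)))]
    refine tsum_congr fun d => ?_
    rw [tsum_pnat_eq_tsum_succ (f := fun c : ℕ => (c : ℂ) ^ (2 * r + 1) *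
      Complex.exp (2 * Real.pi * Complex.I * τ) ^ ((d + 1) * c))]
    refine tsum_congr fun c => ?_
    simp only [lambertTerm, Equiv.prodComm_apply, Prod.swap_prod_mk, one_pow, one_mul, pow_zero]
    rw [← Complex.exp_nat_mul]
    push_cast
    ring_nf

/-- The integers `n+1` split by parity: odd ones are twice a half-integral mode, even ones twice an
integral mode. The factor `2` in the exponent is absorbed by passing from `τ'` to `τ = 2τ'`. -/
theorem lambert_half (r : ℕ) (τ τ' : UpperHalfPlane) (h : (τ : ℂ) = 2 * τ') :
    lambert 1 (fun n => n + 1) 0 (2 * r + 1) τ' =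
      2 ^ (2 * r + 1) * lambert 1 (fun n => n + 1 / 2) 0 (2 * r + 1) τ +
        2 ^ (2 * r + 1) * lambert 1 (fun n => n + 1) 0 (2 * r + 1) τ := by
  rw [lambert, ← tsum_even_add_tsum_odd (isModeSeq_boson.summable_norm_lambertTerm (ε := 1)
    (by simp) 0 (2 * r + 1) τ').of_norm, lambert, lambert, ← tsum_mul_left, ← tsum_mul_left]
  congr 1 <;> refine tsum_congr fun p => ?_
  · simp only [lambertTerm, h, one_pow, one_mul, pow_zero, ← mul_assoc, ← mul_pow]
    push_cast
    congr 1
    · ring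
    · congr 1
      ring
  · simp only [lambertTerm, h, one_pow, one_mul, pow_zero, ← mul_assoc, ← mul_pow]
    push_cast
    congr 1
    · ring
    · congr 1
      ring

/-- The sign `(-1)^m` equals `1` minus twice the indicator of odd `m`, and for odd `m` the factor
`m+1` is even, which replaces `q` by `q²`. -/
theorem lambert_neg_one (r : ℕ) (τ τ' : UpperHalfPlane) (h : (τ' : ℂ) = 2 * τ) :
    lambert (-1) (fun n => n + 1 / 2) 0 (2 * r + 1) τ =
      lambert 1 (fun n => n + 1 / 2) 0 (2 * r + 1) τ -
        2 * lambert 1 (fun n => n + 1 / 2) 0 (2 * r + 1) τ' := by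
  have h1 := tsum_even_add_tsum_odd' (isModeSeq_fermion.summable_norm_lambertTerm (ε := 1)
    (by simp) 0 (2 * r + 1) τ).of_norm
  have h2 := tsum_even_add_tsum_odd' (isModeSeq_fermion.summable_norm_lambertTerm (ε := -1)
    (by simp) 0 (2 * r + 1) τ).of_norm
  have h3 : ∑' p : ℕ × ℕ, lambertTerm 1 (fun n => n + 1 / 2) 0 (2 * r + 1) τ (p.1, 2 * p.2 + 1) =
      lambert 1 (fun n => n + 1 / 2) 0 (2 * r + 1) τ' := by
    refine tsum_congr fun p => ?_
    simp only [lambertTerm, h, one_pow, one_mul, pow_zero]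
    push_cast
    congr 2
    ring
  have h4 : ∑' p : ℕ × ℕ, lambertTerm (-1) (fun n => n + 1 / 2) 0 (2 * r + 1) τ (p.1, 2 * p.2 + 1) =
      -∑' p : ℕ × ℕ, lambertTerm 1 (fun n => n + 1 / 2) 0 (2 * r + 1) τ (p.1, 2 * p.2 + 1) := by
    rw [← tsum_neg]
    refine tsum_congr fun p => ?_
    simp [lambertTerm, pow_succ]
  have h5 : ∑' p : ℕ × ℕ, lambertTerm (-1) (fun n => n + 1 / 2) 0 (2 * r + 1) τ (p.1, 2 * p.2) =
      ∑' p : ℕ × ℕ, lambertTerm 1 (fun n => n + 1 / 2) 0 (2 * r + 1) τ (p.1, 2 * p.2) := by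
    refine tsum_congr fun p => ?_
    simp [lambertTerm]
  rw [h4, h5, h3] at h2
  rw [h3] at h1
  simp only [lambert] at h1 h2 ⊢
  linear_combination h1 - h2

theorem exists_coe_eq_mul (τ : UpperHalfPlane) {x : ℝ} (hx : 0 < x) :
    ∃ τ' : UpperHalfPlane, (τ' : ℂ) = x * τ := by
  refine ⟨⟨x * τ, ?_⟩, rfl⟩
  simpa using mul_pos hx τ.im_pos

theorem eisF_eq (r : ℕ) (τ : UpperHalfPlane) :
    eisF (2 * (r + 1)) τ = (1 - 2 ^ (2 * r + 1)) * bosonConst r +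
      2 ^ (2 * r + 1) * lambert 1 (fun n => n + 1 / 2) 0 (2 * r + 1) τ := by
  obtain ⟨τ', hτ'⟩ := exists_coe_eq_mul τ (x := 1 / 2) (by norm_num)
  have h1 : (τ : ℂ) / 2 = τ' := by rw [hτ']; push_cast; ring
  have h2 : (τ : ℂ) = 2 * τ' := by rw [← h1]; ring
  have h3 : 2 * (r + 1) - 1 = 2 * r + 1 := by omega
  rw [eisF, h1, eisG_eq, eisG_eq, lambert_half r τ τ' h2, h3]
  ring

/-- `F^{(2)}` retains only the half-integral modes, and subtracting its value at `q²` creates the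
fermionic signs. The constant terms combine to `-ζ(-2r-1, 1/2)/2`. -/
theorem eisCombination_eq (r : ℕ) (τ : UpperHalfPlane) :
    eisCombination (r + 1) τ =
      fermionConst r + lambert (-1) (fun n => n + 1 / 2) 0 (2 * r + 1) τ := by
  obtain ⟨τ', hτ'⟩ := exists_coe_eq_mul τ (x := 2) (by norm_num)
  have h3 : 2 * (r + 1) - 1 = 2 * r + 1 := by omega
  have h4 : 2 * (r + 1) - 2 = 2 * r := by omega
  have h5 : (2 : ℂ) * τ = τ' := by rw [hτ']; push_cast; ring
  rw [eisCombination, h5, eisF_eq, eisF_eq, lambert_neg_one r τ τ' h5.symm, fermionConst_eq, h3, h4,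
    pow_succ (2 : ℂ) (2 * r)]
  generalize lambert 1 (fun n => n + 1 / 2) 0 (2 * r + 1) τ = x
  generalize lambert 1 (fun n => n + 1 / 2) 0 (2 * r + 1) τ' = y
  field_simp
  ring

end

/-! ### Growth estimates and the transformation of `E₂` and `D E₂` -/

section

open scoped ModularForm

/-! ## Holomorphic functions of moderate growth -/

theorem two_le_im_add_inv (τ : UpperHalfPlane) : 2 ≤ τ.im + τ.im⁻¹ := by
  have h := τ.im_pos
  have h1 : τ.im + τ.im⁻¹ - 2 = (τ.im - 1) ^ 2 * τ.im⁻¹ := by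
    field_simp
    ring
  have h2 : 0 ≤ (τ.im - 1) ^ 2 * τ.im⁻¹ := by positivity
  linarith

theorem one_le_im_add_inv (τ : UpperHalfPlane) : 1 ≤ τ.im + τ.im⁻¹ := by
  linarith [two_le_im_add_inv τ]

theorem ModerateGrowth.add {f g : UpperHalfPlane → ℂ} (hf : ModerateGrowth f)
    (hg : ModerateGrowth g) : ModerateGrowth (f + g) := by
  obtain ⟨C, N, hC⟩ := hf
  obtain ⟨C', N', hC'⟩ := hg
  refine ⟨|C| + |C'|, N + N', fun τ => ?_⟩
  have h1 := one_le_im_add_inv τ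
  calc ‖f τ + g τ‖ ≤ ‖f τ‖ + ‖g τ‖ := norm_add_le _ _
    _ ≤ C * (τ.im + τ.im⁻¹) ^ N + C' * (τ.im + τ.im⁻¹) ^ N' := add_le_add (hC τ) (hC' τ)
    _ ≤ |C| * (τ.im + τ.im⁻¹) ^ (N + N') + |C'| * (τ.im + τ.im⁻¹) ^ (N + N') := by
        gcongr <;> first | exact le_abs_self _ | exact h1 | omega
    _ = _ := by ring

theorem ModerateGrowth.mul {f g : UpperHalfPlane → ℂ} (hf : ModerateGrowth f)
    (hg : ModerateGrowth g) : ModerateGrowth (f * g) := by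
  obtain ⟨C, N, hC⟩ := hf
  obtain ⟨C', N', hC'⟩ := hg
  refine ⟨C * C', N + N', fun τ => ?_⟩
  calc ‖f τ * g τ‖ = ‖f τ‖ * ‖g τ‖ := norm_mul _ _
    _ ≤ (C * (τ.im + τ.im⁻¹) ^ N) * (C' * (τ.im + τ.im⁻¹) ^ N') :=
        mul_le_mul (hC τ) (hC' τ) (norm_nonneg _) ((norm_nonneg _).trans (hC τ))
    _ = _ := by ring

theorem moderateGrowth_const (c : ℂ) : ModerateGrowth fun _ => c :=
  ⟨‖c‖, 0, fun τ => by simp⟩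

/-- Cauchy's estimate on the disc of radius `Im τ / 2`: there `Im` changes by at most a factor two,
and dividing by the radius costs one further power of `1/Im τ`. -/
theorem ModerateGrowth.deriv {f : UpperHalfPlane → ℂ} (hf : MDiff f) (h : ModerateGrowth f) :
    ModerateGrowth (Derivative.normalizedDerivOfComplex f) := by
  obtain ⟨C, N, hC⟩ := h
  refine ⟨(2 * Real.pi)⁻¹ * (2 * (|C| * 2 ^ N)), N + 1, fun τ => ?_⟩
  have hy := τ.im_pos
  set M := |C| * (2 * (τ.im + τ.im⁻¹)) ^ N with hM
  have him : ∀ z ∈ Metric.closedBall (τ : ℂ) (τ.im / 2), τ.im / 2 ≤ z.im ∧ z.im ≤ 2 * τ.im := by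
    intro z hz
    have h1 := Complex.abs_im_le_norm (z - τ)
    rw [mem_closedBall_iff_norm] at hz
    rw [Complex.sub_im, UpperHalfPlane.coe_im] at h1
    have h2 := abs_le.mp (h1.trans hz)
    constructor <;> linarith
  have hbound : ∀ z ∈ Metric.sphere (τ : ℂ) (τ.im / 2),
      ‖(f ∘ UpperHalfPlane.ofComplex) z‖ ≤ M := by
    intro z hz
    obtain ⟨h1, h2⟩ := him z (Metric.sphere_subset_closedBall hz)
    have hz0 : 0 < z.im := by linarith
    rw [Function.comp_apply, UpperHalfPlane.ofComplex_apply_of_im_pos hz0]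
    refine (hC _).trans ?_
    have h3 : (UpperHalfPlane.mk z hz0).im = z.im := rfl
    have h4 : z.im⁻¹ ≤ 2 * τ.im⁻¹ := by
      have := inv_anti₀ (by positivity) h1
      rwa [inv_div, div_eq_mul_inv] at this
    rw [h3, hM]
    have h5 : 0 < z.im⁻¹ := inv_pos.mpr hz0
    gcongr
    · exact le_abs_self C
    · linarith
  have hdiff : DiffContOnCl ℂ (f ∘ UpperHalfPlane.ofComplex) (Metric.ball (τ : ℂ) (τ.im / 2)) := by
    refine DifferentiableOn.diffContOnCl ?_
    rw [UpperHalfPlane.mdifferentiable_iff] at hf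
    refine hf.mono fun z hz => ?_
    have hz' := Metric.closure_ball_subset_closedBall hz
    have := (him z hz').1
    change 0 < z.im
    linarith
  have h6 := Complex.norm_deriv_le_of_forall_mem_sphere_norm_le (by positivity) hdiff hbound
  rw [Derivative.normalizedDerivOfComplex, norm_mul]
  have h7 : ‖(2 * (Real.pi : ℂ) * Complex.I)⁻¹‖ = (2 * Real.pi)⁻¹ := by
    rw [norm_inv, norm_mul, norm_mul, Complex.norm_I, Complex.norm_real, Complex.norm_ofNat,
      Real.norm_of_nonneg Real.pi_pos.le, mul_one]
  rw [h7, mul_assoc]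
  gcongr
  refine h6.trans ?_
  rw [hM, mul_pow, pow_succ]
  have h8 : τ.im⁻¹ ≤ τ.im + τ.im⁻¹ := by linarith
  have h9 : 0 < τ.im⁻¹ := inv_pos.mpr hy
  calc |C| * (2 ^ N * (τ.im + τ.im⁻¹) ^ N) / (τ.im / 2)
      = 2 * (|C| * 2 ^ N) * ((τ.im + τ.im⁻¹) ^ N * τ.im⁻¹) := by field_simp
    _ ≤ _ := by gcongr

/-- Holomorphic functions of moderate growth. -/
def Tempered (f : UpperHalfPlane → ℂ) : Prop := MDiff f ∧ ModerateGrowth f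

theorem Tempered.add {f g : UpperHalfPlane → ℂ} (hf : Tempered f) (hg : Tempered g) :
    Tempered (f + g) := ⟨MDifferentiable.add hf.1 hg.1, hf.2.add hg.2⟩

theorem Tempered.mul {f g : UpperHalfPlane → ℂ} (hf : Tempered f) (hg : Tempered g) :
    Tempered (f * g) := ⟨MDifferentiable.mul hf.1 hg.1, hf.2.mul hg.2⟩

theorem tempered_const (c : ℂ) : Tempered fun _ => c :=
  ⟨mdifferentiable_const, moderateGrowth_const c⟩

theorem Tempered.smul {f : UpperHalfPlane → ℂ} (hf : Tempered f) (c : ℂ) : Tempered (c • f) :=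
  (tempered_const c).mul hf

theorem Tempered.sub {f g : UpperHalfPlane → ℂ} (hf : Tempered f) (hg : Tempered g) :
    Tempered (f - g) := by
  have h := hf.add (hg.smul (-1))
  rwa [neg_one_smul, ← sub_eq_add_neg] at h

theorem Tempered.deriv {f : UpperHalfPlane → ℂ} (hf : Tempered f) :
    Tempered (Derivative.normalizedDerivOfComplex f) :=
  ⟨Derivative.normalizedDerivOfComplex_mdifferentiable hf.1, hf.2.deriv hf.1⟩

theorem tempered_sum {ι : Type*} (s : Finset ι) {f : ι → UpperHalfPlane → ℂ}
    (hf : ∀ i ∈ s, Tempered (f i)) : Tempered (∑ i ∈ s, f i) := by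
  classical
  induction s using Finset.induction_on with
  | empty => exact tempered_const 0
  | insert a s ha ih =>
    rw [Finset.sum_insert ha]
    exact (hf a (Finset.mem_insert_self a s)).add
      (ih fun i hi => hf i (Finset.mem_insert_of_mem hi))

theorem Tempered.comp_smul {f : UpperHalfPlane → ℂ} (hf : Tempered f) (x : {x : ℝ // 0 < x}) :
    Tempered fun τ => f (x • τ) := by
  refine ⟨fun τ => ?_, ?_⟩
  · rw [UpperHalfPlane.mdifferentiableAt_iff]
    have h1 := UpperHalfPlane.mdifferentiableAt_iff.mp (hf.1 (x • τ))
    rw [UpperHalfPlane.coe_pos_real_smul] at h1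
    have h2 : DifferentiableAt ℂ (fun z : ℂ => (x : ℝ) • z) τ := by fun_prop
    refine (h1.comp (τ : ℂ) h2).congr_of_eventuallyEq ?_
    filter_upwards [UpperHalfPlane.isOpen_upperHalfPlaneSet.mem_nhds τ.im_pos] with z hz
    have hz' : 0 < ((x : ℝ) • z).im := by
      rw [Complex.smul_im]
      exact mul_pos x.2 hz
    rw [Function.comp_apply, Function.comp_apply, Function.comp_apply,
      UpperHalfPlane.ofComplex_apply_of_im_pos hz, UpperHalfPlane.ofComplex_apply_of_im_pos hz']
    rfl
  · obtain ⟨C, N, hC⟩ := hf.2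
    refine ⟨|C| * ((x : ℝ) + (x : ℝ)⁻¹) ^ N, N, fun τ => (hC _).trans ?_⟩
    rw [mul_assoc, ← mul_pow, UpperHalfPlane.pos_real_im]
    have hx := x.2
    have hx' : 0 < (x : ℝ)⁻¹ := inv_pos.mpr hx
    have hy := τ.im_pos
    have hy' : 0 < τ.im⁻¹ := inv_pos.mpr hy
    have h1 : (x : ℝ) * τ.im + ((x : ℝ) * τ.im)⁻¹ ≤ ((x : ℝ) + (x : ℝ)⁻¹) * (τ.im + τ.im⁻¹) := by
      rw [mul_inv]
      nlinarith [mul_pos hx hy', mul_pos hx' hy]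
    gcongr
    exact le_abs_self C

/-- The inequality `exp(-u) ≤ (s+2)!/u^{s+2}` cancels `l^s`; the two extra powers leave a convergent
double series in `l` and `m`. -/
theorem pow_mul_exp_neg_le (s : ℕ) {y m l : ℝ} (hy : 0 < y) (hm : 1 ≤ m) (hl : 0 < l) :
    l ^ s * Real.exp (-(2 * Real.pi * y) * (m * l)) ≤
      (s + 2).factorial * (y + y⁻¹) ^ (s + 2) * ((l ^ 2)⁻¹ * (m ^ 2)⁻¹) := by
  have hm0 : 0 < m := by linarith
  have hu0 : 0 < y * m * l := by positivity
  have h1 : Real.exp (-(2 * Real.pi * y) * (m * l)) ≤ Real.exp (-(y * m * l)) := by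
    refine Real.exp_le_exp.mpr ?_
    nlinarith [Real.pi_gt_three]
  have h2 : Real.exp (-(y * m * l)) ≤ (s + 2).factorial / (y * m * l) ^ (s + 2) := by
    rw [Real.exp_neg, inv_le_comm₀ (Real.exp_pos _) (by positivity), inv_div]
    exact Real.pow_div_factorial_le_exp _ hu0.le (s + 2)
  have h3 : y⁻¹ ^ (s + 2) ≤ (y + y⁻¹) ^ (s + 2) := by
    gcongr
    linarith
  have h4 : (m ^ s)⁻¹ ≤ 1 := inv_le_one_of_one_le₀ (one_le_pow₀ hm)
  calc l ^ s * Real.exp (-(2 * Real.pi * y) * (m * l))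
      ≤ l ^ s * ((s + 2).factorial / (y * m * l) ^ (s + 2)) := by
        gcongr
        exact h1.trans h2
    _ = (s + 2).factorial * y⁻¹ ^ (s + 2) * ((l ^ 2)⁻¹ * (m ^ 2)⁻¹) * (m ^ s)⁻¹ := by
        rw [mul_pow, mul_pow, inv_pow, pow_add l, pow_add m]
        field_simp
    _ ≤ (s + 2).factorial * (y + y⁻¹) ^ (s + 2) * ((l ^ 2)⁻¹ * (m ^ 2)⁻¹) * 1 := by
        gcongr
    _ = _ := mul_one _

theorem IsModeSeq.moderateGrowth_lambert {lam : ℕ → ℝ} (h : IsModeSeq lam) {ε : ℂ}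
    (hε : ‖ε‖ = 1) (s : ℕ) :
    ModerateGrowth fun τ : UpperHalfPlane => lambert ε lam 0 s τ := by
  have hsq : Summable fun n : ℕ => (((n + 1 : ℕ) : ℝ) ^ 2)⁻¹ :=
    (summable_nat_add_iff 1).mpr (Real.summable_nat_pow_inv.mpr one_lt_two)
  have hsq' : Summable fun n : ℕ => (lam n ^ 2)⁻¹ := by
    refine (hsq.mul_left 4).of_nonneg_of_le (fun n => by positivity) fun n => ?_
    have h6 : (((n : ℝ) + 1) / 2) ^ 2 ≤ lam n ^ 2 := by
      have := h.lower n
      gcongr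
    refine (inv_anti₀ (by positivity) h6).trans (le_of_eq ?_)
    push_cast
    field_simp
    norm_num
  have hS : Summable fun p : ℕ × ℕ => (lam p.1 ^ 2)⁻¹ * (((p.2 + 1 : ℕ) : ℝ) ^ 2)⁻¹ :=
    hsq'.mul_of_nonneg hsq (fun n => by positivity) fun n => by positivity
  refine ⟨(s + 2).factorial * ∑' p : ℕ × ℕ, (lam p.1 ^ 2)⁻¹ * (((p.2 + 1 : ℕ) : ℝ) ^ 2)⁻¹, s + 2,
    fun τ => ?_⟩
  have hterm : ∀ p : ℕ × ℕ, ‖lambertTerm ε lam 0 s τ p‖ ≤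
      (s + 2).factorial * (τ.im + τ.im⁻¹) ^ (s + 2) *
        ((lam p.1 ^ 2)⁻¹ * (((p.2 + 1 : ℕ) : ℝ) ^ 2)⁻¹) := by
    intro p
    have hl := h.pos p.1
    have h1 := pow_mul_exp_neg_le s τ.im_pos (m := ((p.2 + 1 : ℕ) : ℝ)) (by simp) hl
    refine le_trans (le_of_eq ?_) h1
    rw [lambertTerm, norm_mul, norm_mul, norm_mul, norm_pow, hε, one_pow, pow_zero, norm_one,
      norm_exp_mul, norm_pow, Complex.norm_real, Real.norm_of_nonneg hl.le, one_mul, one_mul,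
      Nat.cast_add_one, UpperHalfPlane.coe_im]
  have hsum := h.summable_norm_lambertTerm hε 0 s τ
  calc ‖lambert ε lam 0 s τ‖ ≤ ∑' p, ‖lambertTerm ε lam 0 s τ p‖ := norm_tsum_le_tsum_norm hsum
    _ ≤ ∑' p : ℕ × ℕ, (s + 2).factorial * (τ.im + τ.im⁻¹) ^ (s + 2) *
        ((lam p.1 ^ 2)⁻¹ * (((p.2 + 1 : ℕ) : ℝ) ^ 2)⁻¹) :=
        hsum.tsum_le_tsum hterm (hS.mul_left _)
    _ = _ := by
        rw [tsum_mul_left]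
        ring

theorem IsModeSeq.tempered_lambert {lam : ℕ → ℝ} (h : IsModeSeq lam) {ε : ℂ}
    (hε : ‖ε‖ = 1) (s : ℕ) : Tempered fun τ : UpperHalfPlane => lambert ε lam 0 s τ :=
  ⟨h.mdiff_lambert hε 0 s, h.moderateGrowth_lambert hε s⟩

theorem tempered_eisG (r : ℕ) : Tempered fun τ : UpperHalfPlane => eisG (2 * (r + 1)) τ := by
  simp only [eisG_eq]
  exact (tempered_const _).add (isModeSeq_boson.tempered_lambert (by simp) _)

/-! ## The Eisenstein series of weight two -/

theorem tsum_pnat_sigma (k : ℕ) (τ : UpperHalfPlane) :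
    ∑' n : ℕ+, (ArithmeticFunction.sigma k n : ℂ) *
      Complex.exp (2 * Real.pi * Complex.I * τ) ^ (n : ℕ) =
    ∑' n : ℕ, (ArithmeticFunction.sigma k (n + 1) : ℂ) *
      Complex.exp (2 * Real.pi * Complex.I * ((n : ℂ) + 1) * τ) := by
  rw [tsum_pnat_eq_tsum_succ (f := fun n : ℕ => (ArithmeticFunction.sigma k n : ℂ) *
    Complex.exp (2 * Real.pi * Complex.I * τ) ^ n)]
  refine tsum_congr fun n => ?_
  rw [← Complex.exp_nat_mul]
  push_cast
  ring_nf

theorem eisG_two (τ : UpperHalfPlane) : eisG 2 τ = -1 / 24 * EisensteinSeries.E2 τ := by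
  have h := bosonConst_zero
  rw [bosonConst] at h
  rw [EisensteinSeries.E2_eq_tsum_cexp, eisG]
  have h2 := tsum_pnat_sigma 1 τ
  rw [h2]
  have h4 : (1 : ℂ) - ((2 : ℕ) : ℂ) = -(2 * ((0 : ℕ) : ℂ) + 1) := by norm_num
  rw [h4, h]
  ring

theorem tempered_E2 : Tempered EisensteinSeries.E2 := by
  have h : EisensteinSeries.E2 = (-24 : ℂ) • fun τ : UpperHalfPlane => eisG (2 * (0 + 1)) τ := by
    ext τ
    rw [Pi.smul_apply, zero_add, mul_one, eisG_two, smul_eq_mul]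
    ring
  rw [h]
  exact (tempered_eisG 0).smul _

theorem E2_apply_smul (γ : SL(2, ℤ)) (τ : UpperHalfPlane) :
    EisensteinSeries.E2 (γ • τ) = UpperHalfPlane.denom γ τ ^ 2 * EisensteinSeries.E2 τ +
      6 / (Real.pi * Complex.I) * (γ 1 0 * UpperHalfPlane.denom γ τ) := by
  have h := congrFun (EisensteinSeries.E2_slash_action γ) τ
  rw [ModularForm.SL_slash_apply] at h
  have hJ := UpperHalfPlane.denom_ne_zero γ τ
  simp only [Pi.sub_apply, Pi.smul_apply, smul_eq_mul, EisensteinSeries.D2, riemannZeta_two] at h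
  have h2 : EisensteinSeries.E2 (γ • τ) = UpperHalfPlane.denom γ τ ^ 2 *
      (EisensteinSeries.E2 (γ • τ) * UpperHalfPlane.denom γ τ ^ (-2 : ℤ)) := by
    rw [zpow_neg]
    field_simp
  rw [h2, h]
  field_simp [Real.pi_ne_zero]
  linear_combination (-6 * (γ 1 0 : ℂ)) * Complex.I_sq

/-- The derivative `D E₂` transforms like `E₂² / 12`. -/
theorem deriv_E2_slash (γ : SL(2, ℤ)) :
    (EisensteinSeries.E2 * EisensteinSeries.E2 -
        (12 : ℂ) • Derivative.normalizedDerivOfComplex EisensteinSeries.E2) ∣[(4 : ℤ)] γ =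
      EisensteinSeries.E2 * EisensteinSeries.E2 -
        (12 : ℂ) • Derivative.normalizedDerivOfComplex EisensteinSeries.E2 := by
  have hm := tempered_E2.1
  have hslash : ∀ z : UpperHalfPlane, (EisensteinSeries.E2 ∣[(2 : ℤ)] γ) z =
      EisensteinSeries.E2 z + 6 / (Real.pi * Complex.I) * (γ 1 0 / UpperHalfPlane.denom γ z) := by
    intro z
    rw [ModularForm.SL_slash_apply, E2_apply_smul, zpow_neg]
    have hJ := UpperHalfPlane.denom_ne_zero γ z
    field_simp
  ext τ
  have hJ := UpperHalfPlane.denom_ne_zero γ τ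
  have h1 := congrFun (Derivative.normalizedDerivOfComplex_SL_slash (k := 2) hm (γ := γ)) τ
  have hd := (UpperHalfPlane.hasDerivAt_denom_zpow (γ : GL (Fin 2) ℝ) (-1) τ).const_mul
    (6 / (Real.pi * Complex.I) * (γ 1 0 : ℂ))
  have hE := (UpperHalfPlane.mdifferentiableAt_iff.mp (hm τ)).hasDerivAt
  -- With `J = cτ + d`, this differentiates `E₂ + (6/πi) c/J`, using that `1/J` has derivative
  -- `-c/J²`.
  have h2 : Derivative.normalizedDerivOfComplex (EisensteinSeries.E2 ∣[(2 : ℤ)] γ) τ =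
      Derivative.normalizedDerivOfComplex EisensteinSeries.E2 τ - (2 * Real.pi * Complex.I)⁻¹ *
        (6 / (Real.pi * Complex.I)) * (γ 1 0) ^ 2 / UpperHalfPlane.denom γ τ ^ 2 := by
    rw [Derivative.normalizedDerivOfComplex, ((hE.add hd).congr_of_eventuallyEq ?_).deriv,
      Derivative.normalizedDerivOfComplex]
    · have h3 : ((γ : GL (Fin 2) ℝ) 1 0 : ℂ) = (γ 1 0 : ℂ) := by simp
      rw [h3]
      norm_num
      ring
    · filter_upwards [UpperHalfPlane.isOpen_upperHalfPlaneSet.mem_nhds τ.im_pos] with z hz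
      simp only [Function.comp_apply, UpperHalfPlane.ofComplex_apply_of_im_pos hz, hslash,
        Pi.add_apply]
      rw [zpow_neg_one]
      ring
  rw [h2, Pi.sub_apply, hslash, ModularForm.SL_slash_apply] at h1
  rw [ModularForm.SL_slash_apply]
  simp only [Pi.sub_apply, Pi.mul_apply, Pi.smul_apply, smul_eq_mul]
  have h4 : UpperHalfPlane.denom γ τ ^ (-(2 + 2) : ℤ) = (UpperHalfPlane.denom γ τ ^ 4)⁻¹ := by
    rw [show (-(2 + 2) : ℤ) = -((4 : ℕ) : ℤ) from rfl, zpow_neg, zpow_natCast]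
  have h5 : UpperHalfPlane.denom γ τ ^ (-4 : ℤ) = (UpperHalfPlane.denom γ τ ^ 4)⁻¹ := h4
  rw [h4, Int.cast_ofNat] at h1
  rw [h5, E2_apply_smul]
  generalize (γ 1 0 : ℂ) = c at h1 ⊢
  generalize UpperHalfPlane.denom γ τ = J at h1 hJ ⊢
  have h6 : Derivative.normalizedDerivOfComplex EisensteinSeries.E2 (γ • τ) * (J ^ 4)⁻¹ =
      Derivative.normalizedDerivOfComplex EisensteinSeries.E2 τ - (2 * Real.pi * Complex.I)⁻¹ *
        (6 / (Real.pi * Complex.I)) * c ^ 2 / J ^ 2 + 2 * (2 * Real.pi * Complex.I)⁻¹ *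
        (c / J) * (EisensteinSeries.E2 τ + 6 / (Real.pi * Complex.I) * (c / J)) := by
    linear_combination -h1
  rw [sub_mul, mul_assoc 12, h6]
  field_simp [Real.pi_ne_zero]
  ring

end

/-! ### The algebra of quasimodular forms and its Eisenstein series -/

section

open scoped ModularForm

/-! ## Modular and quasimodular forms -/

/-- Holomorphic modular forms of weight `k` on `Γ`. -/
structure IsHolModular (Γ : Subgroup SL(2, ℤ)) (k : ℕ) (f : UpperHalfPlane → ℂ) : Prop where
  tempered : Tempered f
  slash : ∀ γ ∈ Γ, f ∣[(k : ℤ)] γ = f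

variable {Γ : Subgroup SL(2, ℤ)} {k l : ℕ} {f g : UpperHalfPlane → ℂ}

theorem slash_eq_iff (k : ℕ) (f : UpperHalfPlane → ℂ) (γ : SL(2, ℤ)) :
    f ∣[(k : ℤ)] γ = f ↔ ∀ τ, f (γ • τ) = UpperHalfPlane.denom γ τ ^ k * f τ := by
  rw [funext_iff]
  refine forall_congr' fun τ => ?_
  have hJ := UpperHalfPlane.denom_ne_zero γ τ
  rw [ModularForm.SL_slash_apply, zpow_neg, zpow_natCast, mul_inv_eq_iff_eq_mul₀ (pow_ne_zero _ hJ),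
    mul_comm (f τ)]

theorem IsHolModular.apply_smul (hf : IsHolModular Γ k f) {γ : SL(2, ℤ)} (hγ : γ ∈ Γ)
    (τ : UpperHalfPlane) : f (γ • τ) = UpperHalfPlane.denom γ τ ^ k * f τ :=
  (slash_eq_iff k f γ).mp (hf.slash γ hγ) τ

theorem isHolModular_const (Γ : Subgroup SL(2, ℤ)) (c : ℂ) : IsHolModular Γ 0 fun _ => c :=
  ⟨tempered_const c, fun γ _ => (slash_eq_iff 0 _ γ).mpr fun τ => by simp⟩

theorem IsHolModular.serreDerivative (hf : IsHolModular Γ k f) :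
    IsHolModular Γ (k + 2) (Derivative.serreDerivative k f) := by
  refine ⟨?_, fun γ hγ => ?_⟩
  · have h := hf.tempered.deriv.sub ((tempered_E2.smul ((k : ℂ) * 12⁻¹)).mul hf.tempered)
    exact h
  · have h := Derivative.serreDerivative_slash_invariant (k := (k : ℤ)) hf.tempered.1
      (hf.slash γ hγ)
    exact_mod_cast h

/-- The graded algebra generated by the Eisenstein series `E₂` over the modular forms on `Γ`. -/
inductive IsQuasimodular (Γ : Subgroup SL(2, ℤ)) : ℕ → (UpperHalfPlane → ℂ) → Prop
  | modular {k : ℕ} {f : UpperHalfPlane → ℂ} : IsHolModular Γ k f → IsQuasimodular Γ k f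
  | E2 : IsQuasimodular Γ 2 EisensteinSeries.E2
  | add {k : ℕ} {f g : UpperHalfPlane → ℂ} :
      IsQuasimodular Γ k f → IsQuasimodular Γ k g → IsQuasimodular Γ k (f + g)
  | mul {k l : ℕ} {f g : UpperHalfPlane → ℂ} :
      IsQuasimodular Γ k f → IsQuasimodular Γ l g → IsQuasimodular Γ (k + l) (f * g)

namespace IsQuasimodular

theorem tempered (hf : IsQuasimodular Γ k f) : Tempered f := by
  induction hf with
  | modular h => exact h.tempered
  | E2 => exact tempered_E2
  | add _ _ h1 h2 => exact h1.add h2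
  | mul _ _ h1 h2 => exact h1.mul h2

theorem smul (hf : IsQuasimodular Γ k f) (c : ℂ) : IsQuasimodular Γ k (c • f) := by
  have h := (modular (isHolModular_const Γ c)).mul hf
  rwa [zero_add] at h

theorem zero (Γ : Subgroup SL(2, ℤ)) (k : ℕ) : IsQuasimodular Γ k 0 :=
  modular ⟨tempered_const 0, fun γ _ => (slash_eq_iff k _ γ).mpr fun τ => by simp⟩

theorem sum {ι : Type*} (s : Finset ι) {f : ι → UpperHalfPlane → ℂ}
    (hf : ∀ i ∈ s, IsQuasimodular Γ k (f i)) : IsQuasimodular Γ k (∑ i ∈ s, f i) := by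
  classical
  induction s using Finset.induction_on with
  | empty => exact zero Γ k
  | insert a s ha ih =>
    rw [Finset.sum_insert ha]
    exact (hf a (Finset.mem_insert_self a s)).add
      (ih fun i hi => hf i (Finset.mem_insert_of_mem hi))

/-- On modular forms `D` is the Serre derivative plus `(k/12) E₂`. For `E₂` it suffices, in
Ramanujan's identity, that `E₂² - 12 D E₂` is modular of weight four; identifying it with `E₄` is
unnecessary. -/
theorem deriv (hf : IsQuasimodular Γ k f) :
    IsQuasimodular Γ (k + 2) (Derivative.normalizedDerivOfComplex f) := by
  induction hf with
  | @modular k f h =>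
    have h1 := (modular h.serreDerivative).add ((mul E2 (modular h)).smul ((k : ℂ) * 12⁻¹) |>
      (add_comm 2 k ▸ ·))
    convert h1 using 1
    ext τ
    simp [mul_assoc]
  | E2 =>
    have h1 : IsHolModular Γ 4 (EisensteinSeries.E2 * EisensteinSeries.E2 -
        (12 : ℂ) • Derivative.normalizedDerivOfComplex EisensteinSeries.E2) :=
      ⟨(tempered_E2.mul tempered_E2).sub (tempered_E2.deriv.smul 12), fun γ _ => deriv_E2_slash γ⟩
    have h2 := ((mul (Γ := Γ) E2 E2).smul 12⁻¹).add ((modular h1).smul (-12⁻¹))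
    convert h2 using 1
    ext τ
    simp
    ring
  | add h1 h2 ih1 ih2 =>
    rw [Derivative.normalizedDerivOfComplex_add _ _ h1.tempered.1 h2.tempered.1]
    exact ih1.add ih2
  | @mul k l f g h1 h2 ih1 ih2 =>
    rw [Derivative.normalizedDerivOfComplex_mul _ _ h1.tempered.1 h2.tempered.1]
    have h3 := ih1.mul h2
    have h4 := h1.mul ih2
    rw [add_right_comm] at h3
    rw [← add_assoc] at h4
    exact h3.add h4

theorem iterate_deriv (hf : IsQuasimodular Γ k f) (n : ℕ) :
    IsQuasimodular Γ (k + 2 * n) (Derivative.normalizedDerivOfComplex^[n] f) := by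
  induction n with
  | zero => exact hf
  | succ n ih =>
    rw [Function.iterate_succ_apply']
    exact ih.deriv

/-- The almost holomorphic modular form of which a quasimodular form is the constant term. -/
theorem exists_polynomial (hf : IsQuasimodular Γ k f) :
    ∃ P : Polynomial (UpperHalfPlane → ℂ), P.coeff 0 = f ∧ (∀ j, Tempered (P.coeff j)) ∧
      ∀ γ ∈ Γ, ∀ τ : UpperHalfPlane,
        P.eval₂ (Pi.evalRingHom _ (γ • τ)) (((γ • τ).im : ℂ)⁻¹) =
          UpperHalfPlane.denom γ τ ^ k * P.eval₂ (Pi.evalRingHom _ τ) ((τ.im : ℂ)⁻¹) := by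
  -- Evaluating coefficients at `τ` and the variable at `1/Im τ` is a ring homomorphism, so sums and
  -- products are formal and only the generators need an argument.
  induction hf with
  | @modular k f h =>
    refine ⟨Polynomial.C f, Polynomial.coeff_C_zero, fun j => ?_, fun γ hγ τ => ?_⟩
    · rw [Polynomial.coeff_C]
      split_ifs
      exacts [h.tempered, tempered_const 0]
    · simpa using h.apply_smul hγ τ
  | E2 =>
    -- The witness is the nonholomorphic modular form `E₂ - 3/(π Im τ)`.
    refine ⟨Polynomial.C EisensteinSeries.E2 +
      Polynomial.C (fun _ => (-3 / Real.pi : ℂ)) * Polynomial.X, by simp, fun j => ?_,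
      fun γ hγ τ => ?_⟩
    · rw [Polynomial.coeff_add, Polynomial.coeff_C, Polynomial.coeff_C_mul, Polynomial.coeff_X]
      refine Tempered.add ?_ ?_
      · split_ifs
        exacts [tempered_E2, tempered_const 0]
      · split_ifs
        · rw [mul_one]
          exact tempered_const _
        · rw [mul_zero]
          exact tempered_const 0
    · simp only [Polynomial.eval₂_add, Polynomial.eval₂_mul, Polynomial.eval₂_C,
        Polynomial.eval₂_X, Pi.evalRingHom_apply]
      rw [E2_apply_smul, ModularGroup.im_smul_eq_div_normSq]
      have hJ := UpperHalfPlane.denom_ne_zero γ τ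
      have hy : (τ.im : ℂ) ≠ 0 := by exact_mod_cast τ.im_pos.ne'
      -- `|J|²` is `J` times its conjugate, and the conjugate of `cτ + d` is `J - 2ic Im τ`.
      have hN : ((Complex.normSq (UpperHalfPlane.denom γ τ) : ℝ) : ℂ) =
          UpperHalfPlane.denom γ τ * (UpperHalfPlane.denom γ τ -
            2 * Complex.I * (γ 1 0 * τ.im)) := by
        rw [← Complex.mul_conj]
        congr 1
        rw [ModularGroup.denom_apply]
        apply Complex.ext <;> simp
        ring
      push_cast
      rw [hN]
      field_simp [Real.pi_ne_zero]
      linear_combination (6 * (γ 1 0 : ℂ) * τ.im) * Complex.I_sq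
  | add _ _ ih1 ih2 =>
    obtain ⟨P, hP, hP1, hP2⟩ := ih1
    obtain ⟨Q, hQ, hQ1, hQ2⟩ := ih2
    refine ⟨P + Q, by rw [Polynomial.coeff_add, hP, hQ], fun j => ?_, fun γ hγ τ => ?_⟩
    · rw [Polynomial.coeff_add]
      exact (hP1 j).add (hQ1 j)
    · rw [Polynomial.eval₂_add, Polynomial.eval₂_add, hP2 γ hγ, hQ2 γ hγ, mul_add]
  | mul _ _ ih1 ih2 =>
    obtain ⟨P, hP, hP1, hP2⟩ := ih1
    obtain ⟨Q, hQ, hQ1, hQ2⟩ := ih2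
    refine ⟨P * Q, by rw [Polynomial.mul_coeff_zero, hP, hQ], fun j => ?_, fun γ hγ τ => ?_⟩
    · rw [Polynomial.coeff_mul]
      exact tempered_sum _ fun i _ => (hP1 _).mul (hQ1 _)
    · rw [Polynomial.eval₂_mul, Polynomial.eval₂_mul, hP2 γ hγ, hQ2 γ hγ, pow_add]
      ring

theorem isQuasimodularForm (hf : IsQuasimodular Γ k f) : IsQuasimodularForm Γ k f := by
  obtain ⟨P, hP, hP1, hP2⟩ := hf.exists_polynomial
  refine ⟨P.natDegree, P.coeff, hP, fun j _ => hP1 j, fun γ hγ τ => ?_⟩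
  have h := hP2 γ hγ τ
  rw [Polynomial.eval₂_eq_sum_range, Polynomial.eval₂_eq_sum_range] at h
  have h2 : autFactor (k : ℝ) γ τ = UpperHalfPlane.denom γ τ ^ k := by
    rw [autFactor, Complex.ofReal_natCast, Complex.cpow_natCast]
  rw [h2, one_mul]
  exact h

end IsQuasimodular

/-! ## Eisenstein series on `Γ(4)` -/

/-- By Euler's formula a vanishing Bernoulli number would make `ζ(2r+2)` vanish. -/
theorem bernoulli_two_mul_ne_zero (r : ℕ) : bernoulli (2 * (r + 1)) ≠ 0 := by
  intro h
  have h1 := riemannZeta_two_mul_nat (Nat.succ_ne_zero r)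
  rw [Nat.succ_eq_add_one, h, Rat.cast_zero, mul_zero, zero_div] at h1
  refine riemannZeta_ne_zero_of_one_lt_re ?_ h1
  have : (0 : ℝ) ≤ r := r.cast_nonneg
  simp
  linarith

theorem eisG_eq_E (r : ℕ) (hk : 3 ≤ 2 * (r + 1)) (τ : UpperHalfPlane) :
    eisG (2 * (r + 1)) τ = riemannZeta (1 - ((2 * (r + 1) : ℕ) : ℂ)) / 2 * ModularForm.E hk τ := by
  have h0 : (bernoulli (2 * (r + 1)) : ℂ) ≠ 0 := by exact_mod_cast bernoulli_two_mul_ne_zero r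
  have h1 := riemannZeta_neg_nat_eq_bernoulli (2 * r + 1)
  have h2 : (1 : ℂ) - ((2 * (r + 1) : ℕ) : ℂ) = -((2 * r + 1 : ℕ) : ℂ) := by
    push_cast
    ring
  have h3 := tsum_pnat_sigma (2 * (r + 1) - 1) τ
  have h4 : (r : ℂ) + 1 ≠ 0 := Nat.cast_add_one_ne_zero r
  rw [EisensteinSeries.q_expansion_bernoulli hk (even_two_mul _), eisG]
  simp only [zpow_natCast]
  rw [h3, h2, h1]
  generalize ∑' n : ℕ, (ArithmeticFunction.sigma (2 * (r + 1) - 1) (n + 1) : ℂ) *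
    Complex.exp (2 * Real.pi * Complex.I * ((n : ℂ) + 1) * τ) = S
  rw [show 2 * r + 1 + 1 = 2 * (r + 1) by ring, pow_succ, pow_mul]
  push_cast
  have h5 : (2 * (r : ℂ) + 1 + 1) ≠ 0 := by
    rw [show 2 * (r : ℂ) + 1 + 1 = 2 * (r + 1) by ring]
    exact mul_ne_zero two_ne_zero h4
  field_simp
  ring

/-- The anomaly `κ`, nonzero only in weight two, lets all weights be treated by one formula. -/
theorem eisG_apply_smul (r : ℕ) : ∃ κ : ℂ, (r ≠ 0 → κ = 0) ∧ ∀ (γ : SL(2, ℤ)) (τ : UpperHalfPlane),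
    eisG (2 * (r + 1)) ((γ • τ : UpperHalfPlane) : ℂ) =
      UpperHalfPlane.denom γ τ ^ (2 * (r + 1)) * eisG (2 * (r + 1)) τ +
        κ * (γ 1 0 * UpperHalfPlane.denom γ τ) := by
  rcases Nat.eq_zero_or_pos r with rfl | hr
  · refine ⟨-1 / 24 * (6 / (Real.pi * Complex.I)), by simp, fun γ τ => ?_⟩
    rw [zero_add, mul_one, eisG_two, eisG_two, E2_apply_smul]
    ring
  · refine ⟨0, fun _ => rfl, fun γ τ => ?_⟩
    have hk : 3 ≤ 2 * (r + 1) := by omega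
    have h := SlashInvariantForm.slash_action_eqn'' (ModularForm.E hk)
      (Γ := (Matrix.SpecialLinearGroup.mapGL (R := ℤ) (n := Fin 2) ℝ).range)
      (γ := Matrix.SpecialLinearGroup.mapGL ℝ γ) ⟨γ, rfl⟩ τ
    rw [zpow_natCast] at h
    rw [eisG_eq_E r hk, eisG_eq_E r hk, zero_mul, add_zero, mul_left_comm]
    exact congrArg _ h

theorem isQuasimodular_eisG (Γ : Subgroup SL(2, ℤ)) (r : ℕ) :
    IsQuasimodular Γ (2 * (r + 1)) fun τ => eisG (2 * (r + 1)) τ := by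
  rcases Nat.eq_zero_or_pos r with rfl | hr
  · have h := (IsQuasimodular.E2 (Γ := Γ)).smul (-1 / 24)
    convert h using 1
    ext τ
    exact eisG_two τ
  · obtain ⟨κ, hκ, h⟩ := eisG_apply_smul r
    refine IsQuasimodular.modular ⟨tempered_eisG r, fun γ _ => (slash_eq_iff _ _ γ).mpr fun τ => ?_⟩
    rw [h, hκ hr.ne', zero_mul, add_zero]

/-- `γ'` is the conjugate of `γ` by `diag(x, 1)`, the matrix of `τ ↦ xτ`. -/
theorem conj_smul {x : {x : ℝ // 0 < x}} {γ γ' : SL(2, ℤ)} (h00 : γ' 0 0 = γ 0 0)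
    (h11 : γ' 1 1 = γ 1 1) (h01 : (γ' 0 1 : ℝ) = x * γ 0 1) (h10 : (x : ℝ) * γ' 1 0 = γ 1 0)
    (τ : UpperHalfPlane) : UpperHalfPlane.denom γ' (x • τ : UpperHalfPlane) =
      UpperHalfPlane.denom γ τ ∧ γ' • x • τ = x • γ • τ := by
  have hd : UpperHalfPlane.denom γ' (x • τ : UpperHalfPlane) = UpperHalfPlane.denom γ τ := by
    have h10' : ((x : ℝ) : ℂ) * γ' 1 0 = γ 1 0 := by exact_mod_cast h10
    rw [ModularGroup.denom_apply, ModularGroup.denom_apply, h11, ← h10',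
      UpperHalfPlane.coe_pos_real_smul, Complex.real_smul]
    ring
  refine ⟨hd, UpperHalfPlane.ext ?_⟩
  have h01' : (γ' 0 1 : ℂ) = ((x : ℝ) : ℂ) * γ 0 1 := by exact_mod_cast h01
  have hJ := UpperHalfPlane.denom_ne_zero γ τ
  have key : ∀ (δ : SL(2, ℤ)) (z : UpperHalfPlane),
      ((δ • z : UpperHalfPlane) : ℂ) = (δ 0 0 * z + δ 0 1) / UpperHalfPlane.denom δ z := by
    intro δ z
    rw [UpperHalfPlane.coe_specialLinearGroup_apply, ModularGroup.denom_apply]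
    simp
  rw [key, hd, UpperHalfPlane.coe_pos_real_smul, UpperHalfPlane.coe_pos_real_smul, key, h00, h01',
    Complex.real_smul, Complex.real_smul]
  ring

/-- On `Γ(4)` both off-diagonal entries are divisible by four, so the one that the conjugation
halves remains an integer. -/
theorem exists_conj {γ : SL(2, ℤ)} (hγ : γ ∈ CongruenceSubgroup.Gamma 4) {x : {x : ℝ // 0 < x}}
    (hx : (x : ℝ) = 2 ∨ (x : ℝ) = 1 / 2) :
    ∃ γ' : SL(2, ℤ), (γ' 0 0 = γ 0 0 ∧ γ' 1 1 = γ 1 1) ∧ (γ' 0 1 : ℝ) = x * γ 0 1 ∧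
      (x : ℝ) * γ' 1 0 = γ 1 0 := by
  rw [CongruenceSubgroup.Gamma_mem] at hγ
  obtain ⟨_, h01, h10, _⟩ := hγ
  obtain ⟨b, hb⟩ := (ZMod.intCast_zmod_eq_zero_iff_dvd _ 4).mp h01
  obtain ⟨c, hc⟩ := (ZMod.intCast_zmod_eq_zero_iff_dvd _ 4).mp h10
  have hdet := γ.det_coe
  rw [Matrix.det_fin_two] at hdet
  rcases hx with hx | hx
  · refine ⟨⟨!![γ 0 0, 2 * γ 0 1; 2 * c, γ 1 1], ?_⟩, ⟨rfl, rfl⟩, ?_, ?_⟩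
    · rw [hc] at hdet
      push_cast at hdet
      rw [Matrix.det_fin_two_of]
      linear_combination hdet
    · rw [hx]
      simp
    · have h := congrArg (fun n : ℤ => (n : ℝ)) hc
      push_cast at h
      rw [hx]
      simp
      linarith
  · refine ⟨⟨!![γ 0 0, 2 * b; 2 * γ 1 0, γ 1 1], ?_⟩, ⟨rfl, rfl⟩, ?_, ?_⟩
    · rw [hb] at hdet
      push_cast at hdet
      rw [Matrix.det_fin_two_of]
      linear_combination hdet
    · have h := congrArg (fun n : ℤ => (n : ℝ)) hb
      push_cast at h
      rw [hx]
      simp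
      linarith
    · rw [hx]
      simp

theorem isQuasimodular_eisG_smul (r : ℕ) {x : {x : ℝ // 0 < x}}
    (hx : (x : ℝ) = 2 ∨ (x : ℝ) = 1 / 2) :
    IsQuasimodular (CongruenceSubgroup.Gamma 4) (2 * (r + 1))
      fun τ => eisG (2 * (r + 1)) (x • τ : UpperHalfPlane) := by
  obtain ⟨κ, hκ, hG⟩ := eisG_apply_smul r
  have hx0 : ((x : ℝ) : ℂ) ≠ 0 := by exact_mod_cast x.2.ne'
  -- In weight two the anomaly of `G₂(xτ)` is `1/x` times that of `G₂(τ)`, because the lower left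
  -- entry of `γ'` is that of `γ` divided by `x`. The subtraction removes it.
  have hmod : IsHolModular (CongruenceSubgroup.Gamma 4) (2 * (r + 1))
      ((fun τ => eisG (2 * (r + 1)) (x • τ : UpperHalfPlane)) -
        (if r = 0 then ((x : ℝ) : ℂ)⁻¹ else 0) • fun τ : UpperHalfPlane => eisG (2 * (r + 1)) τ) := by
    refine ⟨((tempered_eisG r).comp_smul x).sub ((tempered_eisG r).smul _), fun γ hγ =>
      (slash_eq_iff _ _ γ).mpr fun τ => ?_⟩
    obtain ⟨γ', ⟨h00, h11⟩, h01, h10⟩ := exists_conj hγ hx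
    obtain ⟨hd, hs⟩ := conj_smul h00 h11 h01 h10 τ
    have h10' : (γ' 1 0 : ℂ) = ((x : ℝ) : ℂ)⁻¹ * γ 1 0 := by
      have : ((x : ℝ) : ℂ) * γ' 1 0 = γ 1 0 := by exact_mod_cast h10
      rw [← this]
      field_simp
    simp only [Pi.sub_apply, Pi.smul_apply, smul_eq_mul]
    rw [← hs, hG, hG, hd, h10']
    split_ifs with h
    · ring
    · rw [hκ h]
      ring
  have h := (IsQuasimodular.modular hmod).add ((isQuasimodular_eisG _ r).smul
    (if r = 0 then ((x : ℝ) : ℂ)⁻¹ else 0))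
  rwa [sub_add_cancel] at h

theorem isQuasimodular_eisCombination (r : ℕ) :
    IsQuasimodular (CongruenceSubgroup.Gamma 4) (2 * (r + 1)) (eisCombination (r + 1)) := by
  have h1 := isQuasimodular_eisG (CongruenceSubgroup.Gamma 4) r
  have h2 := isQuasimodular_eisG_smul r (x := ⟨2, two_pos⟩) (Or.inl rfl)
  have h3 := isQuasimodular_eisG_smul r (x := ⟨1 / 2, one_half_pos⟩) (Or.inr rfl)
  set m := 2 * (r + 1) with hm
  have h := ((h3.add (h1.smul (-2 ^ (m - 1)))).smul (2 ^ (m - 1))⁻¹).add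
    ((h1.add (h2.smul (-2 ^ (m - 1)))).smul (-(2 ^ (m - 2))⁻¹))
  convert h using 1
  ext τ
  simp only [eisCombination, eisF, Pi.add_apply, Pi.smul_apply, smul_eq_mul, ← hm]
  have e2 : (((⟨2, two_pos⟩ : {x : ℝ // 0 < x}) • τ : UpperHalfPlane) : ℂ) = 2 * τ := by
    rw [UpperHalfPlane.coe_pos_real_smul]
    simp
  have e3 : (((⟨1 / 2, one_half_pos⟩ : {x : ℝ // 0 < x}) • τ : UpperHalfPlane) : ℂ) = τ / 2 := by
    rw [UpperHalfPlane.coe_pos_real_smul]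
    simp
    ring
  rw [e2, e3, mul_div_cancel_left₀ _ (two_ne_zero' ℂ)]
  ring

end

/-! ### Eta functions and the leading coefficients of the characters -/

section

open scoped ModularForm
open scoped MvPowerSeries.WithPiTopology

/-! ## Functions determined by their logarithmic derivative -/

/-- `f` has logarithmic derivative `φ` (with respect to `D`) and leading term `q^c` at `i∞`. -/
structure HasLogDeriv (f φ : UpperHalfPlane → ℂ) (c : ℂ) : Prop where
  mdiff : MDiff f
  deriv : ∀ τ, Derivative.normalizedDerivOfComplex f τ = f τ * φ τ
  leading : Filter.Tendsto (fun τ : UpperHalfPlane =>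
    f τ * Complex.exp (-(2 * Real.pi * Complex.I * c * τ))) UpperHalfPlane.atImInfty (nhds 1)

theorem mdiff_div {f g : UpperHalfPlane → ℂ} (hf : MDiff f) (hg : MDiff g) (h0 : ∀ τ, g τ ≠ 0) :
    MDiff fun τ => f τ / g τ := by
  rw [UpperHalfPlane.mdifferentiable_iff] at *
  exact hf.div hg fun z _ => h0 _

theorem exists_eq_const_of_deriv_eq_zero {h : UpperHalfPlane → ℂ} (hm : MDiff h)
    (hd : ∀ τ, Derivative.normalizedDerivOfComplex h τ = 0) : ∃ C, ∀ τ, h τ = C := by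
  rw [UpperHalfPlane.mdifferentiable_iff] at hm
  obtain ⟨C, hC⟩ := UpperHalfPlane.isOpen_upperHalfPlaneSet.exists_is_const_of_deriv_eq_zero
    (convex_halfSpace_im_gt 0).isPreconnected hm fun z hz => by
      have h1 := hd ⟨z, hz⟩
      rw [Derivative.normalizedDerivOfComplex, mul_eq_zero] at h1
      refine h1.resolve_left (inv_ne_zero ?_)
      simp [Real.pi_ne_zero]
  refine ⟨C, fun τ => ?_⟩
  have := hC τ τ.im_pos
  rwa [Function.comp_apply, UpperHalfPlane.ofComplex_apply] at this

namespace HasLogDeriv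

variable {f g φ ψ : UpperHalfPlane → ℂ} {c d : ℂ}

theorem mul (hf : HasLogDeriv f φ c) (hg : HasLogDeriv g ψ d) :
    HasLogDeriv (f * g) (φ + ψ) (c + d) := by
  refine ⟨MDifferentiable.mul hf.mdiff hg.mdiff, fun τ => ?_, ?_⟩
  · rw [Derivative.normalizedDerivOfComplex_mul _ _ hf.mdiff hg.mdiff]
    simp only [Pi.add_apply, Pi.mul_apply, hf.deriv, hg.deriv]
    ring
  · have h := hf.leading.mul hg.leading
    rw [one_mul] at h
    refine h.congr fun τ => ?_
    rw [Pi.mul_apply, mul_mul_mul_comm, ← Complex.exp_add]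
    ring_nf

theorem inv (hf : HasLogDeriv f φ c) (h0 : ∀ τ, f τ ≠ 0) : HasLogDeriv f⁻¹ (-φ) (-c) := by
  have hm : MDiff f⁻¹ := by
    have := mdiff_div (mdifferentiable_const (c := (1 : ℂ))) hf.mdiff h0
    simp only [one_div] at this
    exact this
  refine ⟨hm, fun τ => ?_, ?_⟩
  · have h1 := congrFun (Derivative.normalizedDerivOfComplex_mul _ _ hf.mdiff hm) τ
    have h2 : f * f⁻¹ = fun _ => (1 : ℂ) := by
      ext τ
      exact mul_inv_cancel₀ (h0 τ)
    rw [h2, Derivative.normalizedDerivOfComplex_const] at h1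
    simp only [Pi.add_apply, Pi.mul_apply, Pi.zero_apply, hf.deriv, Pi.inv_apply, Pi.neg_apply]
      at h1 ⊢
    have h3 := h0 τ
    refine mul_left_cancel₀ h3 ?_
    field_simp at h1 ⊢
    linear_combination -h1
  · have h := hf.leading.inv₀ one_ne_zero
    rw [inv_one] at h
    refine h.congr fun τ => ?_
    rw [mul_inv, ← Complex.exp_neg, Pi.inv_apply]
    ring_nf

theorem comp_smul (hf : HasLogDeriv f φ c) (x : {x : ℝ // 0 < x}) :
    HasLogDeriv (fun τ => f (x • τ)) (fun τ => (x : ℝ) * φ (x • τ)) ((x : ℝ) * c) := by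
  have hd : ∀ τ : UpperHalfPlane, HasDerivAt ((fun τ => f (x • τ)) ∘ UpperHalfPlane.ofComplex)
      (_root_.deriv (f ∘ UpperHalfPlane.ofComplex) ((x : ℝ) • (τ : ℂ)) * (x : ℝ)) τ := by
    intro τ
    have h1 := (UpperHalfPlane.mdifferentiableAt_iff.mp (hf.mdiff (x • τ))).hasDerivAt
    rw [UpperHalfPlane.coe_pos_real_smul] at h1
    have h2 : HasDerivAt (fun z : ℂ => (x : ℝ) • z) ((x : ℝ) : ℂ) τ := by
      simpa [Complex.real_smul] using (hasDerivAt_id (τ : ℂ)).const_mul ((x : ℝ) : ℂ)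
    refine (h1.comp (τ : ℂ) h2).congr_of_eventuallyEq ?_
    filter_upwards [UpperHalfPlane.isOpen_upperHalfPlaneSet.mem_nhds τ.im_pos] with z hz
    have hz' : 0 < ((x : ℝ) • z).im := by
      rw [Complex.smul_im]
      exact mul_pos x.2 hz
    rw [Function.comp_apply, Function.comp_apply, Function.comp_apply,
      UpperHalfPlane.ofComplex_apply_of_im_pos hz, UpperHalfPlane.ofComplex_apply_of_im_pos hz']
    rfl
  refine ⟨fun τ => ?_, fun τ => ?_, ?_⟩
  · rw [UpperHalfPlane.mdifferentiableAt_iff]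
    exact (hd τ).differentiableAt
  · have h1 := hf.deriv (x • τ)
    rw [Derivative.normalizedDerivOfComplex, UpperHalfPlane.coe_pos_real_smul] at h1
    rw [Derivative.normalizedDerivOfComplex, (hd τ).deriv, ← mul_assoc, h1]
    ring
  · have h1 : Filter.Tendsto (fun τ : UpperHalfPlane => x • τ) UpperHalfPlane.atImInfty
        UpperHalfPlane.atImInfty := by
      refine Filter.tendsto_comap_iff.mpr ?_
      have h2 : UpperHalfPlane.im ∘ (fun τ : UpperHalfPlane => x • τ) =
          fun τ => (x : ℝ) * τ.im := by
        ext τ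
        exact UpperHalfPlane.pos_real_im x τ
      rw [h2]
      exact Filter.Tendsto.const_mul_atTop x.2 Filter.tendsto_comap
    refine (hf.leading.comp h1).congr fun τ => ?_
    rw [Function.comp_apply, UpperHalfPlane.coe_pos_real_smul, Complex.real_smul]
    ring_nf

/-- The quotient has derivative zero, hence is constant, and the leading terms fix the constant to
be one. -/
theorem unique (hf : HasLogDeriv f φ c) (hg : HasLogDeriv g φ c) (h0 : ∀ τ, g τ ≠ 0) : f = g := by
  have hm := mdiff_div hf.mdiff hg.mdiff h0
  have hfg : (fun τ => f τ / g τ) * g = f := by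
    ext τ
    exact div_mul_cancel₀ _ (h0 τ)
  obtain ⟨C, hC⟩ := exists_eq_const_of_deriv_eq_zero hm fun τ => by
    have h1 := congrFun (Derivative.normalizedDerivOfComplex_mul _ _ hm hg.mdiff) τ
    rw [hfg] at h1
    simp only [Pi.add_apply, Pi.mul_apply, hf.deriv, hg.deriv] at h1
    have h2 : f τ = f τ / g τ * g τ := (div_mul_cancel₀ _ (h0 τ)).symm
    refine (mul_eq_zero.mp (?_ : _ * g τ = 0)).resolve_right (h0 τ)
    linear_combination -h1 + φ τ * h2
  have hf' : ∀ τ, f τ = C * g τ := fun τ => by rw [← hC τ, div_mul_cancel₀ _ (h0 τ)]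
  have h3 := hg.leading.const_mul C
  rw [mul_one] at h3
  have h4 := tendsto_nhds_unique hf.leading (h3.congr fun τ => by rw [hf' τ, ← mul_assoc])
  ext τ
  rw [hf', ← h4, one_mul]

end HasLogDeriv

/-! ## The leading coefficients of the characters -/

theorem hasLogDeriv_eta : HasLogDeriv (fun τ : UpperHalfPlane => ModularForm.eta τ)
    (fun τ => EisensteinSeries.E2 τ / 24) (1 / 24) := by
  have hcomp : ∀ τ : UpperHalfPlane, (fun τ : UpperHalfPlane => ModularForm.eta τ) ∘
      UpperHalfPlane.ofComplex =ᶠ[nhds (τ : ℂ)] ModularForm.eta := by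
    intro τ
    filter_upwards [UpperHalfPlane.isOpen_upperHalfPlaneSet.mem_nhds τ.im_pos] with z hz
    rw [Function.comp_apply, UpperHalfPlane.ofComplex_apply_of_im_pos hz]
  refine ⟨fun τ => ?_, fun τ => ?_, ?_⟩
  · rw [UpperHalfPlane.mdifferentiableAt_iff]
    exact (ModularForm.differentiableAt_eta_of_mem_upperHalfPlaneSet
      τ.im_pos).congr_of_eventuallyEq (hcomp τ)
  · have h := ModularForm.logDeriv_eta_eq_E2 τ
    have h0 := ModularForm.eta_ne_zero τ.im_pos
    rw [logDeriv_apply, div_eq_iff h0] at h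
    rw [Derivative.normalizedDerivOfComplex, (hcomp τ).deriv_eq, h]
    field_simp [Real.pi_ne_zero]
    ring
  · have h1 : Filter.Tendsto (fun q : ℂ => ∏' n : ℕ, (1 - q ^ (n + 1))) (nhds 0) (nhds 1) := by
      have h0 : (0 : ℂ) ∈ Metric.ball (0 : ℂ) 1 := Metric.mem_ball_self one_pos
      have h2 := (ModularForm.differentiableOn_tprod_one_sub_pow.differentiableAt
        (Metric.isOpen_ball.mem_nhds h0)).continuousAt.tendsto
      simpa using h2
    refine (h1.comp (UpperHalfPlane.qParam_tendsto_atImInfty zero_lt_one)).congr fun τ => ?_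
    rw [Function.comp_apply, ModularForm.eta, Function.Periodic.qParam, Function.Periodic.qParam,
      mul_right_comm (Complex.exp _), ← Complex.exp_add]
    have h3 : 2 * Real.pi * Complex.I * τ / ((24 : ℝ) : ℂ) +
        -(2 * Real.pi * Complex.I * (1 / 24) * τ) = 0 := by
      push_cast
      ring
    rw [h3, Complex.exp_zero, one_mul]
    rfl

/-- Dominated convergence, the majorant being the value of the series of norms at `Im τ = 1`. -/
theorem ExpSummable.tendsto {ι : Type} {a : ι → ℂ} {μ : ι → ℝ} (h : ExpSummable a μ) {i₀ : ι}
    (h0 : μ i₀ = 0) (hpos : ∀ i, i ≠ i₀ → 0 < μ i) :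
    Filter.Tendsto (expSum a μ) UpperHalfPlane.atImInfty (nhds (a i₀)) := by
  classical
  have h1 := tendsto_tsum_of_dominated_convergence (𝓕 := UpperHalfPlane.atImInfty)
    (f := fun (τ : UpperHalfPlane) i => a i * Complex.exp (2 * Real.pi * Complex.I * τ * μ i))
    (g := fun i => if i = i₀ then a i₀ else 0)
    (h.summable (2 * Real.pi) (by positivity)) (fun i => ?_) ?_
  · rwa [tsum_ite_eq] at h1
  · split_ifs with hi
    · rw [hi, h0]
      simp
    · rw [tendsto_zero_iff_norm_tendsto_zero]
      simp only [norm_mul, norm_exp_mul]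
      rw [← mul_zero ‖a i‖]
      refine Filter.Tendsto.const_mul _ (Real.tendsto_exp_atBot.comp ?_)
      have h2 : Filter.Tendsto UpperHalfPlane.im UpperHalfPlane.atImInfty Filter.atTop :=
        Filter.tendsto_comap
      have h3 := h2.const_mul_atTop (mul_pos (mul_pos two_pos Real.pi_pos) (hpos i hi))
      refine (Filter.tendsto_neg_atTop_atBot.comp h3).congr fun τ => ?_
      rw [Function.comp_apply, UpperHalfPlane.coe_im]
      ring
  · have h2 : ∀ᶠ τ in UpperHalfPlane.atImInfty, 1 ≤ UpperHalfPlane.im τ :=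
      Filter.tendsto_comap.eventually (Filter.eventually_ge_atTop 1)
    filter_upwards [h2] with τ hτ i
    rw [norm_mul, norm_exp_mul, UpperHalfPlane.coe_im]
    have h3 : -(2 * Real.pi * τ.im) * μ i ≤ -(2 * Real.pi) * μ i := by
      refine mul_le_mul_of_nonneg_right ?_ (h.nonneg i)
      nlinarith [Real.pi_pos]
    gcongr

/-- The vacuum `i₀` is the only state of energy zero, so `q^{c_0}` is the leading term. -/
theorem IsModeSeq.hasLogDeriv {lam : ℕ → ℝ} (h : IsModeSeq lam) {ε : ℂ} (hε : ‖ε‖ = 1)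
    {ι : Type} {occ : ι → ℕ →₀ ℕ} (hocc : Function.Injective occ) (c : ℕ → ℂ)
    {Z : UpperHalfPlane → MvPowerSeries ℕ ℂ} {i₀ : ι} (h0 : occ i₀ = 0)
    (hZ : ∀ τ : UpperHalfPlane, HasSum (fun i => charExp τ (stateEv lam c (occ i))) (Z τ))
    (hrel : ∀ (τ : UpperHalfPlane) (n : ℕ) (A : MvPowerSeries ℕ ℂ),
      HasSum (fun i => (occ i n : ℂ) • charExp τ (stateEv lam c (occ i))) A →
        A = charExp τ (modeEv lam n) * (Z τ + ε • A)) :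
    HasLogDeriv (fun τ => MvPowerSeries.constantCoeff (Z τ))
      (fun τ : UpperHalfPlane => c 0 + lambert ε lam 0 1 τ) (c 0) := by
  have hS : ExpSummable (fun _ : ι => (1 : ℂ)) (fun i => energy lam (occ i) 0) := by
    refine ⟨fun i => h.energy_nonneg _ _, fun t ht => ?_⟩
    simpa [Function.comp_def] using (h.summable_exp_energy ht).comp_injective hocc
  have hZ0 : ∀ τ : UpperHalfPlane, MvPowerSeries.constantCoeff (Z τ) *
      Complex.exp (-(2 * Real.pi * Complex.I * c 0 * τ)) =
        expSum (fun _ : ι => (1 : ℂ)) (fun i => energy lam (occ i) 0) τ := by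
    intro τ
    have h1 := MvPowerSeries.WithPiTopology.hasSum_iff_hasSum_coeff.mp (hZ τ) 0
    simp only [MvPowerSeries.coeff_zero_eq_constantCoeff_apply, constantCoeff_charExp] at h1
    refine (h1.mul_right _).unique ((hS.hasSum τ).congr_fun fun i => ?_)
    rw [← Complex.exp_add, stateEv, one_mul]
    ring_nf
  refine ⟨fun τ => ?_, h.deriv_constantCoeff hε hocc c hZ hrel, ?_⟩
  · rw [UpperHalfPlane.mdifferentiableAt_iff]
    have h1 : DifferentiableAt ℂ (fun z : ℂ => Complex.exp (2 * Real.pi * Complex.I * c 0 * z)) τ :=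
      by fun_prop
    refine ((UpperHalfPlane.mdifferentiableAt_iff.mp (hS.mdiff τ)).mul
      h1).congr_of_eventuallyEq ?_
    filter_upwards [UpperHalfPlane.isOpen_upperHalfPlaneSet.mem_nhds τ.im_pos] with z hz
    rw [Pi.mul_apply, Function.comp_apply, Function.comp_apply, ← hZ0, mul_assoc,
      UpperHalfPlane.ofComplex_apply_of_im_pos hz, ← Complex.exp_add]
    simp
  · refine (hS.tendsto (i₀ := i₀) ?_ fun i hi => ?_).congr fun τ => (hZ0 τ).symm
    · rw [h0]
      simp [energy]
    · have h1 : occ i ≠ 0 := fun h2 => hi (hocc (h2.trans h0.symm))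
      obtain ⟨n, hn⟩ := Finsupp.ne_iff.mp h1
      refine lt_of_lt_of_le ?_ (h.mul_le_energy (occ i) n)
      have hn' : (0 : ℝ) < occ i n := by exact_mod_cast Nat.pos_of_ne_zero hn
      exact mul_pos hn' (h.pos n)

/-- The logarithmic derivative is `G₂ = -E₂/24`, that of `1/η`, and both sides lead with
`q^{-1/24}`. -/
theorem constantCoeff_boson (τ : UpperHalfPlane) :
    MvPowerSeries.constantCoeff (genCharacter bosonCartan τ) = (ModularForm.eta τ)⁻¹ := by
  have h1 := isModeSeq_boson.hasLogDeriv (ε := 1) (by simp) (occ := id) Function.injective_id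
    bosonConst (i₀ := 0) rfl boson_hasGenCharacter.2 boson_relation
  have h2 := hasLogDeriv_eta.inv fun τ => ModularForm.eta_ne_zero τ.im_pos
  have h3 : (fun τ : UpperHalfPlane => bosonConst 0 + lambert 1 (fun n => n + 1) 0 1 τ) =
      -fun τ => EisensteinSeries.E2 τ / 24 := by
    ext τ
    have := eisG_eq 0 τ
    rw [zero_add, mul_one, eisG_two, mul_zero, zero_add] at this
    rw [← this, Pi.neg_apply]
    ring
  rw [h3, bosonConst_zero, show (-1 / 24 : ℂ) = -(1 / 24) by ring] at h1
  exact congrFun (h1.unique h2 fun τ => inv_ne_zero (ModularForm.eta_ne_zero τ.im_pos)) τ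

theorem coe_two_smul (τ : UpperHalfPlane) :
    (((⟨2, two_pos⟩ : {x : ℝ // 0 < x}) • τ : UpperHalfPlane) : ℂ) = 2 * τ := by
  rw [UpperHalfPlane.coe_pos_real_smul]
  simp

theorem coe_half_smul (τ : UpperHalfPlane) :
    (((⟨1 / 2, one_half_pos⟩ : {x : ℝ // 0 < x}) • τ : UpperHalfPlane) : ℂ) = τ / 2 := by
  rw [UpperHalfPlane.coe_pos_real_smul]
  simp
  ring

theorem eta_two_mul_ne_zero (τ : UpperHalfPlane) : ModularForm.eta (2 * τ) ≠ 0 := by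
  rw [← coe_two_smul]
  exact ModularForm.eta_ne_zero (UpperHalfPlane.im_pos _)

theorem eta_div_two_ne_zero (τ : UpperHalfPlane) : ModularForm.eta (τ / 2) ≠ 0 := by
  rw [← coe_half_smul]
  exact ModularForm.eta_ne_zero (UpperHalfPlane.im_pos _)

/-- The level-two combination of weight two is `(2E₂(τ) - 2E₂(2τ) - E₂(τ/2)/2)/24`, the logarithmic
derivative of the quotient; both sides lead with `q^{-1/48}`. -/
theorem constantCoeff_fermion (τ : UpperHalfPlane) :
    MvPowerSeries.constantCoeff (genCharacter fermionCartan τ) =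
      ModularForm.eta τ ^ 2 / (ModularForm.eta (2 * τ) * ModularForm.eta (τ / 2)) := by
  have h1 := isModeSeq_fermion.hasLogDeriv (ε := -1) (by simp) occupation_injective
    fermionConst (i₀ := ∅) (Finsupp.ext fun n => by simp [occupation_apply]) fermion_hasGenCharacter.2
    fun _ _ _ => fermion_occupation_relation (fermion_hasGenCharacter.2 _)
  have e1 := hasLogDeriv_eta.comp_smul ⟨2, two_pos⟩
  have e2 := hasLogDeriv_eta.comp_smul ⟨1 / 2, one_half_pos⟩
  simp only [coe_two_smul] at e1
  simp only [coe_half_smul] at e2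
  have h2 := (hasLogDeriv_eta.mul hasLogDeriv_eta).mul ((e1.mul e2).inv fun τ =>
    mul_ne_zero (eta_two_mul_ne_zero τ) (eta_div_two_ne_zero τ))
  have h3 : (fun τ : UpperHalfPlane => fermionConst 0 + lambert (-1) (fun n => n + 1 / 2) 0 1 τ) =
      eisCombination 1 := by
    ext τ
    exact (eisCombination_eq 0 τ).symm
  rw [h3] at h1
  have h4 : HasLogDeriv (((fun τ : UpperHalfPlane => ModularForm.eta τ) *
      fun τ : UpperHalfPlane => ModularForm.eta τ) *
      ((fun τ : UpperHalfPlane => ModularForm.eta (2 * τ)) *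
        fun τ : UpperHalfPlane => ModularForm.eta (τ / 2))⁻¹)
      (eisCombination 1) (fermionConst 0) := by
    convert h2 using 1
    · ext τ
      rw [eisCombination, eisF, eisF]
      simp only [Pi.add_apply, Pi.neg_apply, mul_one]
      rw [mul_div_cancel_left₀ _ (two_ne_zero' ℂ), ← coe_half_smul, ← coe_two_smul, eisG_two,
        eisG_two, eisG_two]
      push_cast
      ring
    · rw [fermionConst_zero]
      push_cast
      norm_num
  rw [sq, div_eq_mul_inv]
  exact congrFun (h1.unique h4 fun τ => mul_ne_zero (mul_ne_zero (ModularForm.eta_ne_zero τ.im_pos)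
    (ModularForm.eta_ne_zero τ.im_pos))
    (inv_ne_zero (mul_ne_zero (eta_two_mul_ne_zero τ) (eta_div_two_ne_zero τ)))) τ

end

section

open scoped ModularForm

/-! ## The eta quotient `η(τ) / (η(2τ) η(τ/2))` -/

/-- Taking norms in the modularity of `Δ = η^24` and extracting a twelfth root avoids the multiplier
of `η`. -/
theorem norm_eta_smul_sq (γ : SL(2, ℤ)) (τ : UpperHalfPlane) :
    ‖ModularForm.eta (γ • τ : UpperHalfPlane)‖ ^ 2 =
      ‖UpperHalfPlane.denom γ τ‖ * ‖ModularForm.eta τ‖ ^ 2 := by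
  have h : ModularForm.discriminant (γ • τ) =
      UpperHalfPlane.denom γ τ ^ (12 : ℤ) * ModularForm.discriminant τ :=
    SlashInvariantForm.slash_action_eqn'' CuspForm.discriminant
      (Γ := (Matrix.SpecialLinearGroup.mapGL (R := ℤ) (n := Fin 2) ℝ).range)
      (γ := Matrix.SpecialLinearGroup.mapGL ℝ γ) ⟨γ, rfl⟩ τ
  have h1 := congrArg norm h
  rw [ModularForm.discriminant, ModularForm.discriminant, norm_mul, norm_zpow, norm_pow, norm_pow]
    at h1
  refine (pow_left_inj₀ (by positivity) (by positivity) (n := 12) (by norm_num)).mp ?_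
  have h2 : ‖UpperHalfPlane.denom γ τ‖ ^ (12 : ℤ) = ‖UpperHalfPlane.denom γ τ‖ ^ 12 := by
    norm_cast
  rw [h2] at h1
  rw [mul_pow, ← pow_mul, ← pow_mul]
  exact h1

/-- The function `η(τ) / (η(2τ) η(τ/2))` on the upper half-plane. -/
def etaQuotient (τ : UpperHalfPlane) : ℂ :=
  ModularForm.eta τ / (ModularForm.eta (2 * τ) * ModularForm.eta (τ / 2))

theorem etaQuotient_ne_zero (τ : UpperHalfPlane) : etaQuotient τ ≠ 0 :=
  div_ne_zero (ModularForm.eta_ne_zero τ.im_pos)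
    (mul_ne_zero (eta_two_mul_ne_zero τ) (eta_div_two_ne_zero τ))

theorem mdiff_etaQuotient : MDiff etaQuotient := by
  have e1 := (hasLogDeriv_eta.comp_smul ⟨2, two_pos⟩).mdiff
  have e2 := (hasLogDeriv_eta.comp_smul ⟨1 / 2, one_half_pos⟩).mdiff
  simp only [coe_two_smul] at e1
  simp only [coe_half_smul] at e2
  exact mdiff_div hasLogDeriv_eta.mdiff (MDifferentiable.mul e1 e2) fun τ =>
    mul_ne_zero (eta_two_mul_ne_zero τ) (eta_div_two_ne_zero τ)

/-- After conjugation the three eta values acquire the same factor `|J|`, once in the numerator and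
twice in the denominator. -/
theorem norm_etaQuotient_smul_sq {γ : SL(2, ℤ)} (hγ : γ ∈ CongruenceSubgroup.Gamma 4)
    (τ : UpperHalfPlane) : ‖etaQuotient (γ • τ)‖ ^ 2 =
      ‖UpperHalfPlane.denom γ τ‖⁻¹ * ‖etaQuotient τ‖ ^ 2 := by
  obtain ⟨γ₁, ⟨h00, h11⟩, h01, h10⟩ := exists_conj hγ (x := ⟨2, two_pos⟩) (Or.inl rfl)
  obtain ⟨γ₂, ⟨k00, k11⟩, k01, k10⟩ := exists_conj hγ (x := ⟨1 / 2, one_half_pos⟩) (Or.inr rfl)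
  obtain ⟨d1, e1⟩ := conj_smul h00 h11 h01 h10 τ
  obtain ⟨d2, e2⟩ := conj_smul k00 k11 k01 k10 τ
  have hJ : ‖UpperHalfPlane.denom γ τ‖ ≠ 0 := norm_ne_zero_iff.mpr (UpperHalfPlane.denom_ne_zero γ τ)
  rw [etaQuotient, etaQuotient, norm_div, norm_div, norm_mul, norm_mul, ← coe_two_smul,
    ← coe_two_smul, ← coe_half_smul, ← coe_half_smul, ← e1, ← e2, div_pow, div_pow, mul_pow, mul_pow,
    norm_eta_smul_sq, norm_eta_smul_sq, norm_eta_smul_sq, d1, d2]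
  field_simp

theorem mdiff_autFactor (k : ℝ) (γ : SL(2, ℤ)) : MDiff (autFactor k γ) := by
  intro τ
  rw [UpperHalfPlane.mdifferentiableAt_iff]
  have hcomp : autFactor k γ ∘ UpperHalfPlane.ofComplex =ᶠ[nhds (τ : ℂ)]
      fun z : ℂ => ((γ 1 0 : ℂ) * z + γ 1 1) ^ (k : ℂ) := by
    filter_upwards [UpperHalfPlane.isOpen_upperHalfPlaneSet.mem_nhds τ.im_pos] with z hz
    rw [Function.comp_apply, autFactor, ModularGroup.denom_apply,
      UpperHalfPlane.ofComplex_apply_of_im_pos hz]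
  refine DifferentiableAt.congr_of_eventuallyEq ?_ hcomp
  -- If `c = 0` the factor is constant, even when `d` lies on the branch cut; otherwise `cτ + d` is
  -- not real and stays off the cut.
  by_cases hc : γ 1 0 = 0
  · simp only [hc, Int.cast_zero, zero_mul, zero_add]
    exact differentiableAt_const _
  · have h1 : DifferentiableAt ℂ (fun z : ℂ => (γ 1 0 : ℂ) * z + γ 1 1) τ := by fun_prop
    refine h1.cpow_const (Or.inr ?_)
    simpa using ⟨hc, τ.im_ne_zero⟩

theorem autFactor_ne_zero (k : ℝ) (γ : SL(2, ℤ)) (τ : UpperHalfPlane) : autFactor k γ τ ≠ 0 := by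
  rw [autFactor, Complex.cpow_ne_zero_iff]
  exact Or.inl (UpperHalfPlane.denom_ne_zero γ τ)

theorem norm_autFactor (k : ℝ) (γ : SL(2, ℤ)) (τ : UpperHalfPlane) :
    ‖autFactor k γ τ‖ = ‖UpperHalfPlane.denom γ τ‖ ^ k := Complex.norm_cpow_real _ _

theorem eq_const_of_norm_eq_one {h : UpperHalfPlane → ℂ} (hm : MDiff h) (h1 : ∀ τ, ‖h τ‖ = 1)
    (τ : UpperHalfPlane) : h τ = h UpperHalfPlane.I := by
  rw [UpperHalfPlane.mdifferentiable_iff] at hm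
  have h2 := Complex.eqOn_of_isPreconnected_of_isMaxOn_norm
    (convex_halfSpace_im_gt 0).isPreconnected UpperHalfPlane.isOpen_upperHalfPlaneSet hm
    UpperHalfPlane.I.im_pos (fun z _ => by simp [h1]) τ.im_pos
  simpa only [Function.comp_apply, UpperHalfPlane.ofComplex_apply, Function.const_apply] using h2

/-- The multiplier system of the eta quotient. -/
def etaMultiplier (γ : SL(2, ℤ)) : ℂ :=
  etaQuotient (γ • UpperHalfPlane.I) /
    (autFactor (-1 / 2) γ UpperHalfPlane.I * etaQuotient UpperHalfPlane.I)

theorem norm_etaQuotient_ratio {γ : SL(2, ℤ)} (hγ : γ ∈ CongruenceSubgroup.Gamma 4)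
    (τ : UpperHalfPlane) :
    ‖etaQuotient (γ • τ) / (autFactor (-1 / 2) γ τ * etaQuotient τ)‖ = 1 := by
  have h1 := norm_etaQuotient_smul_sq hγ τ
  have hJ : 0 < ‖UpperHalfPlane.denom γ τ‖ := norm_pos_iff.mpr (UpperHalfPlane.denom_ne_zero γ τ)
  have h2 : ‖autFactor (-1 / 2) γ τ‖ ^ 2 = ‖UpperHalfPlane.denom γ τ‖⁻¹ := by
    rw [norm_autFactor, ← Real.rpow_natCast, ← Real.rpow_mul hJ.le, ← Real.rpow_neg_one]
    norm_num
  have h3 := norm_ne_zero_iff.mpr (etaQuotient_ne_zero τ)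
  refine (pow_left_inj₀ (norm_nonneg _) zero_le_one (n := 2) (by norm_num)).mp ?_
  rw [one_pow, norm_div, norm_mul, div_pow, mul_pow, h2, h1, div_self]
  positivity

/-- The transformation ratio is holomorphic of modulus one, hence constant by the maximum principle;
`etaMultiplier` is its value at `i`. -/
theorem etaQuotient_smul {γ : SL(2, ℤ)} (hγ : γ ∈ CongruenceSubgroup.Gamma 4)
    (τ : UpperHalfPlane) :
    etaQuotient (γ • τ) = etaMultiplier γ * autFactor (-1 / 2) γ τ * etaQuotient τ := by
  have hm : MDiff fun τ => etaQuotient (γ • τ) / (autFactor (-1 / 2) γ τ * etaQuotient τ) := by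
    refine mdiff_div ?_ (MDifferentiable.mul (mdiff_autFactor _ γ) mdiff_etaQuotient) fun τ =>
      mul_ne_zero (autFactor_ne_zero _ γ τ) (etaQuotient_ne_zero τ)
    exact mdiff_etaQuotient.comp (UpperHalfPlane.mdifferentiable_smul (by simp))
  have h1 := eq_const_of_norm_eq_one hm (norm_etaQuotient_ratio hγ) τ
  have h2 := autFactor_ne_zero (-1 / 2) γ τ
  have h3 := etaQuotient_ne_zero τ
  rw [etaMultiplier, ← h1, mul_assoc, div_mul_cancel₀ _ (mul_ne_zero h2 h3)]

theorem isMultiplierSystem_etaMultiplier :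
    IsMultiplierSystem (CongruenceSubgroup.Gamma 4) (-1 / 2) etaMultiplier where
  norm_eq_one γ hγ := norm_etaQuotient_ratio hγ _
  cocycle γ hγ δ hδ τ := by
    refine mul_right_cancel₀ (etaQuotient_ne_zero τ) ?_
    rw [← etaQuotient_smul (mul_mem hγ hδ), mul_smul, etaQuotient_smul hγ, etaQuotient_smul hδ]
    ring
  neg_one h τ := by
    refine mul_right_cancel₀ (etaQuotient_ne_zero τ) ?_
    rw [← etaQuotient_smul h, one_mul, ModularGroup.SL_neg_smul, one_smul]

/-! ## Growth of the eta quotient -/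

theorem sum_geometric_le {w : ℝ} (hw : 0 < w) (N : ℕ) :
    ∑ n ∈ Finset.range N, Real.exp (-w) ^ (n + 1) ≤ w⁻¹ := by
  have h1 : Real.exp (-w) < 1 := Real.exp_lt_one_iff.mpr (by linarith)
  have h0 := Real.exp_pos (-w)
  have h2 : ∑ n ∈ Finset.range N, Real.exp (-w) ^ n ≤ (1 - Real.exp (-w))⁻¹ := by
    rw [← tsum_geometric_of_lt_one h0.le h1]
    exact (summable_geometric_of_lt_one h0.le h1).sum_le_tsum _ fun n _ => by positivity
  simp only [pow_succ]
  rw [← Finset.sum_mul]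
  refine (mul_le_mul_of_nonneg_right h2 h0.le).trans ?_
  have h3 : Real.exp (-w) * (w + 1) ≤ 1 := by
    have := mul_le_mul_of_nonneg_left (Real.add_one_le_exp w) h0.le
    rwa [← Real.exp_add, neg_add_cancel, Real.exp_zero] at this
  rw [inv_mul_le_iff₀ (by linarith), ← div_eq_mul_inv, le_div_iff₀ hw]
  linarith

theorem prod_one_add_exp_le {w : ℝ} (hw : 0 < w) (N : ℕ) :
    ∏ n ∈ Finset.range N, (1 + Real.exp (-w) ^ (n + 1)) ≤ Real.exp w⁻¹ := by
  calc ∏ n ∈ Finset.range N, (1 + Real.exp (-w) ^ (n + 1))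
      ≤ ∏ n ∈ Finset.range N, Real.exp (Real.exp (-w) ^ (n + 1)) :=
        Finset.prod_le_prod (fun n _ => by positivity) fun n _ => by
          rw [add_comm]
          exact Real.add_one_le_exp _
    _ ≤ Real.exp w⁻¹ := by
        rw [← Real.exp_sum]
        exact Real.exp_le_exp.mpr (sum_geometric_le hw N)

/-- Expanding the logarithms, `-∑ log(1 - x^n) = ∑_m (1/m) ∑_n x^{mn}` with `x = exp(-w)`. Each
inner sum is at most `1/(mw)`, so the total is at most `π²/(6w) ≤ 2/w`. -/
theorem exp_neg_le_prod_one_sub {w : ℝ} (hw : 0 < w) (N : ℕ) :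
    Real.exp (-(2 * w⁻¹)) ≤ ∏ n ∈ Finset.range N, (1 - Real.exp (-w) ^ (n + 1)) := by
  have h1 : Real.exp (-w) < 1 := Real.exp_lt_one_iff.mpr (by linarith)
  have h0 := Real.exp_pos (-w)
  have hx : ∀ n : ℕ, Real.exp (-w) ^ (n + 1) < 1 := fun n => pow_lt_one₀ h0.le h1 n.succ_ne_zero
  have h2 : ∀ n ∈ Finset.range N, 0 < 1 - Real.exp (-w) ^ (n + 1) := fun n _ => by
    linarith [hx n]
  have h3 : HasSum (fun m : ℕ => ∑ n ∈ Finset.range N, (Real.exp (-w) ^ (n + 1)) ^ (m + 1) / (m + 1))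
      (∑ n ∈ Finset.range N, -Real.log (1 - Real.exp (-w) ^ (n + 1))) :=
    hasSum_sum fun n _ => Real.hasSum_pow_div_log_of_abs_lt_one (by
      rw [abs_of_pos (by positivity)]
      exact hx n)
  have h4 : HasSum (fun m : ℕ => w⁻¹ * (1 / ((m : ℝ) + 1) ^ 2)) (w⁻¹ * (Real.pi ^ 2 / 6)) := by
    have h5 := (hasSum_nat_add_iff' 1).mpr hasSum_zeta_two
    simp only [Finset.range_one, Finset.sum_singleton, Nat.cast_zero, ne_eq, OfNat.ofNat_ne_zero,
      not_false_eq_true, zero_pow, div_zero, sub_zero, Nat.cast_add, Nat.cast_one] at h5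
    exact h5.mul_left _
  have h6 : ∑ n ∈ Finset.range N, -Real.log (1 - Real.exp (-w) ^ (n + 1)) ≤
      w⁻¹ * (Real.pi ^ 2 / 6) := by
    refine hasSum_le (fun m => ?_) h3 h4
    have h7 := sum_geometric_le (w := w * (m + 1)) (by positivity) N
    rw [← Finset.sum_div]
    have h8 : ∀ n : ℕ, (Real.exp (-w) ^ (n + 1)) ^ (m + 1) =
        Real.exp (-(w * (m + 1))) ^ (n + 1) := by
      intro n
      rw [← Real.exp_nat_mul, ← Real.exp_nat_mul, ← Real.exp_nat_mul]
      push_cast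
      ring_nf
    simp only [h8]
    refine (div_le_div_of_nonneg_right h7 (by positivity)).trans (le_of_eq ?_)
    field_simp
  rw [← Real.exp_log (Finset.prod_pos h2), Real.log_prod fun n hn => (h2 n hn).ne']
  refine Real.exp_le_exp.mpr ?_
  rw [Finset.sum_neg_distrib] at h6
  have h9 : w⁻¹ * (Real.pi ^ 2 / 6) ≤ 2 * w⁻¹ := by
    have h10 : Real.pi ^ 2 / 6 ≤ 2 := by nlinarith [Real.pi_pos, Real.pi_lt_d2]
    rw [mul_comm]
    exact mul_le_mul_of_nonneg_right h10 (inv_pos.mpr hw).le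
  linarith

theorem norm_eta_bounds (τ : UpperHalfPlane) :
    ‖ModularForm.eta τ‖ ≤ Real.exp (τ.im + τ.im⁻¹) ∧
      Real.exp (-(τ.im + τ.im⁻¹)) ≤ ‖ModularForm.eta τ‖ := by
  have hy := τ.im_pos
  have hyi := inv_pos.mpr hy
  set w := 2 * Real.pi * τ.im with hw_def
  have hw : 0 < w := by positivity
  have hwi : 2 * w⁻¹ ≤ τ.im⁻¹ := by
    rw [hw_def, mul_inv, mul_inv]
    have : Real.pi⁻¹ ≤ 1 := inv_le_one_of_one_le₀ (by linarith [Real.pi_gt_three])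
    nlinarith
  have hq : ∀ n : ℕ, ‖ModularForm.eta_q n τ‖ = Real.exp (-w) ^ (n + 1) := by
    intro n
    rw [ModularForm.eta_q_eq_pow, norm_pow]
    have := norm_exp_mul τ 1
    rw [Complex.ofReal_one, mul_one, mul_one] at this
    rw [this]
    rfl
  have hq24 : ‖Function.Periodic.qParam 24 τ‖ = Real.exp (-(w / 24)) := by
    rw [Function.Periodic.norm_qParam]
    congr 1
    rw [hw_def, UpperHalfPlane.coe_im]
    ring
  have hlim := (ModularForm.multipliableLocallyUniformlyOn_eta.multipliable
    τ.im_pos).hasProd.tendsto_prod_nat.norm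
  have hup : ‖∏' n, (1 - ModularForm.eta_q n τ)‖ ≤ Real.exp w⁻¹ := by
    refine le_of_tendsto' hlim fun N => ?_
    rw [norm_prod]
    refine le_trans (Finset.prod_le_prod (fun n _ => norm_nonneg _) fun n _ => ?_)
      (prod_one_add_exp_le hw N)
    refine (norm_sub_le _ _).trans (le_of_eq ?_)
    rw [norm_one, hq]
  have hlow : Real.exp (-(2 * w⁻¹)) ≤ ‖∏' n, (1 - ModularForm.eta_q n τ)‖ := by
    refine ge_of_tendsto' hlim fun N => ?_
    rw [norm_prod]
    refine (exp_neg_le_prod_one_sub hw N).trans (Finset.prod_le_prod (fun n _ => ?_) fun n _ => ?_)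
    · have : Real.exp (-w) < 1 := Real.exp_lt_one_iff.mpr (by linarith)
      have h : Real.exp (-w) ^ (n + 1) < 1 :=
        pow_lt_one₀ (Real.exp_pos (-w)).le this n.succ_ne_zero
      linarith
    · have := norm_sub_norm_le 1 (ModularForm.eta_q n τ)
      rwa [norm_one, hq] at this
  have hw24 : w / 24 ≤ τ.im := by
    rw [hw_def]
    nlinarith [Real.pi_lt_d2]
  rw [ModularForm.eta, norm_mul, hq24]
  constructor
  · calc Real.exp (-(w / 24)) * ‖∏' n, (1 - ModularForm.eta_q n τ)‖
        ≤ Real.exp (-(w / 24)) * Real.exp w⁻¹ := by gcongr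
      _ = Real.exp (-(w / 24) + w⁻¹) := (Real.exp_add _ _).symm
      _ ≤ _ := Real.exp_le_exp.mpr (by
        have := inv_pos.mpr hw
        linarith [div_pos hw (by norm_num : (0 : ℝ) < 24)])
  · calc Real.exp (-(τ.im + τ.im⁻¹)) ≤ Real.exp (-(w / 24) + -(2 * w⁻¹)) :=
          Real.exp_le_exp.mpr (by linarith)
      _ = Real.exp (-(w / 24)) * Real.exp (-(2 * w⁻¹)) := Real.exp_add _ _
      _ ≤ _ := by gcongr

theorem exponentialGrowth_etaQuotient : ExponentialGrowth etaQuotient := by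
  -- The eta bounds at `τ`, `2τ` and `τ/2` add up to `7/2` times `Im τ + 1/Im τ`, so `6` is ample.
  refine ⟨6, fun τ => ?_⟩
  have hy := τ.im_pos
  have hyi := inv_pos.mpr hy
  have h1 := (norm_eta_bounds τ).1
  have h2 := (norm_eta_bounds ((⟨2, two_pos⟩ : {x : ℝ // 0 < x}) • τ)).2
  have h3 := (norm_eta_bounds ((⟨1 / 2, one_half_pos⟩ : {x : ℝ // 0 < x}) • τ)).2
  rw [coe_two_smul, UpperHalfPlane.pos_real_im] at h2
  rw [coe_half_smul, UpperHalfPlane.pos_real_im] at h3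
  rw [etaQuotient, norm_div, norm_mul, div_le_iff₀ (mul_pos
    (norm_pos_iff.mpr (eta_two_mul_ne_zero τ)) (norm_pos_iff.mpr (eta_div_two_ne_zero τ)))]
  refine h1.trans ?_
  calc Real.exp (τ.im + τ.im⁻¹)
      ≤ 6 * Real.exp (6 * (τ.im + τ.im⁻¹)) * (Real.exp (-(2 * τ.im + (2 * τ.im)⁻¹)) *
          Real.exp (-(1 / 2 * τ.im + (1 / 2 * τ.im)⁻¹))) := by
        rw [mul_assoc, ← Real.exp_add, ← Real.exp_add]
        refine le_trans (Real.exp_le_exp.mpr ?_) (le_mul_of_one_le_left (Real.exp_pos _).le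
          (by norm_num))
        rw [mul_inv, mul_inv]
        norm_num
        linarith
    _ ≤ _ := by gcongr

theorem Tempered.exponentialGrowth_mul {f : UpperHalfPlane → ℂ} (hf : Tempered f) :
    ExponentialGrowth fun τ => etaQuotient τ * f τ := by
  obtain ⟨C, hC⟩ := exponentialGrowth_etaQuotient
  obtain ⟨B, N, hB⟩ := hf.2
  set A := |C| * (|B| * N.factorial) + |C| + 1 with hA
  have hA1 : |C| * (|B| * N.factorial) ≤ A := by
    rw [hA]
    linarith [abs_nonneg C]
  have hA2 : |C| + 1 ≤ A := by
    have : 0 ≤ |C| * (|B| * N.factorial) := by positivity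
    linarith
  refine ⟨A, fun τ => ?_⟩
  have h0 := one_le_im_add_inv τ
  set t := τ.im + τ.im⁻¹ with ht
  have h1 : t ^ N ≤ N.factorial * Real.exp t := by
    have := Real.pow_div_factorial_le_exp t (by linarith) N
    rwa [div_le_iff₀ (by positivity), mul_comm] at this
  calc ‖etaQuotient τ * f τ‖ = ‖etaQuotient τ‖ * ‖f τ‖ := norm_mul _ _
    _ ≤ (|C| * Real.exp (|C| * t)) * (|B| * (N.factorial * Real.exp t)) := by
        refine mul_le_mul ((hC τ).trans ?_) ((hB τ).trans ?_) (norm_nonneg _) (by positivity)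
        · gcongr
          · exact le_abs_self C
          · exact le_abs_self C
        · gcongr
          exact le_abs_self B
    _ = |C| * (|B| * N.factorial) * Real.exp ((|C| + 1) * t) := by
        have h2 : Real.exp ((|C| + 1) * t) = Real.exp (|C| * t) * Real.exp t := by
          rw [← Real.exp_add, add_mul, one_mul]
        rw [h2]
        ring
    _ ≤ A * Real.exp (A * t) := by
        gcongr

/-- Multiplication of a quasimodular form by the eta quotient. -/
theorem IsQuasimodular.etaQuotient_mul {k : ℕ} {f : UpperHalfPlane → ℂ}
    (hf : IsQuasimodular (CongruenceSubgroup.Gamma 4) k f) :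
    IsQuasimodularWith ExponentialGrowth (CongruenceSubgroup.Gamma 4) (-1 / 2 + k) etaMultiplier
      fun τ => etaQuotient τ * f τ := by
  obtain ⟨P, hP, hP1, hP2⟩ := hf.exists_polynomial
  refine ⟨P.natDegree, fun j τ => etaQuotient τ * P.coeff j τ, by subst hP; rfl, fun j _ =>
    ⟨MDifferentiable.mul mdiff_etaQuotient (hP1 j).1, (hP1 j).exponentialGrowth_mul⟩,
    fun γ hγ τ => ?_⟩
  have h := hP2 γ hγ τ
  rw [Polynomial.eval₂_eq_sum_range, Polynomial.eval₂_eq_sum_range] at h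
  simp only [Pi.evalRingHom_apply] at h
  have h2 : autFactor (-1 / 2 + k) γ τ =
      autFactor (-1 / 2) γ τ * UpperHalfPlane.denom γ τ ^ k := by
    rw [autFactor, autFactor, Complex.ofReal_add,
      Complex.cpow_add _ _ (UpperHalfPlane.denom_ne_zero γ τ), Complex.ofReal_natCast,
      Complex.cpow_natCast]
  simp only [mul_assoc]
  rw [← Finset.mul_sum, ← Finset.mul_sum, h, h2, etaQuotient_smul hγ]
  ring

end

section

open scoped ModularForm

/-! ## Taylor coefficients of the characters -/

theorem wt_add (I J : ℕ →₀ ℕ) : wt (I + J) = wt I + wt J :=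
  Finsupp.sum_add_index' (fun _ => by simp) fun _ _ _ => by ring

theorem wt_single (k : ℕ) : wt (Finsupp.single k 1) = 2 * k + 4 := by
  rw [wt, Finsupp.sum_single_index (by simp), mul_one]

theorem wt_eq (I : ℕ →₀ ℕ) : wt I = 2 * (I.sum fun k a => (k + 1) * a) + 2 * I.degree := by
  rw [wt, Finsupp.degree_apply, Finsupp.sum, Finsupp.sum, Finset.mul_sum, Finset.mul_sum,
    ← Finset.sum_add_distrib]
  exact Finset.sum_congr rfl fun k _ => by ring

/-- The Taylor coefficients of the logarithmic derivatives are derivatives of Eisenstein series. -/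
theorem IsModeSeq.coeff_logSeries_eq {lam : ℕ → ℝ} (h : IsModeSeq lam) {ε : ℂ} (hε : ‖ε‖ = 1)
    (c : ℕ → ℂ) (r : ℕ) (b : ℕ →₀ ℕ) (τ : UpperHalfPlane) :
    MvPowerSeries.coeff b (logSeries ε lam c τ r) =
      (2 * Real.pi * Complex.I) ^ b.degree / (b.prod fun _ a => (a.factorial : ℂ)) *
        Derivative.normalizedDerivOfComplex^[b.degree] (fun τ : UpperHalfPlane =>
          c (r + b.sum fun k a => (k + 1) * a) +
            lambert ε lam 0 (2 * (r + b.sum fun k a => (k + 1) * a) + 1) τ) τ := by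
  -- Each `D` raises both Lambert exponents by one, so `|b|` derivatives of the series with odd
  -- exponent `2R+1`, `R = r + ∑ (k+1) b_k`, produce the powers found in the coefficient.
  have h1 : 2 * (r + b.sum fun k a => (k + 1) * a) + 1 + b.degree =
      2 * r + 1 + b.sum fun k a => (2 * k + 3) * a := by
    have h2 : (b.sum fun k a => (2 * k + 3) * a) =
        2 * (b.sum fun k a => (k + 1) * a) + b.degree := by
      rw [Finsupp.degree_apply, Finsupp.sum, Finsupp.sum, Finset.mul_sum,
        ← Finset.sum_add_distrib]
      exact Finset.sum_congr rfl fun k _ => by ring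
    rw [h2]
    ring
  rw [coeff_logSeries, h.iterate_deriv_lambert hε, h1, zero_add]
  -- The constant contributes only at `b = 0`; otherwise at least one derivative kills it.
  by_cases hb : b = 0
  · subst hb
    simp
  · have hd : b.degree ≠ 0 := fun h => hb ((Finsupp.degree_eq_zero_iff b).mp h)
    simp only [if_neg hb, if_neg hd, zero_add]

theorem isQuasimodular_coeff_logSeries {Γ : Subgroup SL(2, ℤ)} {lam : ℕ → ℝ} (h : IsModeSeq lam)
    {ε : ℂ} (hε : ‖ε‖ = 1) {c : ℕ → ℂ}
    (hE : ∀ R, IsQuasimodular Γ (2 * (R + 1)) fun τ : UpperHalfPlane =>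
      c R + lambert ε lam 0 (2 * R + 1) τ) (k : ℕ) (b : ℕ →₀ ℕ) :
    IsQuasimodular Γ (wt (b + Finsupp.single k 1))
      fun τ : UpperHalfPlane => MvPowerSeries.coeff b (logSeries ε lam c τ (k + 1)) := by
  have h1 := ((hE (k + 1 + b.sum fun k a => (k + 1) * a)).iterate_deriv b.degree).smul
    ((2 * Real.pi * Complex.I) ^ b.degree / (b.prod fun _ a => (a.factorial : ℂ)))
  have h2 : 2 * (k + 1 + (b.sum fun k a => (k + 1) * a) + 1) + 2 * b.degree =
      wt (b + Finsupp.single k 1) := by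
    rw [wt_add, wt_single, wt_eq]
    ring
  rw [h2] at h1
  convert h1 using 1
  ext τ
  exact h.coeff_logSeries_eq hε c (k + 1) b τ

theorem exists_eq_add_single {I : ℕ →₀ ℕ} (hI : I ≠ 0) :
    ∃ (J : ℕ →₀ ℕ) (k : ℕ), I = J + Finsupp.single k 1 := by
  obtain ⟨k, hk⟩ := Finsupp.ne_iff.mp hI
  refine ⟨I - Finsupp.single k 1, k, (tsub_add_cancel_of_le ?_).symm⟩
  rw [Finsupp.single_le_iff]
  exact Nat.one_le_iff_ne_zero.mpr hk

/-- The relative Taylor coefficients of a power series with quasimodular logarithmic derivatives are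
quasimodular. -/
theorem isQuasimodular_coeff_div {Γ : Subgroup SL(2, ℤ)} {w : ℂ}
    {W : UpperHalfPlane → MvPowerSeries ℕ ℂ} {H : ℕ → UpperHalfPlane → MvPowerSeries ℕ ℂ}
    (h0 : ∀ τ, MvPowerSeries.constantCoeff (W τ) ≠ 0)
    (hW : ∀ k τ, MvPowerSeries.pderiv ℂ k (W τ) = w • (W τ * H k τ))
    (hH : ∀ k b, IsQuasimodular Γ (wt (b + Finsupp.single k 1))
      fun τ => MvPowerSeries.coeff b (H k τ)) (I : ℕ →₀ ℕ) :
    IsQuasimodular Γ (wt I) fun τ =>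
      MvPowerSeries.coeff I (W τ) / MvPowerSeries.constantCoeff (W τ) := by
  induction hn : I.degree using Nat.strong_induction_on generalizing I with
  | _ n ih =>
    by_cases hI : I = 0
    · subst hI
      have h1 := IsQuasimodular.modular (isHolModular_const Γ 1)
      rw [show wt 0 = 0 from Finsupp.sum_zero_index]
      convert h1 using 1
      ext τ
      rw [MvPowerSeries.coeff_zero_eq_constantCoeff_apply, div_self (h0 τ)]
    · obtain ⟨J, k, rfl⟩ := exists_eq_add_single hI
      have hJ : J.degree + 1 = n := by
        rw [← hn, map_add]
        simp
      -- The coefficient at `J` of `∂_k W = w W H_k` expresses `W_{J+e_k}` through products `W_p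
      -- (H_k)_{p'}` with `p + p' = J`. The degree of `p` is smaller, and `wt p + wt (p' + e_k) = wt
      -- (J + e_k)`.
      have hsum : IsQuasimodular Γ (wt (J + Finsupp.single k 1))
          (∑ p ∈ Finset.HasAntidiagonal.antidiagonal J, (fun τ => MvPowerSeries.coeff p.1 (W τ) /
            MvPowerSeries.constantCoeff (W τ)) * fun τ => MvPowerSeries.coeff p.2 (H k τ)) := by
        refine IsQuasimodular.sum _ fun p hp => ?_
        rw [Finset.HasAntidiagonal.mem_antidiagonal] at hp
        have hdeg : p.1.degree < n := by
          rw [← hJ, ← hp, map_add]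
          omega
        have h1 := (ih _ hdeg p.1 rfl).mul (hH k p.2)
        rwa [← wt_add, ← add_assoc, hp] at h1
      have h2 := hsum.smul (w / ((J k : ℂ) + 1))
      convert h2 using 1
      ext τ
      have hk : ((J k : ℂ) + 1) ≠ 0 := Nat.cast_add_one_ne_zero _
      have h3 := congrArg (MvPowerSeries.coeff J) (hW k τ)
      rw [MvPowerSeries.coeff_pderiv, MvPowerSeries.coeff_smul, MvPowerSeries.coeff_mul] at h3
      rw [Pi.smul_apply, Finset.sum_apply, smul_eq_mul, div_mul_eq_mul_div, eq_div_iff hk,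
        div_mul_eq_mul_div, h3, mul_div_assoc, Finset.sum_div]
      congr 1
      exact Finset.sum_congr rfl fun p _ => by
        rw [Pi.mul_apply]
        ring

theorem isQuasimodular_boson_lambert (R : ℕ) : IsQuasimodular (CongruenceSubgroup.Gamma 4)
    (2 * (R + 1)) fun τ : UpperHalfPlane =>
      bosonConst R + lambert 1 (fun n => n + 1) 0 (2 * R + 1) τ := by
  simp only [← eisG_eq]
  exact isQuasimodular_eisG _ R

theorem fermion_lambert_eq (R : ℕ) : (fun τ : UpperHalfPlane =>
    fermionConst R + lambert (-1) (fun n => n + 1 / 2) 0 (2 * R + 1) τ) = eisCombination (R + 1) := by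
  ext τ
  exact (eisCombination_eq R τ).symm

theorem constantCoeff_cartan (τ : UpperHalfPlane) :
    MvPowerSeries.constantCoeff (genCharacter cartan τ) = etaQuotient τ := by
  rw [cartan_hasGenCharacter.2, map_mul, constantCoeff_boson, constantCoeff_fermion, etaQuotient]
  have h := ModularForm.eta_ne_zero τ.im_pos
  field_simp

theorem pderiv_cartan (k : ℕ) (τ : UpperHalfPlane) :
    MvPowerSeries.pderiv ℂ k (genCharacter cartan τ) = (2 * Real.pi * Complex.I : ℂ) •
      (genCharacter cartan τ * (logSeries 1 (fun n => n + 1) bosonConst τ (k + 1) +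
        logSeries (-1) (fun n => n + 1 / 2) fermionConst τ (k + 1))) := by
  rw [cartan_hasGenCharacter.2, Derivation.leibniz, pderiv_boson, pderiv_fermion]
  simp only [smul_eq_mul, MvPowerSeries.smul_eq_C_mul]
  ring

theorem isQuasimodular_expansionCoeff_div (I : ℕ →₀ ℕ) :
    IsQuasimodular (CongruenceSubgroup.Gamma 4) (wt I) fun τ =>
      expansionCoeff (genCharacter cartan) I τ / expansionCoeff (genCharacter cartan) 0 τ := by
  have h := (isQuasimodular_coeff_div (Γ := CongruenceSubgroup.Gamma 4)
    (W := genCharacter cartan) (fun τ => by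
      rw [constantCoeff_cartan]
      exact etaQuotient_ne_zero τ) pderiv_cartan (fun k b => by
      simp only [map_add]
      exact (isQuasimodular_coeff_logSeries isModeSeq_boson (by simp)
        isQuasimodular_boson_lambert k b).add
        (isQuasimodular_coeff_logSeries isModeSeq_fermion (by simp) (fun R => by
          rw [fermion_lambert_eq]
          exact isQuasimodular_eisCombination R) k b)) I).smul (I.degree.factorial : ℂ)
  convert h using 1
  ext τ
  rw [expansionCoeff, expansionCoeff, MvPowerSeries.coeff_zero_eq_constantCoeff_apply,
    Pi.smul_apply, smul_eq_mul, map_zero, Nat.factorial_zero, Nat.cast_one, one_mul, mul_div_assoc]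

theorem expansionCoeff_cartan_zero (τ : UpperHalfPlane) :
    expansionCoeff (genCharacter cartan) 0 τ = etaQuotient τ := by
  rw [expansionCoeff, MvPowerSeries.coeff_zero_eq_constantCoeff_apply, constantCoeff_cartan,
    map_zero, Nat.factorial_zero, Nat.cast_one, one_mul]

theorem isQuasimodularSeries_cartan :
    IsQuasimodularSeries (CongruenceSubgroup.Gamma 4) (-1 / 2) (genCharacter cartan) := by
  refine ⟨etaMultiplier, isMultiplierSystem_etaMultiplier, fun I => ?_⟩
  have h := (isQuasimodular_expansionCoeff_div I).etaQuotient_mul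
  convert h using 1
  ext τ
  rw [expansionCoeff_cartan_zero, mul_div_cancel₀ _ (etaQuotient_ne_zero τ)]

/-- One derivative turns `log F` into the known logarithmic derivative: the `τ₁`-derivative if `I =
0`, and otherwise `∂/∂τ_{2k+3}` for some `k` in the support of `I`. This accounts for the exponent
`s + |I| - 1`. -/
theorem logTaylor_fermion {s : ℕ} {I : ℕ →₀ ℕ} (hsI : ¬ (s = 0 ∧ I = 0)) :
    logTaylor (genCharacter fermionCartan) s I =
      Derivative.normalizedDerivOfComplex^[s + I.degree - 1]
        (eisCombination ((I.sum fun k a => (k + 1) * a) + 1)) := by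
  have h0 : ∀ τ : UpperHalfPlane,
      MvPowerSeries.constantCoeff (genCharacter fermionCartan τ) ≠ 0 := fun τ => by
    rw [constantCoeff_fermion]
    exact div_ne_zero (pow_ne_zero _ (ModularForm.eta_ne_zero τ.im_pos))
      (mul_ne_zero (eta_two_mul_ne_zero τ) (eta_div_two_ne_zero τ))
  by_cases hI : I = 0
  · subst hI
    rw [logTaylor, if_pos rfl, map_zero, add_zero, Finsupp.sum_zero_index, zero_add]
    congr 1
    ext τ
    rw [isModeSeq_fermion.deriv_constantCoeff (ε := -1) (by simp) occupation_injective fermionConst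
      fermion_hasGenCharacter.2
      (fun _ _ _ => fermion_occupation_relation (fermion_hasGenCharacter.2 _)) τ,
      mul_div_cancel_left₀ _ (h0 τ)]
    exact congrFun (fermion_lambert_eq 0) τ
  · rw [logTaylor, if_neg hI]
    obtain ⟨J, k, rfl⟩ := exists_eq_add_single hI
    have hdeg : (J + Finsupp.single k 1).degree = J.degree + 1 := by
      rw [map_add]
      simp
    rw [hdeg, show s + (J.degree + 1) - 1 = s + J.degree by omega, Function.iterate_add_apply]
    congr 1
    ext τ
    have h1 := logCoeff_add_single (h0 τ) (pderiv_fermion τ k) J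
    rw [isModeSeq_fermion.coeff_logSeries_eq (by simp), fermion_lambert_eq] at h1
    have h2 : (k + 1 + J.sum fun k a => (k + 1) * a) =
        (J + Finsupp.single k 1).sum fun k a => (k + 1) * a := by
      rw [Finsupp.sum_add_index' (by simp) (fun _ _ _ => by ring),
        Finsupp.sum_single_index (by simp)]
      ring
    rw [h2] at h1
    -- The factorials of `I = J + e_k` exceed those of `J` by the factor `J k + 1` produced by
    -- differentiating.
    have h3 : ((J + Finsupp.single k 1).prod fun _ a => (a.factorial : ℂ)) =
        (J.prod fun _ a => (a.factorial : ℂ)) * ((J k : ℂ) + 1) := by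
      have hk : k ∈ insert k J.support := Finset.mem_insert_self _ _
      rw [Finsupp.prod_of_support_subset J (Finset.subset_insert k J.support) _ (by simp),
        Finsupp.prod_of_support_subset (J + Finsupp.single k 1) (s := insert k J.support)
          (Finsupp.support_add.trans (Finset.union_subset (Finset.subset_insert k J.support)
            (Finsupp.support_single_subset.trans (by simp)))) _ (by simp),
        ← Finset.mul_prod_erase _ _ hk, ← Finset.mul_prod_erase _ _ hk]
      have h6 : ∀ i ∈ (insert k J.support).erase k,
          (((J + Finsupp.single k 1 : ℕ →₀ ℕ) i).factorial : ℂ) = ((J i).factorial : ℂ) := fun i hi => by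
        rw [Finsupp.add_apply, Finsupp.single_eq_of_ne (Finset.ne_of_mem_erase hi), add_zero]
      rw [Finset.prod_congr rfl h6, Finsupp.add_apply, Finsupp.single_eq_same, Nat.factorial_succ]
      push_cast
      ring
    have h4 : (J.prod fun _ a => (a.factorial : ℂ)) ≠ 0 :=
      Finset.prod_ne_zero_iff.mpr fun _ _ => Nat.cast_ne_zero.mpr (Nat.factorial_ne_zero _)
    have h5 : (2 * Real.pi * Complex.I : ℂ) ≠ 0 := Complex.two_pi_I_ne_zero
    rw [h3, div_eq_iff (pow_ne_zero _ h5), mul_assoc, mul_comm ((J k : ℂ) + 1), h1, pow_succ]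
    field_simp

theorem isQuasimodularForm_logTaylor_fermion {s : ℕ} {I : ℕ →₀ ℕ} (hsI : ¬ (s = 0 ∧ I = 0)) :
    IsQuasimodularForm (CongruenceSubgroup.Gamma 4) (2 * s + wt I)
      (logTaylor (genCharacter fermionCartan) s I) := by
  have h := (isQuasimodular_eisCombination (I.sum fun k a => (k + 1) * a)).iterate_deriv
    (s + I.degree - 1)
  rw [← logTaylor_fermion hsI] at h
  have hpos : 1 ≤ s + I.degree := by
    by_contra hlt
    exact hsI ⟨by omega, (Finsupp.degree_eq_zero_iff I).mp (by omega)⟩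
  have hw : 2 * ((I.sum fun k a => (k + 1) * a) + 1) + 2 * (s + I.degree - 1) = 2 * s + wt I := by
    rw [wt_eq]
    omega
  rw [hw] at h
  exact h.isQuasimodularForm

end

end FreeFieldCharacter

end

open FreeFieldCharacter in
theorem mainTheorem3 :
    -- the generalized characters of `M(1)`, `F` and `W = M(1) ⊗ F` are well defined
    HasGenCharacter bosonCartan ∧ HasGenCharacter fermionCartan ∧ HasGenCharacter cartan ∧
    -- the character of `W` is the product of the bosonic and the fermionic factor
    (∀ τ : UpperHalfPlane,
      genCharacter cartan τ = genCharacter bosonCartan τ * genCharacter fermionCartan τ) ∧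
    -- the character of `W` is quasimodular of weight `-1/2`
    IsQuasimodularSeries (CongruenceSubgroup.Gamma 4) (-1 / 2) (genCharacter cartan) ∧
    -- its leading coefficient, and its coefficients relative to the leading one
    (∀ τ : UpperHalfPlane, expansionCoeff (genCharacter cartan) 0 τ =
      ModularForm.eta τ / (ModularForm.eta (2 * τ) * ModularForm.eta (τ / 2))) ∧
    (∀ I : ℕ →₀ ℕ, IsQuasimodularForm (CongruenceSubgroup.Gamma 4) (wt I)
      fun τ => expansionCoeff (genCharacter cartan) I τ /
        expansionCoeff (genCharacter cartan) 0 τ) ∧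
    -- the fermionic factor: leading coefficient and Taylor coefficients of the logarithm
    (∀ τ : UpperHalfPlane, MvPowerSeries.constantCoeff (genCharacter fermionCartan τ) =
      ModularForm.eta τ ^ 2 / (ModularForm.eta (2 * τ) * ModularForm.eta (τ / 2))) ∧
    (∀ (s : ℕ) (I : ℕ →₀ ℕ), ¬ (s = 0 ∧ I = 0) →
      logTaylor (genCharacter fermionCartan) s I =
        Derivative.normalizedDerivOfComplex^[s + I.degree - 1]
          (eisCombination ((I.sum fun k a => (k + 1) * a) + 1)) ∧
      IsQuasimodularForm (CongruenceSubgroup.Gamma 4) (2 * s + wt I)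
        (logTaylor (genCharacter fermionCartan) s I)) := by
  exact ⟨boson_hasGenCharacter.1, fermion_hasGenCharacter.1, cartan_hasGenCharacter.1,
    cartan_hasGenCharacter.2, isQuasimodularSeries_cartan, expansionCoeff_cartan_zero,
    fun I => (isQuasimodular_expansionCoeff_div I).isQuasimodularForm, constantCoeff_fermion,
    fun _ _ h => ⟨logTaylor_fermion h, isQuasimodularForm_logTaylor_fermion h⟩⟩
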